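/- **Setting.** Let $N,p\ge 0$ be integers. Let $\varrho$ be a finite-dimensional complex matrix representation of $gl(N)$, whose basis $T^\mu_\nu$ consists of the matrix units, $[T^\mu_\nu,T^\sigma_\tau]=\delta^\sigma_\nu T^\mu_\tau-\delta^\mu_\tau T^\sigma_\nu$, and let $k_0,k_1,k_2$ be numbers with $$\mathrm{tr}\,\varrho(T^\mu_\nu)=k_0\delta^\mu_\nu,\qquad \mathrm{tr}\,\varrho(T^\mu_\nu)\varrho(T^\sigma_\tau)=k_1\delta^\mu_\tau\delta^\sigma_\nu+k_2\delta^\mu_\nu\delta^\sigma_\tau .$$ Let $\mathfrak g$ be a finite-dimensional complex Lie algebra with basis $J^a$, let $\delta^{ab}$ be (the matrix of) a symmetric invariant bilinear form on $\mathfrak g$ and $\delta^a$ (the components of) a linear functional that vanishes on $[\mathfrak g,\mathfrak g]$. Let $M$ be a finite-dimensional matrix representation of $\mathfrak g$, $M^a=M(J^a)$, such that $$\mathrm{tr}\,M^a=z_M\delta^a,\qquad \mathrm{tr}\,M^aM^b=y_M\delta^{ab}+w_M\delta^a\delta^b .$$ Let $V=\varrho\otimes M$ and let $\lambda,w\in\mathbb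 C$. The summation convention is used. Vector fields $\xi=\xi^\mu(x)\partial_\mu$ and $\mathfrak g$-valued functions $X=X_a(x)J^a$ on $N$-dimensional space are polynomial, $\mu=0,\dots,N-1$, and functions $f(t)$ on the circle of length $2\pi$ are trigonometric polynomials. In every $\pm$ or $\mp$ the upper sign is for bosonic and the lower for fermionic $\phi$. **The algebra $DGRO(N,\mathfrak g)$.** $Obs(N)$ is the space of local functionals $\int dt\,P(t,q(t),\dot q(t),\ddot q(t),\dots)$ of a trajectory $q^\mu(t)$, $P$ polynomial in finitely many derivatives of $q$ with trigonometric polynomials in $t$ as coefficients, modulo $\int dt\,\frac{d}{dt}P=0$. For parameters $c_1,\dots,c_8,a_3,a_6$, $DGRO(N,\mathfrak g)$ is spanned by $\mathcal L_\xi$, $L_f$, $\mathcal J_X$ (linear in $\xi$, $f$, $X$) and $Obs(N)$, with brackets $$\begin{aligned} [\mathcal L_\xi,\mathcal L_\eta]&=\mathcal L_{[\xi,\eta]}+\tfrac1{2\pi i}\int dt\,\dot q^\rho\big(c_1\,\partial_\rho\partial_\nu\xi^\mu\,\partial_\mu\eta^\nu+c_2\,\partial_\rho\partial_\mu\xi^\mu\,\partial_\nu\eta^\nu\big)(q(t)),\\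 [L_f,\mathcal L_\xi]&=\tfrac1{4\pi i}\int dt\,(c_3\ddot f-ia_3\dot f)\,\partial_\mu\xi^\mu(q(t)),\\ [L_f,L_g]&=L_{f\dot g-g\dot f}+\tfrac{c_4}{24\pi i}\int dt\,(\ddot f\dot g-\dot f g),\\ [\mathcal J_X,\mathcal J_Y]&=\mathcal J_{[X,Y]}-\tfrac1{2\pi i}(c_5\delta^{ab}+c_8\delta^a\delta^b)\int dt\,\dot q^\rho\,\partial_\rho X_a(q(t))\,Y_b(q(t)),\\ [L_f,\mathcal J_X]&=\tfrac1{4\pi i}\delta^a\int dt\,(c_6\ddot f-ia_6\dot f)\,X_a(q(t)),\\ [\mathcal L_\xi,\mathcal J_X]&=\mathcal J_{\xi^\mu\partial_\mu X}-\tfrac{c_7}{2\pi i}\delta^a\int dt\,\dot q^\rho\,X_a(q(t))\,\partial_\rho\partial_\mu\xi^\mu(q(t)),\\ [\mathcal L_\xi,q^\mu(t)]&=\xi^\mu(q(t)),\qquad [L_f,q^\mu(t)]=-f(t)\dot q^\mu(t),\qquad [\mathcal J_X,q^\mu(t)]=[q^\mu(s),q^\nu(t)]=0, \end{aligned}$$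 the last line being extended to $Obs(N)$ by Leibniz' rule and linearity. Here $[X,Y]$ is the pointwise bracket. **Fock space.** Consider fields $q^\mu(t),p_\mu(t),\phi_{\alpha,\mathbf m}(t),\pi^{\alpha,\mathbf m}(t)$, where $\alpha$ labels a basis of $V$ and $\mathbf m$ runs over multi-indices in $\mathbb N^N$ with $|\mathbf m|\le p$, each expanded as $A(t)=\sum_{n\in\mathbb Z}\hat A(n)e^{-int}$. The Fock space $J^p\mathcal F$ is the quotient of the associative algebra generated by all modes, subject to the graded commutation relations $[p_\mu(s),q^\nu(t)]=\delta^\nu_\mu\delta(s-t)$ and $[\pi^{\alpha,\mathbf m}(s),\phi_{\beta,\mathbf n}(t)]=\delta^\alpha_\beta\delta^{\mathbf m}_{\mathbf n}\delta(s-t)$ (all other graded commutators vanish), by the left ideal generated by $\hat q^\mu(n),\hat\phi_{\alpha,\mathbf m}(n)$, $n<0$, and $\hat p_\mu(n),\hat\pi^{\alpha,\mathbf m}(n)$, $n\le0$. For a momentum $P$ ($=p_\mu$ or $\pi^{\alpha,\mathbf m}$) with positive and non-positive frequency parts $P_>$ and $P_\le$, the normal ordering is ${:}P(t)G(t){:}=P_>(t)G(t)\pm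 G(t)P_\le(t)$, always with the sign $+$ for $P=p_\mu$. Set $$T^{\mathbf m}_{\mathbf n}(\xi)=\tbinom{\mathbf n}{\mathbf m}\partial_{\mathbf n-\mathbf m+\underline\nu}\xi^\mu\,\varrho(T^\nu_\mu)\otimes1+\sum_{\mu:\ \mathbf m-\underline\mu\ne\mathbf n}\tbinom{\mathbf n}{\mathbf m-\underline\mu}\partial_{\mathbf n-\mathbf m+\underline\mu}\xi^\mu,\qquad J^{\mathbf m}_{\mathbf n}(X)=\tbinom{\mathbf n}{\mathbf m}\partial_{\mathbf n-\mathbf m}X_a\,1\otimes M^a,$$ where $\underline\mu$ is the unit multi-index in direction $\mu$. **Theorem.** The following operators on $J^p\mathcal F$ are well defined (every infinite sum of products of modes is finite on each vector), and together with the operators $\int dt\,P(t,q(t),\dot q(t),\dots)$ they are a realization of $DGRO(N,\mathfrak g)$, that is, a linear map from $DGRO(N,\mathfrak g)$ to operators on $J^p\mathcal F$ that takes brackets to commutators: $$\begin{aligned} \mathcal L_\xi&=\int dt\,\Big({:}\xi^\mu(q(t))p_\mu(t){:}\mp\sum_{|\mathbf m|\le|\mathbf n|\le p}{:}\pi^{,\mathbf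 n}(t)\,T^{\mathbf m}_{\mathbf n}(\xi)(q(t))\,\phi_{,\mathbf m}(t){:}\Big),\\ \mathcal J_X&=\int dt\,J(X(q(t)),t),\qquad J(X(q(t)),t)=\mp\sum_{|\mathbf m|\le|\mathbf n|\le p}{:}\pi^{,\mathbf n}(t)\,J^{\mathbf m}_{\mathbf n}(X)(q(t))\,\phi_{,\mathbf m}(t){:}\,,\\ L_f&=\int dt\,f(t)L(t),\qquad L(t)=-{:}\dot q^\mu(t)p_\mu(t){:}\pm\sum_{|\mathbf m|\le p}\Big\{-{:}\pi^{,\mathbf m}\dot\phi_{,\mathbf m}{:}+\lambda\tfrac{d}{dt}{:}\pi^{,\mathbf m}\phi_{,\mathbf m}{:}+iw\,{:}\pi^{,\mathbf m}\phi_{,\mathbf m}{:}\Big\}\\ &\qquad\pm\tbinom{N+p}{p}\dim\varrho\,\dim M\,\frac{\lambda-\lambda^2-w+w^2}{4\pi i}. \end{aligned}$$ The parameters are (with $\binom nk=0$ for $k<0$; in the binomials with lower entry $p-j$ read $\binom{N+p}{p-1}=\binom{N+p}{N+1}$, $\binom{N+p}{p-2}=\binom{N+p}{N+2}$, $\binom{N+p+1}{p-1}=\binom{N+p+1}{N+2}$)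 $$\begin{aligned} c_5&=\mp y_M\tbinom{N+p}{p}\dim\varrho, & c_8&=\mp w_M\tbinom{N+p}{p}\dim\varrho,\\ c_6&=\pm z_M(2\lambda-1)\tbinom{N+p}{p}\dim\varrho, & a_6&=\pm z_M(2w-1)\tbinom{N+p}{p}\dim\varrho,\\ c_7&=\mp z_M\Big(\tbinom{N+p}{p}k_0+\tbinom{N+p}{p-1}\dim\varrho\Big), \end{aligned}$$ and $$\begin{aligned} c_1&=1\pm\dim M\Big(\tbinom{N+p}{p}k_1+\tbinom{N+p+1}{p-1}\dim\varrho\Big),\\ c_2&=\pm\dim M\Big(\tbinom{N+p}{p}k_2+\tbinom{N+p}{p-2}\dim\varrho+2\tbinom{N+p}{p-1}k_0\Big),\\ c_3&=1\pm(2\lambda-1)\dim M\Big(\tbinom{N+p}{p}k_0+\tbinom{N+p}{p-1}\dim\varrho\Big),\\ a_3&=1\pm(2w-1)\dim M\Big(\tbinom{N+p}{p}k_0+\tbinom{N+p}{p-1}\dim\varrho\Big),\\ c_4&=2N\pm2(1-6\lambda+6\lambda^2)\tbinom{N+p}{p}\dim\varrho\,\dim M . \end{aligned}$$ -/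

import Mathlib

attribute [local instance] LieRing.ofAssociativeRing

noncomputable section

namespace JetFock

/-! ## Polynomials, trigonometric polynomials, local functionals -/

/-- Polynomial functions on `N`-dimensional spacetime. -/
abbrev Poly (N : ℕ) : Type := MvPolynomial (Fin N) ℂ

/-- A polynomial vector field `ξ = ξ^μ(x) ∂_μ`, given by its components. -/
abbrev VecField (N : ℕ) : Type := Fin N → Poly N

/-- Trigonometric polynomials on the circle; the basis element `T n` stands for `exp (-i n t)`. -/
abbrev Trig : Type := LaurentPolynomial ℂ

/-- The linear map `d/dt` on trigonometric polynomials: `exp (-i n t) ↦ -i n exp (-i n t)`. -/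
def trigDerivLin : Trig →ₗ[ℂ] Trig :=
  (AddMonoidAlgebra.coeffLinearEquiv ℂ).symm.toLinearMap ∘ₗ
    Finsupp.lsum ℂ (fun n : ℤ => (-Complex.I * (n : ℂ)) • Finsupp.lsingle n) ∘ₗ
      (AddMonoidAlgebra.coeffLinearEquiv ℂ).toLinearMap

theorem trigDerivLin_single (n : ℤ) (a : ℂ) :
    trigDerivLin (AddMonoidAlgebra.single n a) =
      AddMonoidAlgebra.single n (-Complex.I * (n : ℂ) * a) := by
  have h : (Finsupp.lsum ℂ (fun n : ℤ => (-Complex.I * (n : ℂ)) • Finsupp.lsingle n) :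
      (ℤ →₀ ℂ) →ₗ[ℂ] (ℤ →₀ ℂ)) (Finsupp.single n a) =
      Finsupp.single n (-Complex.I * (n : ℂ) * a) := by
    rw [Finsupp.lsum_single, LinearMap.smul_apply, Finsupp.lsingle_apply, Finsupp.smul_single,
      smul_eq_mul]
  exact congrArg AddMonoidAlgebra.ofCoeff h

/-- `d/dt` on trigonometric polynomials, as a derivation. -/
def trigDeriv : Derivation ℂ Trig Trig :=
  Derivation.mk' trigDerivLin (by
    intro a b
    induction a using AddMonoidAlgebra.induction_linear with
    | zero => simp
    | add p q hp hq => rw [add_mul, map_add, hp, hq, map_add, add_smul, smul_add]; abel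
    | single m x =>
      induction b using AddMonoidAlgebra.induction_linear with
      | zero => simp
      | add p q hp hq => rw [mul_add, map_add, hp, hq, map_add, add_smul, smul_add]; abel
      | single n y =>
        simp only [smul_eq_mul, AddMonoidAlgebra.single_mul_single, trigDerivLin_single]
        rw [add_comm n m, ← AddMonoidAlgebra.single_add]
        congr 1
        push_cast
        ring)

/-- Polynomials in `q^μ(t), dq^μ/dt, d²q^μ/dt², …` with trigonometric polynomials in `t` as
coefficients: the variable `(μ, k)` stands for `d^k q^μ / dt^k`. -/
abbrev DiffPoly (N : ℕ) : Type := MvPolynomial (Fin N × ℕ) Trig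

/-- Coefficientwise application of `d/dt`. -/
def explicitDerivLin (N : ℕ) : DiffPoly N →ₗ[ℂ] DiffPoly N :=
  (AddMonoidAlgebra.coeffLinearEquiv ℂ).symm.toLinearMap ∘ₗ
    Finsupp.mapRange.linearMap trigDeriv.toLinearMap ∘ₗ
      (AddMonoidAlgebra.coeffLinearEquiv ℂ).toLinearMap

theorem explicitDerivLin_single {N : ℕ} (s : Fin N × ℕ →₀ ℕ) (a : Trig) :
    explicitDerivLin N (AddMonoidAlgebra.single s a) =
      AddMonoidAlgebra.single s (trigDeriv a) := by
  simp [explicitDerivLin]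

/-- The derivative with respect to the explicit dependence on `t`. -/
def explicitDeriv (N : ℕ) : Derivation ℂ (DiffPoly N) (DiffPoly N) :=
  Derivation.mk' (explicitDerivLin N) (by
    intro a b
    induction a using AddMonoidAlgebra.induction_linear with
    | zero => simp
    | add p q hp hq => rw [add_mul, map_add, hp, hq, map_add, add_smul, smul_add]; abel
    | single m x =>
      induction b using AddMonoidAlgebra.induction_linear with
      | zero => simp
      | add p q hp hq => rw [mul_add, map_add, hp, hq, map_add, add_smul, smul_add]; abel
      | single n y =>
        simp only [smul_eq_mul, AddMonoidAlgebra.single_mul_single, explicitDerivLin_single,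
          Derivation.leibniz]
        rw [add_comm n m, ← AddMonoidAlgebra.single_add])

/-- The total derivative `d/dt`: `d^k q^μ/dt^k ↦ d^(k+1) q^μ/dt^(k+1)`, and coefficients are
differentiated as functions of `t`. -/
def totalDeriv (N : ℕ) : Derivation ℂ (DiffPoly N) (DiffPoly N) :=
  explicitDeriv N +
    (MvPolynomial.mkDerivation Trig
      (fun v : Fin N × ℕ => (MvPolynomial.X (v.1, v.2 + 1) : DiffPoly N))).restrictScalars ℂ

/-- The derivation induced by the infinitesimal variation `q^μ(t) ↦ Q^μ(t)` of the trajectory; it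
is extended to the time derivatives of `q` by `d^k q^μ/dt^k ↦ d^k Q^μ/dt^k` and to all polynomials
by Leibniz' rule and linearity. -/
def variation {N : ℕ} (Q : Fin N → DiffPoly N) : Derivation Trig (DiffPoly N) (DiffPoly N) :=
  MvPolynomial.mkDerivation Trig (fun v : Fin N × ℕ => (totalDeriv N)^[v.2] (Q v.1))

theorem explicitDeriv_C {N : ℕ} (a : Trig) :
    explicitDeriv N (MvPolynomial.C a) = MvPolynomial.C (trigDeriv a) :=
  explicitDerivLin_single 0 a

theorem explicitDeriv_X {N : ℕ} (v : Fin N × ℕ) :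
    explicitDeriv N (MvPolynomial.X v) = 0 := by
  have h := explicitDerivLin_single (N := N) (Finsupp.single v 1) 1
  rw [Derivation.map_one_eq_zero, AddMonoidAlgebra.single_zero] at h
  exact h

theorem totalDeriv_C {N : ℕ} (a : Trig) :
    totalDeriv N (MvPolynomial.C a) = MvPolynomial.C (trigDeriv a) := by
  simp [totalDeriv, explicitDeriv_C]

theorem totalDeriv_X {N : ℕ} (v : Fin N × ℕ) :
    totalDeriv N (MvPolynomial.X v) = MvPolynomial.X (v.1, v.2 + 1) := by
  simp [totalDeriv, explicitDeriv_X]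

theorem variation_totalDeriv {N : ℕ} (Q : Fin N → DiffPoly N) (P : DiffPoly N) :
    variation Q (totalDeriv N P) = totalDeriv N (variation Q P) := by
  induction P using MvPolynomial.induction_on with
  | C a => simp [totalDeriv_C, variation]
  | add p q hp hq => simp only [map_add, hp, hq]
  | mul_X p v hp =>
    have hX : variation Q (totalDeriv N (MvPolynomial.X v)) =
        totalDeriv N (variation Q (MvPolynomial.X v)) := by
      rw [totalDeriv_X, variation, MvPolynomial.mkDerivation_X, MvPolynomial.mkDerivation_X,
        Function.iterate_succ_apply']
    simp only [Derivation.leibniz, map_add, smul_eq_mul, hp, hX]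
    ring

/-- The observer algebra: local functionals `∫ dt P(t, q, dq/dt, …)`, that is, differential
polynomials modulo total time derivatives. -/
abbrev Obs (N : ℕ) : Type :=
  DiffPoly N ⧸ LinearMap.range (totalDeriv N).toLinearMap

/-- The local functional `∫ dt P(t)`. -/
def functional {N : ℕ} : DiffPoly N →ₗ[ℂ] Obs N :=
  (LinearMap.range (totalDeriv N).toLinearMap).mkQ

/-- The action of a variation of the trajectory on local functionals. -/
def variationObs {N : ℕ} (Q : Fin N → DiffPoly N) : Obs N →ₗ[ℂ] Obs N :=
  Submodule.mapQ _ _ ((variation Q).toLinearMap.restrictScalars ℂ) (by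
    rintro _ ⟨P, rfl⟩
    exact ⟨variation Q P, (variation_totalDeriv Q P).symm⟩)

/-! ## The algebra `DGRO(N, 𝔤)` -/

/-- The commutator of vector fields, `[ξ, η]^μ = ξ^ν ∂_ν η^μ - η^ν ∂_ν ξ^μ`. -/
def vecBracket {N : ℕ} (ξ η : VecField N) : VecField N := fun μ =>
  ∑ ν, (ξ ν * MvPolynomial.pderiv ν (η μ) - η ν * MvPolynomial.pderiv ν (ξ μ))

/-- The divergence `∂_μ ξ^μ`. -/
def divergence {N : ℕ} (ξ : VecField N) : Poly N := ∑ μ, MvPolynomial.pderiv μ (ξ μ)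

/-- The commutator of vector fields on the circle, `[f, g] = f g' - g f'`. -/
def circleBracket (f g : Trig) : Trig := f * trigDeriv g - g * trigDeriv f

/-- The pointwise bracket of `𝔤`-valued functions `X = X_a(x) J^a`, in coordinates with respect to
the basis `J`. -/
def gaugeBracket {N dg : ℕ} {𝔤 : Type*} [LieRing 𝔤] [LieAlgebra ℂ 𝔤]
    (J : Module.Basis (Fin dg) ℂ 𝔤) (X Y : Fin dg → Poly N) : Fin dg → Poly N := fun c =>
  ∑ a, ∑ b, MvPolynomial.C (J.repr ⁅J a, J b⁆ c) * X a * Y b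

/-- The derivative `ξ^μ ∂_μ X` of a `𝔤`-valued function along a vector field. -/
def alongVec {N dg : ℕ} (ξ : VecField N) (X : Fin dg → Poly N) : Fin dg → Poly N := fun a =>
  ∑ μ, ξ μ * MvPolynomial.pderiv μ (X a)

/-- The function `P(q(t))`. -/
def atTraj {N : ℕ} : Poly N →ₐ[ℂ] DiffPoly N :=
  MvPolynomial.aeval (fun μ : Fin N => (MvPolynomial.X (μ, 0) : DiffPoly N))

/-- The velocity `dq^ρ/dt`. -/
def velocity {N : ℕ} (ρ : Fin N) : DiffPoly N := MvPolynomial.X (ρ, 1)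

/-- The parameters of `DGRO(N, 𝔤)`. -/
structure Charges where
  (c₁ c₂ c₃ a₃ c₄ c₅ c₆ a₆ c₇ c₈ : ℂ)

/-- The variation of the trajectory under `ℒ_ξ + L_f`, namely
`δq^μ(t) = ξ^μ(q(t)) - f(t) dq^μ/dt`. -/
def trajVariation {N : ℕ} (ξ : VecField N) (f : Trig) : Fin N → DiffPoly N := fun μ =>
  atTraj (ξ μ) - MvPolynomial.C f * velocity μ

/-- The extension in `[ℒ_ξ, ℒ_η]`. -/
def cocycleDiff {N : ℕ} (c : Charges) (ξ η : VecField N) : Obs N :=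
  (1 / (2 * (Real.pi : ℂ) * Complex.I)) • functional (∑ ρ, velocity ρ * atTraj (
    MvPolynomial.C c.c₁ * (∑ μ, ∑ ν,
      MvPolynomial.pderiv ρ (MvPolynomial.pderiv ν (ξ μ)) * MvPolynomial.pderiv μ (η ν)) +
    MvPolynomial.C c.c₂ * (∑ μ, ∑ ν,
      MvPolynomial.pderiv ρ (MvPolynomial.pderiv μ (ξ μ)) * MvPolynomial.pderiv ν (η ν))))

/-- The extension in `[L_f, ℒ_ξ]`. -/
def cocycleRepDiff {N : ℕ} (c : Charges) (f : Trig) (ξ : VecField N) : Obs N :=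
  (1 / (4 * (Real.pi : ℂ) * Complex.I)) • functional (
    MvPolynomial.C (c.c₃ • trigDeriv (trigDeriv f) - (Complex.I * c.a₃) • trigDeriv f) *
      atTraj (divergence ξ))

/-- The extension in `[L_f, L_g]`. -/
def cocycleRep {N : ℕ} (c : Charges) (f g : Trig) : Obs N :=
  (c.c₄ / (24 * (Real.pi : ℂ) * Complex.I)) • functional (
    MvPolynomial.C (trigDeriv (trigDeriv f) * trigDeriv g - trigDeriv f * g))

/-- The extension in `[𝒥_X, 𝒥_Y]`; `κ` is the metric `δ^{ab}` and `δ` the vector `δ^a`. -/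
def cocycleGauge {N dg : ℕ} {𝔤 : Type*} [LieRing 𝔤] [LieAlgebra ℂ 𝔤]
    (J : Module.Basis (Fin dg) ℂ 𝔤) (κ : LinearMap.BilinForm ℂ 𝔤) (δ : Module.Dual ℂ 𝔤)
    (c : Charges) (X Y : Fin dg → Poly N) : Obs N :=
  (-(1 / (2 * (Real.pi : ℂ) * Complex.I))) • functional (∑ a, ∑ b, ∑ ρ,
    (c.c₅ * κ (J a) (J b) + c.c₈ * δ (J a) * δ (J b)) •
      (velocity ρ * atTraj (MvPolynomial.pderiv ρ (X a) * Y b)))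

/-- The extension in `[L_f, 𝒥_X]`. -/
def cocycleRepGauge {N dg : ℕ} {𝔤 : Type*} [LieRing 𝔤] [LieAlgebra ℂ 𝔤]
    (J : Module.Basis (Fin dg) ℂ 𝔤) (δ : Module.Dual ℂ 𝔤)
    (c : Charges) (f : Trig) (X : Fin dg → Poly N) : Obs N :=
  (1 / (4 * (Real.pi : ℂ) * Complex.I)) • functional (∑ a, δ (J a) •
    (MvPolynomial.C (c.c₆ • trigDeriv (trigDeriv f) - (Complex.I * c.a₆) • trigDeriv f) *
      atTraj (X a)))

/-- The extension in `[ℒ_ξ, 𝒥_X]`. -/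
def cocycleDiffGauge {N dg : ℕ} {𝔤 : Type*} [LieRing 𝔤] [LieAlgebra ℂ 𝔤]
    (J : Module.Basis (Fin dg) ℂ 𝔤) (δ : Module.Dual ℂ 𝔤)
    (c : Charges) (ξ : VecField N) (X : Fin dg → Poly N) : Obs N :=
  (-(c.c₇ / (2 * (Real.pi : ℂ) * Complex.I))) • functional (∑ a, ∑ ρ, δ (J a) •
    (velocity ρ * atTraj (X a * MvPolynomial.pderiv ρ (divergence ξ))))

/-- The vector space underlying `DGRO(N, 𝔤)`, `dg = dim 𝔤`. The element `(ξ, f, X, a)` stands for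
`ℒ_ξ + L_f + 𝒥_X + a`. -/
abbrev DGRO (N dg : ℕ) : Type := VecField N × Trig × (Fin dg → Poly N) × Obs N

/-- The bracket of `DGRO(N, 𝔤)`. -/
def dgroBracket {N dg : ℕ} {𝔤 : Type*} [LieRing 𝔤] [LieAlgebra ℂ 𝔤]
    (J : Module.Basis (Fin dg) ℂ 𝔤) (κ : LinearMap.BilinForm ℂ 𝔤) (δ : Module.Dual ℂ 𝔤)
    (c : Charges) : DGRO N dg → DGRO N dg → DGRO N dg
  | (ξ, f, X, a), (η, g, Y, b) =>
    (vecBracket ξ η,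
     circleBracket f g,
     gaugeBracket J X Y + alongVec ξ Y - alongVec η X,
     variationObs (trajVariation ξ f) b - variationObs (trajVariation η g) a
       + cocycleDiff c ξ η
       + (cocycleRepDiff c f η - cocycleRepDiff c g ξ)
       + cocycleRep c f g
       + cocycleGauge J κ δ c X Y
       + (cocycleRepGauge J δ c f Y - cocycleRepGauge J δ c g X)
       + (cocycleDiffGauge J δ c ξ Y - cocycleDiffGauge J δ c η X))

/-! ## The Fock space -/

/-- The parity of the fields `φ`. -/
inductive Parity
  | boson
  | fermion

/-- The sign `±`: upper for bosons, lower for fermions. -/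
def Parity.sgn : Parity → ℂ
  | .boson => 1
  | .fermion => -1

/-- The Fourier modes of `q^μ(t)`, `p_μ(t)`, `φ_A(t)`, `π^A(t)`, where
`q^μ(t) = ∑ₙ q^μ(n) exp (-i n t)`, etc. The capital index `A` runs over an index set `ι`. -/
inductive Mode (N : ℕ) (ι : Type)
  | q (μ : Fin N) (n : ℤ)
  | p (μ : Fin N) (n : ℤ)
  | φ (A : ι) (n : ℤ)
  | π (A : ι) (n : ℤ)

/-- Whether a mode belongs to `φ` or `π` (as opposed to the observer's trajectory). -/
def Mode.isMatter {N : ℕ} {ι : Type} : Mode N ι → Bool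
  | .q _ _ => false
  | .p _ _ => false
  | .φ _ _ => true
  | .π _ _ => true

/-- The sign in the exchange of two modes. -/
def exchangeSign {N : ℕ} {ι : Type} (s : Parity) (x y : Mode N ι) : ℂ :=
  if x.isMatter && y.isMatter then s.sgn else 1

/-- The graded commutator of two modes. The values are the Fourier coefficients of
`[p_μ(s), q^ν(t)] = δ_μ^ν δ(s - t)` and `[π^A(s), φ_B(t)] = δ^A_B δ(s - t)`, with
`δ(t) = (1 / 2π) ∑ₙ exp (-i n t)`. -/
def modeBracket {N : ℕ} {ι : Type} [DecidableEq ι] (s : Parity) : Mode N ι → Mode N ι → ℂ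
  | .p μ m, .q ν n => if μ = ν ∧ m + n = 0 then 1 / (2 * (Real.pi : ℂ)) else 0
  | .q ν n, .p μ m => if μ = ν ∧ m + n = 0 then -(1 / (2 * (Real.pi : ℂ))) else 0
  | .π A m, .φ B n => if A = B ∧ m + n = 0 then 1 / (2 * (Real.pi : ℂ)) else 0
  | .φ B n, .π A m => if A = B ∧ m + n = 0 then -(s.sgn * (1 / (2 * (Real.pi : ℂ)))) else 0
  | _, _ => 0

/-- The graded commutation relations. -/
inductive HeisRel (N : ℕ) (ι : Type) [DecidableEq ι] (s : Parity) :
    FreeAlgebra ℂ (Mode N ι) → FreeAlgebra ℂ (Mode N ι) → Prop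
  | exchange (x y : Mode N ι) :
      HeisRel N ι s (FreeAlgebra.ι ℂ x * FreeAlgebra.ι ℂ y)
        (exchangeSign s x y • (FreeAlgebra.ι ℂ y * FreeAlgebra.ι ℂ x) +
          algebraMap ℂ (FreeAlgebra ℂ (Mode N ι)) (modeBracket s x y))

/-- The universal enveloping algebra of the graded Heisenberg algebra of the modes (with the central
element equal to `1`). -/
abbrev Heis (N : ℕ) (ι : Type) [DecidableEq ι] (s : Parity) : Type := RingQuot (HeisRel N ι s)

/-- A mode as an element of the enveloping algebra. -/
def heisMode {N : ℕ} {ι : Type} [DecidableEq ι] (s : Parity) (x : Mode N ι) : Heis N ι s :=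
  RingQuot.mkAlgHom ℂ (HeisRel N ι s) (FreeAlgebra.ι ℂ x)

/-- The modes that annihilate the vacuum: negative frequency modes of `q` and `φ`, non-positive
frequency modes of `p` and `π`. -/
def Mode.annihilates {N : ℕ} {ι : Type} : Mode N ι → Prop
  | .q _ n => n < 0
  | .p _ n => n ≤ 0
  | .φ _ n => n < 0
  | .π _ n => n ≤ 0

/-- The left ideal generated by the annihilating modes. -/
def vacuumIdeal (N : ℕ) (ι : Type) [DecidableEq ι] (s : Parity) :
    Submodule (Heis N ι s) (Heis N ι s) :=
  Submodule.span (Heis N ι s) {a | ∃ x : Mode N ι, x.annihilates ∧ heisMode s x = a}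

/-- The Fock space; the vacuum is the class of `1`. -/
abbrev Fock (N : ℕ) (ι : Type) [DecidableEq ι] (s : Parity) : Type :=
  Heis N ι s ⧸ vacuumIdeal N ι s

/-- A mode as an operator on Fock space. -/
def modeOp {N : ℕ} {ι : Type} [DecidableEq ι] (s : Parity) (x : Mode N ι) :
    Module.End ℂ (Fock N ι s) :=
  Algebra.lsmul ℂ ℂ (Fock N ι s) (heisMode s x)

/-! ## Fields and normal ordering -/

section Fields

variable {F : Type*} [AddCommGroup F] [Module ℂ F]

/-- A family of operators is locally finite if only finitely many members act non-trivially on each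
given vector. -/
def OpLocallyFinite {κ : Type*} (A : κ → Module.End ℂ F) : Prop :=
  ∀ v : F, {i | A i v ≠ 0}.Finite

open Classical in
/-- The sum `v ↦ ∑ᵢ Aᵢ v` of a locally finite family of operators (and `0` for other families). -/
def opSum {κ : Type*} (A : κ → Module.End ℂ F) : Module.End ℂ F :=
  if h : OpLocallyFinite A then
    { toFun := fun v => ∑ᶠ i, A i v
      map_add' := fun v w => by
        simp only [map_add]
        exact finsum_add_distrib (h v) (h w)
      map_smul' := fun c v => by
        simp only [map_smul, RingHom.id_apply]
        exact (smul_finsum c _).symm }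
  else 0

/-- An operator-valued field `A(t) = ∑ₙ A(n) exp (-i n t)` on the circle, given by its modes. -/
abbrev OpField (F : Type*) [AddCommGroup F] [Module ℂ F] : Type _ := ℤ → Module.End ℂ F

/-- The time derivative of a field. -/
def timeDeriv (A : OpField F) : OpField F := fun n => (-Complex.I * (n : ℂ)) • A n

/-- The terms of the modes of the product `A(t) B(t)`. -/
def mulTerm (A B : OpField F) (k : ℤ) : ℤ → Module.End ℂ F := fun j => A j * B (k - j)

/-- The product `A(t) B(t)`. -/
def mulField (A B : OpField F) : OpField F := fun k => opSum (mulTerm A B k)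

/-- The constant field `1`. -/
def oneField : OpField F := fun k => if k = 0 then 1 else 0

/-- Products of the fields `Q a`, `a` running through a list. -/
def wordField {σ : Type*} (Q : σ → OpField F) : List σ → OpField F
  | [] => oneField
  | a :: l => mulField (Q a) (wordField Q l)

/-- Monomials in commuting fields. -/
def monoField {σ : Type*} (Q : σ → OpField F) (m : σ →₀ ℕ) : OpField F :=
  wordField Q (Finsupp.toMultiset m).toList

/-- Polynomials with constant coefficients in commuting fields. -/
def polyField {σ : Type*} (Q : σ → OpField F) (P : MvPolynomial σ ℂ) : OpField F := fun k =>
  ∑ m ∈ P.support, P.coeff m • monoField Q m k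

/-- The integral `∫ dt f(t) A(t)` over the circle (of length `2π`). -/
def smear (f : Trig) (A : OpField F) : Module.End ℂ F :=
  (2 * (Real.pi : ℂ)) • ∑ n ∈ f.coeff.support, f.coeff n • A (-n)

/-- The terms of the modes of the normal ordered product of a canonical momentum `P` and a field
`G`. -/
def normalTerm (ε : ℂ) (P G : OpField F) (k : ℤ) : ℤ → Module.End ℂ F := fun j =>
  if 0 < j then P j * G (k - j) else ε • (G (k - j) * P j)

/-- The normal ordered product `:P(t) G(t): = P_>(t) G(t) + ε G(t) P_≤(t)`, where `P_>` and `P_≤`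
are the positive and non-positive frequency parts of `P`. -/
def normalOrdered (ε : ℂ) (P G : OpField F) : OpField F := fun k => opSum (normalTerm ε P G k)

end Fields

/-! ## Jets and the operators on Fock space -/

/-- Multi-indices of length at most `p`. -/
abbrev MultiIdx (N p : ℕ) : Type := {m : Fin N → Fin (p + 1) // ∑ μ, (m μ : ℕ) ≤ p}

/-- The exponents of a multi-index. -/
def MultiIdx.exps {N p : ℕ} (m : MultiIdx N p) : Fin N → ℕ := fun μ => (m.1 μ : ℕ)

/-- The length of a multi-index. -/
def MultiIdx.len {N p : ℕ} (m : MultiIdx N p) : ℕ := ∑ μ, m.exps μ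

/-- Components of `V = ϱ ⊗ M`. -/
abbrev VIdx (dV dM : ℕ) : Type := Fin dV × Fin dM

/-- The indices `A = (α, m)` of the jet coordinates `φ_{α,m}`. -/
abbrev JetIdx (N p dV dM : ℕ) : Type := VIdx dV dM × MultiIdx N p

/-- The partial derivative `∂_m`. -/
def multiDeriv {N : ℕ} (m : Fin N → ℕ) (P : Poly N) : Poly N :=
  (List.finRange N).foldr (fun μ R => (MvPolynomial.pderiv μ)^[m μ] R) P

/-- The binomial coefficient of multi-indices; it vanishes unless `m ≤ n`. -/
def multiChoose {N : ℕ} (n m : Fin N → ℕ) : ℕ := ∏ μ, (n μ).choose (m μ)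

/-- The matrix unit `T^μ_ν` of `gl(N)`. -/
def glUnit {N : ℕ} (μ ν : Fin N) : Matrix (Fin N) (Fin N) ℂ := Matrix.single μ ν 1

/-- The matrix `T^m_n(ξ)` on `ϱ ⊗ M`; `gl(N)` acts in the factor `ϱ`. The second sum runs over the
`μ` for which `m - e_μ` is a multi-index different from `n`. -/
def jetT {N dV dM : ℕ} (ϱ : Matrix (Fin N) (Fin N) ℂ →ₗ⁅ℂ⁆ Matrix (Fin dV) (Fin dV) ℂ)
    (ξ : VecField N) (m n : Fin N → ℕ) : Matrix (VIdx dV dM) (VIdx dV dM) (Poly N) := fun β α =>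
  (∑ μ, ∑ ν, MvPolynomial.C ((multiChoose n m : ℂ) *
      (ϱ (glUnit ν μ) β.1 α.1 * if β.2 = α.2 then 1 else 0)) *
      multiDeriv (n - m + Pi.single ν 1) (ξ μ)) +
  ∑ μ, if 1 ≤ m μ ∧ m - Pi.single μ 1 ≠ n then
      MvPolynomial.C ((multiChoose n (m - Pi.single μ 1) : ℂ) * if β = α then 1 else 0) *
        multiDeriv (n - (m - Pi.single μ 1)) (ξ μ)
    else 0

/-- The matrix `J^m_n(X)` on `ϱ ⊗ M`; `𝔤` acts in the factor `M`. -/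
def jetJ {N dg dV dM : ℕ} {𝔤 : Type*} [LieRing 𝔤] [LieAlgebra ℂ 𝔤]
    (J : Module.Basis (Fin dg) ℂ 𝔤) (M : 𝔤 →ₗ⁅ℂ⁆ Matrix (Fin dM) (Fin dM) ℂ)
    (X : Fin dg → Poly N) (m n : Fin N → ℕ) :
    Matrix (VIdx dV dM) (VIdx dV dM) (Poly N) := fun β α =>
  ∑ a, MvPolynomial.C ((multiChoose n m : ℂ) *
      ((if β.1 = α.1 then 1 else 0) * M (J a) β.2 α.2)) *
    multiDeriv (n - m) (X a)

section Operators

variable (N p dV dM : ℕ) (s : Parity)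

/-- The Fock space `J^p ℱ` of trajectories in the space of `p`-jets. -/
abbrev JetFockSpace : Type := Fock N (JetIdx N p dV dM) s

/-- The field `q^μ(t)`. -/
def qField (μ : Fin N) : OpField (JetFockSpace N p dV dM s) := fun n => modeOp s (.q μ n)

/-- The field `p_μ(t)`. -/
def pField (μ : Fin N) : OpField (JetFockSpace N p dV dM s) := fun n => modeOp s (.p μ n)

/-- The field `φ_{α,m}(t)`. -/
def phiField (A : JetIdx N p dV dM) : OpField (JetFockSpace N p dV dM s) := fun n =>
  modeOp s (.φ A n)

/-- The field `π^{α,m}(t)`. -/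
def piField (A : JetIdx N p dV dM) : OpField (JetFockSpace N p dV dM s) := fun n =>
  modeOp s (.π A n)

/-- The field `P(q(t))`. -/
def trajField (P : Poly N) : OpField (JetFockSpace N p dV dM s) :=
  polyField (qField N p dV dM s) P

/-- The field `d^k q^μ / dt^k`. -/
def qJetField (v : Fin N × ℕ) : OpField (JetFockSpace N p dV dM s) :=
  timeDeriv^[v.2] (qField N p dV dM s v.1)

/-- The operator `∫ dt P(t, q(t), dq/dt, …)`. -/
def obsOp (P : DiffPoly N) : Module.End ℂ (JetFockSpace N p dV dM s) :=
  ∑ m ∈ P.support, smear (P.coeff m) (monoField (qJetField N p dV dM s) m)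

/-- The field `∓ ∑_{|m| ≤ |n| ≤ p} :π^{,n}(t) R^m_n(q(t)) φ_{,m}(t):`, for matrices `R^m_n` of
functions on spacetime. -/
def bilinearField (R : (Fin N → ℕ) → (Fin N → ℕ) → Matrix (VIdx dV dM) (VIdx dV dM) (Poly N)) :
    OpField (JetFockSpace N p dV dM s) := fun k =>
  -s.sgn • ∑ m : MultiIdx N p, ∑ n : MultiIdx N p, if m.len ≤ n.len then
      ∑ β, ∑ α, normalOrdered s.sgn (piField N p dV dM s (β, n))
        (mulField (trajField N p dV dM s (R m.exps n.exps β α))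
          (phiField N p dV dM s (α, m))) k
    else 0

/-- `ℒ_ξ = ∫ dt (:ξ^μ(q(t)) p_μ(t): + T(ξ(q(t)), t))`. -/
def diffOp (ϱ : Matrix (Fin N) (Fin N) ℂ →ₗ⁅ℂ⁆ Matrix (Fin dV) (Fin dV) ℂ) (ξ : VecField N) :
    Module.End ℂ (JetFockSpace N p dV dM s) :=
  smear 1 (fun k => ∑ μ, normalOrdered 1 (pField N p dV dM s μ) (trajField N p dV dM s (ξ μ)) k
    + bilinearField N p dV dM s (jetT ϱ ξ) k)

/-- The field `L(t) = - :(dq^μ/dt) p_μ(t): + L'(t)`, where `L'(t)` is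
`±∑ {-:π^{,m} (dφ_{,m}/dt): + lam :d/dt (π^{,m} φ_{,m}): + i w :π^{,m} φ_{,m}:}` plus the constant
`± C(N+p, p) dim V (lam - lam² - w + w²) / 4πi`. -/
def repField (lam w : ℂ) : OpField (JetFockSpace N p dV dM s) := fun k =>
  -∑ μ, normalOrdered 1 (pField N p dV dM s μ) (timeDeriv (qField N p dV dM s μ)) k
  + s.sgn • ∑ A : JetIdx N p dV dM,
    (-normalOrdered s.sgn (piField N p dV dM s A) (timeDeriv (phiField N p dV dM s A)) k
      + lam • timeDeriv
          (normalOrdered s.sgn (piField N p dV dM s A) (phiField N p dV dM s A)) k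
      + (Complex.I * w) •
          normalOrdered s.sgn (piField N p dV dM s A) (phiField N p dV dM s A) k)
  + (s.sgn * ((N + p).choose p : ℂ) * ((dV : ℂ) * dM) *
      ((lam - lam ^ 2 - w + w ^ 2) / (4 * (Real.pi : ℂ) * Complex.I))) • oneField k

/-- `L_f = ∫ dt f(t) L(t)`. -/
def repOp (lam w : ℂ) (f : Trig) : Module.End ℂ (JetFockSpace N p dV dM s) :=
  smear f (repField N p dV dM s lam w)

/-- `𝒥_X = ∫ dt J(X(q(t)), t)`, with `J(X, t) = ∓∑ :π^{,n}(t) J^m_n(X) φ_{,m}(t):`. -/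
def gaugeOp {dg : ℕ} {𝔤 : Type*} [LieRing 𝔤] [LieAlgebra ℂ 𝔤]
    (J : Module.Basis (Fin dg) ℂ 𝔤) (M : 𝔤 →ₗ⁅ℂ⁆ Matrix (Fin dM) (Fin dM) ℂ)
    (X : Fin dg → Poly N) : Module.End ℂ (JetFockSpace N p dV dM s) :=
  smear 1 (bilinearField N p dV dM s (jetJ J M X))

/-- All infinite sums of operators in the definitions above are locally finite, so that all of the
operators are well defined. -/
def SumsLocallyFinite : Prop :=
  (∀ (v : Fin N × ℕ) (l : List (Fin N × ℕ)) (k : ℤ),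
    OpLocallyFinite (mulTerm (qJetField N p dV dM s v) (wordField (qJetField N p dV dM s) l) k)) ∧
  (∀ (μ : Fin N) (l : List (Fin N)) (k : ℤ),
    OpLocallyFinite (mulTerm (qField N p dV dM s μ) (wordField (qField N p dV dM s) l) k)) ∧
  (∀ (P : Poly N) (A : JetIdx N p dV dM) (k : ℤ),
    OpLocallyFinite (mulTerm (trajField N p dV dM s P) (phiField N p dV dM s A) k)) ∧
  (∀ (μ : Fin N) (P : Poly N) (k : ℤ),
    OpLocallyFinite (normalTerm 1 (pField N p dV dM s μ) (trajField N p dV dM s P) k)) ∧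
  (∀ (μ : Fin N) (k : ℤ), OpLocallyFinite
    (normalTerm 1 (pField N p dV dM s μ) (timeDeriv (qField N p dV dM s μ)) k)) ∧
  (∀ (P : Poly N) (A B : JetIdx N p dV dM) (k : ℤ), OpLocallyFinite
    (normalTerm s.sgn (piField N p dV dM s A)
      (mulField (trajField N p dV dM s P) (phiField N p dV dM s B)) k)) ∧
  (∀ (A : JetIdx N p dV dM) (k : ℤ), OpLocallyFinite
    (normalTerm s.sgn (piField N p dV dM s A) (timeDeriv (phiField N p dV dM s A)) k)) ∧
  (∀ (A : JetIdx N p dV dM) (k : ℤ), OpLocallyFinite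
    (normalTerm s.sgn (piField N p dV dM s A) (phiField N p dV dM s A) k))

end Operators

/-- The values of the parameters. Here `k₀, k₁, k₂` are the trace invariants of `ϱ` and `y, z, u`
those of `M` (`y_M, z_M, w_M`). The binomial coefficients `C(N+p, p-1)`, `C(N+p+1, p-1)` and
`C(N+p, p-2)`, which vanish if the lower entry is negative, are written as `C(N+p, N+1)`,
`C(N+p+1, N+2)` and `C(N+p, N+2)`. -/
def fockCharges (N p dV dM : ℕ) (s : Parity) (lam w k₀ k₁ k₂ y z u : ℂ) : Charges where
  c₁ := 1 + s.sgn * dM * ((N + p).choose p * k₁ + (N + p + 1).choose (N + 2) * dV)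
  c₂ := s.sgn * dM * ((N + p).choose p * k₂ + (N + p).choose (N + 2) * dV
    + 2 * (N + p).choose (N + 1) * k₀)
  c₃ := 1 + s.sgn * (2 * lam - 1) * dM * ((N + p).choose p * k₀ + (N + p).choose (N + 1) * dV)
  a₃ := 1 + s.sgn * (2 * w - 1) * dM * ((N + p).choose p * k₀ + (N + p).choose (N + 1) * dV)
  c₄ := 2 * N + s.sgn * 2 * (1 - 6 * lam + 6 * lam ^ 2) * (N + p).choose p * dV * dM
  c₅ := -s.sgn * y * (N + p).choose p * dV
  c₆ := s.sgn * z * (2 * lam - 1) * (N + p).choose p * dV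
  a₆ := s.sgn * z * (2 * w - 1) * (N + p).choose p * dV
  c₇ := -s.sgn * z * ((N + p).choose p * k₀ + (N + p).choose (N + 1) * dV)
  c₈ := -s.sgn * u * (N + p).choose p * dV

end JetFock

end

/-! The classical part of the theorem is geometry, and every extension comes from one mechanism:
modes crossing the zero-frequency wall that defines normal ordering.

Call a field restricted if each vector is killed by its sufficiently negative modes (`RField`). The
normally ordered product `nop` of restricted fields is a locally finite sum and is again restricted,
and commutation with a fixed operator obeys the Leibniz rule for it (`tad_nop`). A generator
therefore acts on any composite field through its action on q, p, φ, π, and that action is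
classical. Anomalies appear only when a result has to be brought back to standard order.
Re-bracketing :(:PH:)G: into :P(:HG:): carries, at each frequency r of H, a net number r of modes of
P across the wall; the contractions add up to the Schwinger term i H'C (`nop_nop`). Multiplying P by
exp(-irt) also carries r modes across, and the contractions sum to a polynomial in r
(`nop_shift_left`).

Functions of the trajectory form a commutative differential algebra `QF` inside the restricted
fields, so differential polynomials can simply be evaluated there (`diffQ`), and local functionals
act through the integral (`obsInt`).

For vector fields and gauge transformations, a pair (ξ, X) acts on functions with values in ϱ ⊗ M as
a first order operator ξ^μ∂_μ + A. The Leibniz rule turns its action on p-jets into another first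
order operator, with matrix `jetMat`. Jets of polynomials separate matrices, so brackets survive
prolongation (`jetMat_commutator`). Quantization adds to the bracket only -i/2π times the integral
of d(∂_ν ξ^μ)/dt ∂_μ η^ν ± tr (dA/dt) B (`commutator_firstOrderInt`). The trace is computable
because jet matrices are block triangular for the length of multi-indices, so only length-preserving
blocks contribute (`jetMat_apply_mul`); the remaining moments of multi-indices are binomial
coefficients (`sum_prod_choose`, `sum_shiftCoeff_mul`).

For reparametrizations, each conjugate pair has weights 1 - λ and λ. The polynomials in r are
quadratic for brackets with the other currents (`ad_rep_nop`) and cubic for the bracket with itself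
(`ad_rep_rep`). The constant in L(t) is what brings the linear part of the cubic into the required
ratio with the cubic part (`commutator_smear_smear`).

All of this uses only the mode relations and restrictedness, collected in `ModeRep`. The Fock space
provides them because it is generated by its vacuum (`mode_mem_RField`, `fockRep`). -/

noncomputable section

namespace JetFock

/-! ## Restricted fields and their normally ordered products -/

section RestrictedFields

open Filter

variable {F : Type*} [AddCommGroup F] [Module ℂ F]

/-- The fields `A(t) = ∑ₙ A(n) exp (-i n t)` for which every vector is annihilated by all `A(n)`
with `n` sufficiently negative. -/
def RField (F : Type*) [AddCommGroup F] [Module ℂ F] : Submodule ℂ (OpField F) where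
  carrier := {A | ∀ v, ∀ᶠ n in atBot, A n v = 0}
  add_mem' := fun {A B} hA hB v => by
    filter_upwards [hA v, hB v] with n h₁ h₂
    simp [h₁, h₂]
  zero_mem' := fun v => by simp
  smul_mem' := fun c A hA v => by
    filter_upwards [hA v] with n h
    simp [h]

instance : CoeFun (RField F) (fun _ => ℤ → Module.End ℂ F) := ⟨fun A => A.1⟩

@[ext] theorem RField.ext {A B : RField F} (h : ∀ n, A n = B n) : A = B :=
  Subtype.ext (funext h)

@[simp] theorem RField.add_apply (A B : RField F) (n : ℤ) : (A + B) n = A n + B n := rfl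
@[simp] theorem RField.sub_apply (A B : RField F) (n : ℤ) : (A - B) n = A n - B n := rfl
@[simp] theorem RField.neg_apply (A : RField F) (n : ℤ) : (-A) n = -A n := rfl
@[simp] theorem RField.zero_apply (n : ℤ) : (0 : RField F) n = 0 := rfl
@[simp] theorem RField.smul_apply (c : ℂ) (A : RField F) (n : ℤ) : (c • A) n = c • A n := rfl

/-- A mode of a field, as a linear function of the field. -/
def modeLin (n : ℤ) : RField F →ₗ[ℂ] Module.End ℂ F where
  toFun A := A n
  map_add' _ _ := rfl
  map_smul' _ _ := rfl

theorem RField.sum_apply {κ : Type*} (s : Finset κ) (A : κ → RField F) (n : ℤ) :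
    (∑ i ∈ s, A i) n = ∑ i ∈ s, A i n := map_sum (modeLin n) A s

theorem exists_bound (A : RField F) (v : F) : ∃ K : ℤ, ∀ n < K, A n v = 0 := by
  obtain ⟨K, hK⟩ := eventually_atBot.1 (A.2 v)
  exact ⟨K, fun n hn => hK n hn.le⟩

theorem normalTerm_apply (ε : ℂ) (P G : OpField F) (k j : ℤ) (v : F) :
    normalTerm ε P G k j v = if 0 < j then P j (G (k - j) v) else ε • G (k - j) (P j v) := by
  unfold normalTerm
  split_ifs <;> simp

/-- Normal ordering lets the dangerous factor act first: for large positive j that is G at the very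
negative mode k - j, for very negative j it is P at mode j. -/
theorem opLocallyFinite_normalTerm (ε : ℂ) (P G : RField F) (k : ℤ) :
    OpLocallyFinite (normalTerm ε P G k) := by
  intro v
  obtain ⟨K, hK⟩ := exists_bound G v
  obtain ⟨L, hL⟩ := exists_bound P v
  refine (Set.finite_Icc (min L 0) (max (k - K) 0)).subset fun j hj => ?_
  rw [Set.mem_ofPred_eq, normalTerm_apply] at hj
  rw [Set.mem_Icc]
  by_contra hcon
  apply hj
  split_ifs with h
  · rw [hK _ (by omega), map_zero]
  · rw [hL _ (by omega), map_zero, smul_zero]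

theorem opSum_apply {κ : Type*} {A : κ → Module.End ℂ F} (h : OpLocallyFinite A) (v : F) :
    opSum A v = ∑ᶠ i, A i v := by
  rw [opSum, dif_pos h]
  rfl

theorem normalOrdered_apply (ε : ℂ) (P G : RField F) (k : ℤ) (v : F) :
    normalOrdered ε P G k v = ∑ᶠ j, normalTerm ε P G k j v :=
  opSum_apply (opLocallyFinite_normalTerm ε P G k) v

theorem normalOrdered_mem (ε : ℂ) (P G : RField F) :
    normalOrdered ε P G ∈ RField F := by
  intro v
  obtain ⟨K, hK⟩ := exists_bound G v
  obtain ⟨L, hL⟩ := exists_bound P v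
  -- Only the finitely many vectors `P j v` with L ≤ j ≤ 0 can matter on the non-positive side, so
  -- one bound serves for all of them.
  have h : ∀ᶠ n in atBot, ∀ j ∈ Set.Icc L 0, G n (P j v) = 0 :=
    (eventually_all_finite (Set.finite_Icc L 0)).2 fun j _ => G.2 (P j v)
  obtain ⟨M, hM⟩ := eventually_atBot.1 h
  filter_upwards [eventually_le_atBot (min K (M + L))] with k hk
  rw [normalOrdered_apply]
  refine finsum_eq_zero_of_forall_eq_zero fun j => ?_
  rw [normalTerm_apply]
  split_ifs with h
  · rw [hK _ (by omega), map_zero]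
  · by_cases hj : j < L
    · rw [hL _ hj, map_zero, smul_zero]
    · rw [hM (k - j) (by omega) j ⟨by omega, by omega⟩, smul_zero]

/-- The normally ordered product `:P(t) G(t):` of restricted fields, as a bilinear map. -/
def nop (ε : ℂ) : RField F →ₗ[ℂ] RField F →ₗ[ℂ] RField F :=
  LinearMap.mk₂ ℂ (fun P G => ⟨normalOrdered ε P G, normalOrdered_mem ε P G⟩)
    (by
      intro P Q G
      ext k v
      change normalOrdered ε (P + Q : RField F) G k v =
        normalOrdered ε P G k v + normalOrdered ε Q G k v
      simp only [normalOrdered_apply]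
      rw [← finsum_add_distrib (opLocallyFinite_normalTerm ε P G k v)
        (opLocallyFinite_normalTerm ε Q G k v)]
      refine finsum_congr fun j => ?_
      simp only [normalTerm_apply]
      split_ifs <;> simp)
    (by
      intro c P G
      ext k v
      change normalOrdered ε (c • P : RField F) G k v = c • normalOrdered ε P G k v
      simp only [normalOrdered_apply]
      rw [smul_finsum]
      refine finsum_congr fun j => ?_
      simp only [normalTerm_apply]
      split_ifs <;> simp [smul_comm c])
    (by
      intro P G H
      ext k v
      change normalOrdered ε P (G + H : RField F) k v =
        normalOrdered ε P G k v + normalOrdered ε P H k v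
      simp only [normalOrdered_apply]
      rw [← finsum_add_distrib (opLocallyFinite_normalTerm ε P G k v)
        (opLocallyFinite_normalTerm ε P H k v)]
      refine finsum_congr fun j => ?_
      simp only [normalTerm_apply]
      split_ifs <;> simp)
    (by
      intro c P G
      ext k v
      change normalOrdered ε P (c • G : RField F) k v = c • normalOrdered ε P G k v
      simp only [normalOrdered_apply]
      rw [smul_finsum]
      refine finsum_congr fun j => ?_
      simp only [normalTerm_apply]
      split_ifs <;> simp [smul_comm c])

theorem coe_nop (ε : ℂ) (P G : RField F) : (nop ε P G : OpField F) = normalOrdered ε P G := rfl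

theorem nop_apply (ε : ℂ) (P G : RField F) (k : ℤ) (v : F) :
    nop ε P G k v = ∑ᶠ j, if 0 < j then P j (G (k - j) v) else ε • G (k - j) (P j v) := by
  rw [coe_nop, normalOrdered_apply]
  exact finsum_congr fun j => normalTerm_apply ε P G k j v

theorem nop_finite (ε : ℂ) (P G : RField F) (k : ℤ) (v : F) :
    (Function.support fun j : ℤ =>
      if 0 < j then P j (G (k - j) v) else ε • G (k - j) (P j v)).Finite := by
  refine (opLocallyFinite_normalTerm ε P G k v).subset fun j hj => ?_
  rwa [Set.mem_ofPred_eq, normalTerm_apply]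

/-- The time derivative. -/
def tder : RField F →ₗ[ℂ] RField F where
  toFun A := ⟨timeDeriv A, fun v => by
    filter_upwards [A.2 v] with n h
    simp [timeDeriv, h]⟩
  map_add' A B := by ext n v; simp [timeDeriv]
  map_smul' c A := by ext n v; simp [timeDeriv, smul_smul]; ring_nf

theorem coe_tder (A : RField F) : (tder A : OpField F) = timeDeriv A := rfl

theorem tder_apply (A : RField F) (n : ℤ) : tder A n = (-Complex.I * (n : ℂ)) • A n := rfl

/-- Multiplication by `exp (-i r t)`. -/
def shift (r : ℤ) : RField F →ₗ[ℂ] RField F where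
  toFun A := ⟨fun n => A (n - r), fun v => by
    obtain ⟨K, hK⟩ := exists_bound A v
    filter_upwards [eventually_lt_atBot (K + r)] with n h
    exact hK _ (by omega)⟩
  map_add' A B := by ext n v; rfl
  map_smul' c A := by ext n v; rfl

@[simp] theorem shift_apply (r : ℤ) (A : RField F) (n : ℤ) : shift r A n = A (n - r) := rfl

theorem tder_shift (r : ℤ) (A : RField F) :
    tder (shift r A) = shift r (tder A) - (Complex.I * (r : ℂ)) • shift r A := by
  ext n v
  simp only [tder_apply, shift_apply, RField.sub_apply, RField.smul_apply]
  rw [← sub_smul]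
  congr 2
  push_cast
  ring

/-- The order of the factors depends only on the mode of P, so shifting G costs nothing. Shifting P
does cost something; see `nop_shift_left`. -/
theorem nop_shift_right (ε : ℂ) (r : ℤ) (P G : RField F) :
    nop ε P (shift r G) = shift r (nop ε P G) := by
  ext k v
  rw [shift_apply, nop_apply, nop_apply]
  refine finsum_congr fun j => ?_
  rw [shift_apply, sub_right_comm]

/-- The factor -ik splits as -ij - i(k - j), and differentiation does not change which side of the
wall j lies on. -/
theorem tder_nop (ε : ℂ) (P G : RField F) :
    tder (nop ε P G) = nop ε (tder P) G + nop ε P (tder G) := by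
  ext k v
  simp only [tder_apply, RField.add_apply, LinearMap.add_apply, LinearMap.smul_apply]
  simp only [nop_apply]
  rw [smul_finsum, ← finsum_add_distrib (nop_finite ε (tder P) G k v)
    (nop_finite ε P (tder G) k v)]
  refine finsum_congr fun j => ?_
  simp only [tder_apply, LinearMap.smul_apply, map_smul]
  split_ifs
  · rw [← add_smul]; congr 1; push_cast; ring
  · rw [smul_comm ε, smul_comm ε, ← add_smul]; congr 1; push_cast; ring

/-- The twisted commutator `x B(t) - ε B(t) x` of an operator with a field. -/
def tad (x : Module.End ℂ F) (ε : ℂ) : RField F →ₗ[ℂ] RField F where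
  toFun B := ⟨fun n => x * B n - ε • (B n * x), fun v => by
    filter_upwards [B.2 v, B.2 (x v)] with n h₁ h₂
    simp [h₁, h₂]⟩
  map_add' A B := by ext n v; simp; abel
  map_smul' c A := by ext n v; simp [smul_sub, smul_comm ε]

theorem tad_apply (x : Module.End ℂ F) (ε : ℂ) (B : RField F) (n : ℤ) :
    tad x ε B n = x * B n - ε • (B n * x) := rfl

theorem tad_tder (x : Module.End ℂ F) (ε : ℂ) (B : RField F) :
    tad x ε (tder B) = tder (tad x ε B) := by
  ext n v
  simp [tad_apply, tder_apply, smul_sub, smul_comm ε]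

theorem tad_shift (x : Module.End ℂ F) (ε : ℂ) (r : ℤ) (B : RField F) :
    tad x ε (shift r B) = shift r (tad x ε B) := rfl

/-- The twisted Leibniz rule for normally ordered products. -/
theorem tad_nop (x : Module.End ℂ F) {ε₁ : ℂ} (h₁ : ε₁ * ε₁ = 1) (ε₂ ε : ℂ) (P G : RField F) :
    tad x (ε₁ * ε₂) (nop ε P G) =
      nop (ε * ε₂) (tad x ε₁ P) G + ε₁ • nop (ε * ε₁) P (tad x ε₂ G) := by
  ext k v
  simp only [tad_apply, RField.add_apply, RField.smul_apply, LinearMap.add_apply,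
    LinearMap.smul_apply, LinearMap.sub_apply, Module.End.mul_apply]
  simp only [nop_apply]
  have hx : x (∑ᶠ j : ℤ, if 0 < j then P j (G (k - j) v) else ε • G (k - j) (P j v)) =
      ∑ᶠ j : ℤ, x (if 0 < j then P j (G (k - j) v) else ε • G (k - j) (P j v)) :=
    map_finsum x (nop_finite ε P G k v)
  have f₁ : (Function.support fun j : ℤ =>
      x (if 0 < j then P j (G (k - j) v) else ε • G (k - j) (P j v))).Finite :=
    (nop_finite ε P G k v).subset (Function.support_comp_subset (map_zero x) _)
  have f₂ : (Function.support fun j : ℤ => (ε₁ * ε₂) •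
      (if 0 < j then P j (G (k - j) (x v)) else ε • G (k - j) (P j (x v)))).Finite :=
    (nop_finite ε P G k (x v)).subset (Function.support_const_smul_subset _ _)
  have f₃ : (Function.support fun j : ℤ => ε₁ • (if 0 < j then P j (tad x ε₂ G (k - j) v)
      else (ε * ε₁) • tad x ε₂ G (k - j) (P j v))).Finite :=
    (nop_finite (ε * ε₁) P (tad x ε₂ G) k v).subset (Function.support_const_smul_subset _ _)
  rw [hx, smul_finsum, smul_finsum, ← finsum_sub_distrib f₁ f₂,
    ← finsum_add_distrib (nop_finite (ε * ε₂) (tad x ε₁ P) G k v) f₃]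
  refine finsum_congr fun j => ?_
  simp only [tad_apply, LinearMap.sub_apply, LinearMap.smul_apply, Module.End.mul_apply]
  split_ifs
  · simp only [map_sub, map_smul, smul_sub, smul_smul]
    abel
  · simp only [map_sub, map_smul, smul_sub, smul_smul]
    -- In the reordered terms x meets G before P, so the sign ε₁ of the second summand has to be
    -- undone; this is where ε₁² = 1 is needed.
    have e₁ : ε₁ * (ε * ε₁) = ε := by linear_combination ε * h₁
    have e₂ : ε₁ * (ε * ε₁ * ε₂) = ε * ε₂ := by linear_combination ε * ε₂ * h₁
    have e₃ : ε₁ * ε₂ * ε = ε * ε₂ * ε₁ := by ring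
    rw [e₁, e₂, e₃]
    abel

/-- The Leibniz rule for normally ordered products. -/
theorem ad_nop (x : Module.End ℂ F) (ε : ℂ) (P G : RField F) :
    tad x 1 (nop ε P G) = nop ε (tad x 1 P) G + nop ε P (tad x 1 G) := by
  simpa using tad_nop x (ε₁ := 1) (one_mul 1) 1 ε P G

/-! ### Commuting fields. -/

/-- All modes of two fields commute. -/
def FieldsCommute (A B : RField F) : Prop := ∀ m n, Commute (A m) (B n)

theorem FieldsCommute.symm {A B : RField F} (h : FieldsCommute A B) : FieldsCommute B A :=
  fun m n => (h n m).symm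

theorem FieldsCommute.apply {A B : RField F} (h : FieldsCommute A B) (m n : ℤ) (v : F) :
    A m (B n v) = B n (A m v) := LinearMap.congr_fun (h m n) v

/-- For commuting factors normal ordering is vacuous. This is what makes the unordered products
`mulField` locally finite and identifies them with `nop 1`. -/
theorem FieldsCommute.normalTerm_eq {A B : RField F} (h : FieldsCommute A B) (k : ℤ) :
    normalTerm 1 A B k = mulTerm A B k := by
  funext j
  unfold normalTerm mulTerm
  split_ifs
  · rfl
  · rw [one_smul]; exact (h _ _).symm

theorem FieldsCommute.opLocallyFinite {A B : RField F} (h : FieldsCommute A B) (k : ℤ) :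
    OpLocallyFinite (mulTerm (A : OpField F) B k) :=
  h.normalTerm_eq k ▸ opLocallyFinite_normalTerm 1 A B k

theorem FieldsCommute.mulField_eq {A B : RField F} (h : FieldsCommute A B) :
    mulField (A : OpField F) B = nop 1 A B := by
  funext k
  rw [coe_nop, normalOrdered, h.normalTerm_eq k]
  rfl

theorem FieldsCommute.nop_apply {A B : RField F} (h : FieldsCommute A B) (k : ℤ) (v : F) :
    nop 1 A B k v = ∑ᶠ j, A j (B (k - j) v) := by
  rw [JetFock.nop_apply]
  refine finsum_congr fun j => ?_
  split_ifs
  · rfl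
  · rw [one_smul, h.apply]

theorem FieldsCommute.finite {A B : RField F} (h : FieldsCommute A B) (k : ℤ) (v : F) :
    (Function.support fun j : ℤ => A j (B (k - j) v)).Finite := h.opLocallyFinite k v

theorem FieldsCommute.nop_comm {A B : RField F} (h : FieldsCommute A B) :
    nop 1 A B = nop 1 B A := by
  ext k v
  rw [h.nop_apply, h.symm.nop_apply, ← finsum_comp_equiv (Equiv.subLeft k)]
  refine finsum_congr fun j => ?_
  rw [Equiv.subLeft_apply, sub_sub_cancel, h.apply]

/-- By the Leibniz rule an operator that commutes with both factors commutes with their product. -/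
theorem FieldsCommute.nop_right {H P G : RField F} (hP : FieldsCommute H P)
    (hG : FieldsCommute H G) (ε : ℂ) : FieldsCommute H (nop ε P G) := by
  intro m n
  have h := ad_nop (H m) ε P G
  have hP' : tad (H m) 1 P = 0 := by
    ext l : 1; rw [tad_apply, one_smul, RField.zero_apply, sub_eq_zero]; exact hP m l
  have hG' : tad (H m) 1 G = 0 := by
    ext l : 1; rw [tad_apply, one_smul, RField.zero_apply, sub_eq_zero]; exact hG m l
  rw [hP', hG', map_zero, LinearMap.map_zero, LinearMap.zero_apply, add_zero] at h
  have := congrArg (fun A : RField F => A n) h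
  rw [commute_iff_eq]
  simpa only [tad_apply, one_smul, RField.zero_apply, sub_eq_zero] using this

theorem tad_one_eq_zero_iff {x : Module.End ℂ F} {B : RField F} :
    tad x 1 B = 0 ↔ ∀ n, Commute x (B n) := by
  constructor
  · intro h n
    have := congrArg (fun A : RField F => A n) h
    rw [commute_iff_eq]
    simpa only [tad_apply, one_smul, RField.zero_apply, sub_eq_zero] using this
  · intro h
    ext n : 1
    rw [tad_apply, one_smul, RField.zero_apply, sub_eq_zero]
    exact h n

end RestrictedFields

end JetFock
end

noncomputable section

namespace JetFock

/-! ## Schwinger terms -/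

section SchwingerTerms

variable {F : Type*} [AddCommGroup F] [Module ℂ F]

/-- Supplies the finiteness that exchanging iterated finite sums in `nop_nop` requires. -/
theorem finite_support_of_fibers {α β M : Type*} [Zero M] {f : α × β → M} {S : Set α}
    (hS : S.Finite) (h₁ : ∀ a b, f (a, b) ≠ 0 → a ∈ S)
    (h₂ : ∀ a ∈ S, (Function.support fun b => f (a, b)).Finite) : (Function.support f).Finite := by
  refine Set.Finite.of_finite_fibers Prod.fst (hS.subset ?_) ?_
  · rintro _ ⟨⟨a, b⟩, hab, rfl⟩
    exact h₁ a b hab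
  · rintro _ ⟨⟨a, b⟩, hab, rfl⟩
    refine ((h₂ a (h₁ a b hab)).image (Prod.mk a)).subset ?_
    rintro ⟨a', b'⟩ ⟨h, h'⟩
    obtain rfl : a' = a := h'
    exact ⟨b', h, rfl⟩

/-- The number of pairs `l ≤ 0 < j` minus the number of pairs `j ≤ 0 < l` with `j - l = r`. -/
theorem finsum_wall_crossing (r : ℤ) (w : F) :
    ∑ᶠ l : ℤ, ((if l ≤ 0 ∧ 0 < l + r then w else 0) - (if l + r ≤ 0 ∧ 0 < l then w else 0)) =
      (r : ℂ) • w := by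
  rw [finsum_eq_sum_of_support_subset (s := Finset.Ioc (-r) 0 ∪ Finset.Ioc 0 (-r))]
  · rw [Finset.sum_union (by
      rw [Finset.disjoint_left]; intro a ha hb; simp only [Finset.mem_Ioc] at ha hb; omega)]
    rw [Finset.sum_congr rfl (g := fun _ => w) (s₁ := Finset.Ioc (-r) 0) (by
        intro l hl
        rw [Finset.mem_Ioc] at hl
        rw [if_pos (by omega), if_neg (by omega), sub_zero]),
      Finset.sum_congr rfl (g := fun _ => -w) (s₁ := Finset.Ioc 0 (-r)) (by
        intro l hl
        rw [Finset.mem_Ioc] at hl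
        rw [if_neg (by omega), if_pos (by omega), zero_sub])]
    rw [Finset.sum_const, Finset.sum_const, Int.card_Ioc, Int.card_Ioc, smul_neg, ← sub_eq_add_neg,
      ← natCast_zsmul, ← natCast_zsmul, ← sub_smul, Int.cast_smul_eq_zsmul]
    congr 1
    omega
  · intro l hl
    by_contra hcon
    apply hl
    simp only [Finset.coe_union, Finset.coe_Ioc, Set.mem_union, Set.mem_Ioc, not_or] at hcon
    change (if l ≤ 0 ∧ 0 < l + r then w else 0) - (if l + r ≤ 0 ∧ 0 < l then w else 0) = 0
    rw [if_neg (by omega), if_neg (by omega), sub_zero]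

/-- Normally ordered products are associative up to a Schwinger term. -/
theorem nop_nop (ε : ℂ) {P H G C : RField F} (hG : FieldsCommute H G) (hC : FieldsCommute H C)
    (hPG : ∀ l m, P l * G m - ε • (G m * P l) = C (l + m)) :
    nop ε (nop 1 P H) G = nop ε P (nop 1 H G) + Complex.I • nop 1 (tder H) C := by
  ext k v
  have hPG' : ∀ l m (u : F), P l (G m u) = ε • G m (P l u) + C (l + m) u := fun l m u => by
    rw [← hPG l m]; simp
  obtain ⟨KG, hKG⟩ := exists_bound G v
  obtain ⟨KH, hKH⟩ := exists_bound H v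
  obtain ⟨KP, hKP⟩ := exists_bound P v
  obtain ⟨KHP, hKHP⟩ : ∃ K : ℤ, ∀ n < K, ∀ l ∈ Set.Icc KP 0, H n (P l v) = 0 := by
    have h : ∀ᶠ n in Filter.atBot, ∀ l ∈ Set.Icc KP 0, H n (P l v) = 0 :=
      (Filter.eventually_all_finite (Set.finite_Icc KP 0)).2 fun l _ => H.2 (P l v)
    obtain ⟨K, hK⟩ := Filter.eventually_atBot.1 h
    exact ⟨K, fun n hn => hK n hn.le⟩
  -- the double sums on the two sides, and their difference
  let X : ℤ × ℤ → F := fun a => if 0 < a.1 then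
      (if 0 < a.2 then P a.2 (H (a.1 - a.2) (G (k - a.1) v))
        else H (a.1 - a.2) (P a.2 (G (k - a.1) v)))
    else ε • G (k - a.1) (if 0 < a.2 then P a.2 (H (a.1 - a.2) v) else H (a.1 - a.2) (P a.2 v))
  let Y : ℤ × ℤ → F := fun a => if 0 < a.2 then P a.2 (H (a.1 - a.2) (G (k - a.1) v))
    else ε • H (a.1 - a.2) (G (k - a.1) (P a.2 v))
  let Z : ℤ × ℤ → F := fun a =>
    (if a.2 ≤ 0 ∧ 0 < a.2 + a.1 then H a.1 (C (k - a.1) v) else 0) -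
      (if a.2 + a.1 ≤ 0 ∧ 0 < a.2 then H a.1 (C (k - a.1) v) else 0)
  -- At fixed r = j - l every contraction is the same operator H(r) C(k - r), so in the coordinates
  -- (r, l) the sum over l becomes a count.
  let e : ℤ × ℤ ≃ ℤ × ℤ :=
    { toFun := fun a => (a.1 - a.2, a.2)
      invFun := fun a => (a.1 + a.2, a.2)
      left_inv := fun a => by simp
      right_inv := fun a => by simp }
  have hXYZ : ∀ a, X a = Y a + Z (e a) := by
    rintro ⟨j, l⟩
    simp only [X, Y, Z, e, Equiv.coe_fn_mk]
    have e1 : l + (j - l) = j := by ring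
    have e2 : k - (j - l) = l + (k - j) := by ring
    rw [e1, e2]
    -- The cases left are the signs of j and l. Equal signs give the same word up to commuting H
    -- with G. For l ≤ 0 < j moving P past G gives one contraction with sign plus, for j ≤ 0 < l one
    -- with sign minus.
    split_ifs <;> first | omega | skip
    · simp
    · rw [hPG', map_add, map_smul]; simp
    · rw [hG.apply, hPG' l, ← hC.symm.apply]; simp
    · rw [hG.apply]; simp
  have hXf : (Function.support X).Finite := by
    refine finite_support_of_fibers
      (Set.finite_Icc (min (min KH (KHP + KP)) 0) (max 0 (k - KG))) (fun j l h => ?_)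
      (fun j _ => ?_)
    · rw [Set.mem_Icc]
      by_contra hcon
      apply h
      simp only [X]
      split_ifs with hj hl hl
      · rw [hKG _ (by omega)]; simp
      · rw [hKG _ (by omega)]; simp
      · rw [hKH _ (by omega)]; simp
      · by_cases hl' : l < KP
        · rw [hKP _ hl']; simp
        · rw [hKHP (j - l) (by omega) l ⟨by omega, by omega⟩]; simp
    · by_cases hj : 0 < j
      · refine (nop_finite 1 P H j (G (k - j) v)).subset fun l hl => ?_
        simpa [X, hj] using hl
      · refine (nop_finite 1 P H j v).subset fun l hl h0 => hl ?_
        simp only [X, one_smul, if_neg hj] at h0 ⊢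
        rw [h0]; simp
  have hYf' : (Function.support (Y ∘ Prod.swap)).Finite := by
    refine finite_support_of_fibers (Set.finite_Icc (min KP 0) (max 0 (k - KG - KH)))
      (fun l j h => ?_) (fun l _ => ?_)
    · rw [Set.mem_Icc]
      by_contra hcon
      apply h
      simp only [Y, Function.comp_apply, Prod.swap_prod_mk]
      split_ifs with hl
      · by_cases hj : k - j < KG
        · rw [hKG _ hj]; simp
        · rw [hG.apply, hKH _ (by omega)]; simp
      · rw [hKP _ (by omega)]; simp
    · have key : ∀ u : F, (Function.support fun j : ℤ => H (j - l) (G (k - j) u)).Finite := by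
        intro u
        refine ((hG.finite (k - l) u).preimage
          (f := fun j : ℤ => j - l) (fun a _ b _ h => by simpa using h)).subset fun j hj => ?_
        simpa using hj
      by_cases hl : 0 < l
      · refine (key v).subset fun j hj h0 => hj ?_
        simp only [Y, Function.comp_apply, Prod.swap_prod_mk, if_pos hl]
        rw [show H (j - l) (G (k - j) v) = 0 from h0, map_zero]
      · refine (key (P l v)).subset fun j hj h0 => hj ?_
        simp only [Y, Function.comp_apply, Prod.swap_prod_mk, if_neg hl]
        rw [show H (j - l) (G (k - j) (P l v)) = 0 from h0, smul_zero]
  have hYf : (Function.support Y).Finite := by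
    have := hYf'.preimage (f := Prod.swap) Prod.swap_injective.injOn
    refine this.subset fun a ha => ?_
    simpa using ha
  -- The correction is the difference of two families of finite support.
  have hZf' : (Function.support (Z ∘ e)).Finite := by
    refine (hXf.union hYf).subset fun a ha => ?_
    by_contra hcon
    simp only [Set.mem_union, Function.mem_support, not_or, not_not] at hcon
    apply ha
    have := hXYZ a
    rw [hcon.1, hcon.2, zero_add] at this
    exact this.symm
  have hZf : (Function.support Z).Finite := by
    have := hZf'.preimage (f := e.symm) e.symm.injective.injOn
    refine this.subset fun a ha => ?_
    simpa using ha
  have hL : nop ε (nop 1 P H) G k v = ∑ᶠ a, X a := by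
    rw [finsum_curry X hXf, nop_apply]
    refine finsum_congr fun j => ?_
    simp only [X]
    split_ifs with hj
    · rw [nop_apply]; simp only [one_smul]
    · rw [nop_apply, map_finsum _ (nop_finite 1 P H j v), smul_finsum]
      simp only [one_smul]
  have hR : nop ε P (nop 1 H G) k v = ∑ᶠ a, Y a := by
    rw [← finsum_comp_equiv (Equiv.prodComm ℤ ℤ), nop_apply]
    have := finsum_curry (Y ∘ Prod.swap) hYf'
    simp only [Function.comp_apply] at this
    refine Eq.trans ?_ this.symm
    refine finsum_congr fun l => ?_
    simp only [Y, Prod.swap_prod_mk]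
    have key : ∀ u : F, nop 1 H G (k - l) u = ∑ᶠ j : ℤ, H (j - l) (G (k - j) u) := by
      intro u
      rw [hG.nop_apply, ← finsum_comp_equiv (Equiv.subRight l)]
      refine finsum_congr fun j => ?_
      simp
    have kfin : ∀ u : F, (Function.support fun j : ℤ => H (j - l) (G (k - j) u)).Finite := by
      intro u
      refine ((hG.finite (k - l) u).preimage
        (f := fun j : ℤ => j - l) (fun a _ b _ h => by simpa using h)).subset fun j hj => ?_
      simpa using hj
    split_ifs with hl
    · rw [key, map_finsum _ (kfin v)]
    · rw [key, smul_finsum]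
  have hD : FieldsCommute (tder H) C := fun m n => by
    rw [tder_apply]; exact (hC m n).smul_left _
  have hZ : (Complex.I • nop 1 (tder H) C) k v = ∑ᶠ a, Z a := by
    rw [finsum_curry Z hZf, RField.smul_apply, LinearMap.smul_apply, hD.nop_apply, smul_finsum]
    refine finsum_congr fun r => ?_
    simp only [Z]
    -- The count r equals i times the factor -ir of the time derivative.
    rw [finsum_wall_crossing, tder_apply, LinearMap.smul_apply, smul_smul, ← mul_assoc]
    congr 1
    rw [mul_neg, Complex.I_mul_I]; simp
  rw [RField.add_apply, LinearMap.add_apply, hL, hR, hZ, ← finsum_comp_equiv e (f := Z),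
    ← finsum_add_distrib (g := fun a => Z (e a)) hYf hZf']
  exact finsum_congr hXYZ

/-- Normally ordered products of commuting factors are associative. -/
theorem nop_assoc {P H G : RField F} (ε : ℂ) (hHG : FieldsCommute H G)
    (hPG : ∀ l m, P l * G m = ε • (G m * P l)) :
    nop ε (nop 1 P H) G = nop ε P (nop 1 H G) := by
  have := nop_nop ε (P := P) (C := 0) hHG (fun m n => Commute.zero_right _)
    (fun l m => by rw [hPG, sub_self]; rfl)
  simpa using this

/-- Shifting P by one step moves exactly one mode, P(0), from the right of G to its left. -/
theorem nop_shift_one (ε : ℂ) (P G : RField F) (k : ℤ) :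
    nop ε (shift 1 P) G (k + 1) = nop ε P G k + (P 0 * G k - ε • (G k * P 0)) := by
  ext v
  rw [LinearMap.add_apply, nop_apply, nop_apply, ← finsum_comp_equiv (Equiv.addRight (1 : ℤ))]
  have h : ∑ᶠ l : ℤ, (if l = 0 then P 0 (G k v) - ε • G k (P 0 v) else 0) =
      P 0 (G k v) - ε • G k (P 0 v) := by
    rw [finsum_eq_single _ 0 (fun x hx => if_neg hx), if_pos rfl]
  have hf : (Function.support fun l : ℤ =>
      if l = 0 then P 0 (G k v) - ε • G k (P 0 v) else 0).Finite := by
    refine (Set.finite_singleton (0 : ℤ)).subset fun l hl => ?_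
    by_contra hcon
    exact hl (if_neg hcon)
  simp only [LinearMap.sub_apply, LinearMap.smul_apply, Module.End.mul_apply]
  rw [← h, ← finsum_add_distrib (nop_finite ε P G k v) hf]
  refine finsum_congr fun l => ?_
  simp only [Equiv.coe_addRight, shift_apply, add_sub_cancel_right, add_sub_add_right_eq_sub]
  rcases lt_trichotomy l 0 with hl | hl | hl
  · rw [if_neg (by omega), if_neg (by omega), if_neg (by omega), add_zero]
  · subst hl; simp
  · rw [if_pos (by omega), if_pos hl, if_neg (by omega), add_zero]

/-- The Schwinger term for multiplication by `exp (-i r t)`. -/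
theorem nop_shift_left (ε : ℂ) {P G C : RField F} {a : ℤ → ℤ → ℂ}
    (hPG : ∀ l m, P l * G m - ε • (G m * P l) = a l m • C (l + m)) (n : ℤ) {b : ℤ → ℂ}
    (h₀ : b 0 = 0) (hb : ∀ r, b (r + 1) - b r = a (-r) (n + r)) (r : ℤ) :
    nop ε (shift r P) G (n + r) = nop ε P G n + b r • C n := by
  -- The zero mode of `shift r P` is P(-r), whence the contraction a(-r, n + r). The function b is
  -- the discrete antiderivative of these, for r of either sign.
  have step : ∀ r, nop ε (shift (r + 1) P) G (n + (r + 1)) =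
      nop ε (shift r P) G (n + r) + (b (r + 1) - b r) • C n := by
    intro r
    have h := nop_shift_one ε (shift r P) G (n + r)
    have e : shift 1 (shift r P) = shift (r + 1) P := by
      ext k : 1; rw [shift_apply, shift_apply, shift_apply, show k - 1 - r = k - (r + 1) by ring]
    rw [e, shift_apply, zero_sub, hPG, ← hb] at h
    rw [← add_assoc, h, show -r + (n + r) = n by ring]
  induction r using Int.induction_on with
  | zero =>
    have e : shift 0 P = P := by ext k : 1; simp
    rw [e, h₀, zero_smul, add_zero, add_zero]
  | succ i ih => rw [step, ih]; module
  | pred i ih =>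
    have := step (-i - 1)
    rw [sub_add_cancel, ih] at this
    rw [eq_comm, ← sub_eq_iff_eq_add] at this
    rw [← this]; module

end SchwingerTerms
end JetFock
end

noncomputable section

namespace JetFock

/-! ## Fields with the graded commutation relations -/

section FockFields

open Filter

variable {N : ℕ} {ι : Type} [DecidableEq ι] {s : Parity} {F : Type*} [AddCommGroup F] [Module ℂ F]

theorem Parity.sgn_mul_self (s : Parity) : s.sgn * s.sgn = 1 := by
  cases s <;> simp [Parity.sgn]

/-- Operators satisfying the graded commutation relations of the modes, such that the fields with
these modes are restricted. -/
structure ModeRep (N : ℕ) (ι : Type) [DecidableEq ι] (s : Parity) (F : Type*) [AddCommGroup F]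
    [Module ℂ F] where
  op : Mode N ι → Module.End ℂ F
  op_mul : ∀ x y, op x * op y =
    exchangeSign s x y • (op y * op x) + modeBracket s x y • (1 : Module.End ℂ F)
  q_mem : ∀ μ, (fun n => op (.q μ n)) ∈ RField F
  p_mem : ∀ μ, (fun n => op (.p μ n)) ∈ RField F
  φ_mem : ∀ A, (fun n => op (.φ A n)) ∈ RField F
  π_mem : ∀ A, (fun n => op (.π A n)) ∈ RField F

/-- The vacuum is killed by very negative modes, and the property passes from v to y v because a
mode of sufficiently negative frequency has zero bracket with the given y. Cyclicity of the vacuum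
then covers every vector. -/
theorem mode_mem_RField {op : Mode N ι → Module.End ℂ F}
    (op_mul : ∀ x y, op x * op y =
      exchangeSign s x y • (op y * op x) + modeBracket s x y • (1 : Module.End ℂ F))
    {v₀ : F} (hv₀ : ∀ x, x.annihilates → op x v₀ = 0)
    (hind : ∀ p : F → Prop, p v₀ → (∀ u v, p u → p v → p (u + v)) →
      (∀ (c : ℂ) v, p v → p (c • v)) → (∀ x v, p v → p (op x v)) → ∀ v, p v)
    {x : ℤ → Mode N ι} (hx : ∀ᶠ n in atBot, (x n).annihilates)
    (hbr : ∀ y, ∀ᶠ n in atBot, modeBracket s (x n) y = 0) :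
    (fun n => op (x n)) ∈ RField F := by
  intro v
  change ∀ᶠ n in atBot, op (x n) v = 0
  refine hind (fun v => ∀ᶠ n in atBot, op (x n) v = 0) ?_ ?_ ?_ ?_ v
  · filter_upwards [hx] with n hn using hv₀ _ hn
  · intro u v hu hv
    filter_upwards [hu, hv] with n h₁ h₂
    rw [map_add, h₁, h₂, add_zero]
  · intro c v hv
    filter_upwards [hv] with n h
    rw [map_smul, h, smul_zero]
  · intro y v hv
    filter_upwards [hv, hbr y] with n h₁ h₂
    have := LinearMap.congr_fun (op_mul (x n) y) v
    rw [h₂] at this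
    simpa [h₁] using this

/-- A representation generated by a vector that is annihilated by all annihilating modes. -/
def ModeRep.ofCyclic (op : Mode N ι → Module.End ℂ F)
    (op_mul : ∀ x y, op x * op y =
      exchangeSign s x y • (op y * op x) + modeBracket s x y • (1 : Module.End ℂ F))
    (v₀ : F) (hv₀ : ∀ x, x.annihilates → op x v₀ = 0)
    (hind : ∀ p : F → Prop, p v₀ → (∀ u v, p u → p v → p (u + v)) →
      (∀ (c : ℂ) v, p v → p (c • v)) → (∀ x v, p v → p (op x v)) → ∀ v, p v) :
    ModeRep N ι s F where
  op := op
  op_mul := op_mul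
  q_mem μ := mode_mem_RField op_mul hv₀ hind
    (by filter_upwards [eventually_lt_atBot (0 : ℤ)] with n hn using hn)
    (fun y => by
      cases y with
      | p ν m =>
        filter_upwards [eventually_lt_atBot (-m)] with n hn
        simp only [modeBracket]
        rw [if_neg (by omega)]
      | _ => exact Eventually.of_forall fun n => rfl)
  p_mem μ := mode_mem_RField op_mul hv₀ hind
    (by filter_upwards [eventually_le_atBot (0 : ℤ)] with n hn using hn)
    (fun y => by
      cases y with
      | q ν m =>
        filter_upwards [eventually_lt_atBot (-m)] with n hn
        simp only [modeBracket]
        rw [if_neg (by omega)]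
      | _ => exact Eventually.of_forall fun n => rfl)
  φ_mem A := mode_mem_RField op_mul hv₀ hind
    (by filter_upwards [eventually_lt_atBot (0 : ℤ)] with n hn using hn)
    (fun y => by
      cases y with
      | π B m =>
        filter_upwards [eventually_lt_atBot (-m)] with n hn
        simp only [modeBracket]
        rw [if_neg (by omega)]
      | _ => exact Eventually.of_forall fun n => rfl)
  π_mem A := mode_mem_RField op_mul hv₀ hind
    (by filter_upwards [eventually_le_atBot (0 : ℤ)] with n hn using hn)
    (fun y => by
      cases y with
      | φ B m =>
        filter_upwards [eventually_lt_atBot (-m)] with n hn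
        simp only [modeBracket]
        rw [if_neg (by omega)]
      | _ => exact Eventually.of_forall fun n => rfl)

/-! ### The elementary fields and their brackets. -/

variable (R : ModeRep N ι s F)

/-- The field `q^μ(t)`. -/
def ModeRep.fq (μ : Fin N) : RField F := ⟨fun n => R.op (.q μ n), R.q_mem μ⟩

/-- The field `p_μ(t)`. -/
def ModeRep.fp (μ : Fin N) : RField F := ⟨fun n => R.op (.p μ n), R.p_mem μ⟩

/-- The field `φ_A(t)`. -/
def ModeRep.fphi (A : ι) : RField F := ⟨fun n => R.op (.φ A n), R.φ_mem A⟩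

/-- The field `π^A(t)`. -/
def ModeRep.fpi (A : ι) : RField F := ⟨fun n => R.op (.π A n), R.π_mem A⟩

theorem ModeRep.commute_of_bracket {x y : Mode N ι} (h₁ : exchangeSign s x y = 1)
    (h₂ : modeBracket s x y = 0) : Commute (R.op x) (R.op y) := by
  rw [commute_iff_eq, R.op_mul, h₁, h₂, one_smul, zero_smul, add_zero]

theorem ModeRep.fq_fq (μ ν : Fin N) : FieldsCommute (R.fq μ) (R.fq ν) := fun _ _ =>
  R.commute_of_bracket rfl rfl

theorem ModeRep.fq_fphi (μ : Fin N) (A : ι) : FieldsCommute (R.fq μ) (R.fphi A) := fun _ _ =>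
  R.commute_of_bracket rfl rfl

theorem ModeRep.fq_fpi (μ : Fin N) (A : ι) : FieldsCommute (R.fq μ) (R.fpi A) := fun _ _ =>
  R.commute_of_bracket rfl rfl

theorem ModeRep.fp_fp (μ ν : Fin N) : FieldsCommute (R.fp μ) (R.fp ν) := fun _ _ =>
  R.commute_of_bracket rfl rfl

theorem ModeRep.fp_fphi (μ : Fin N) (A : ι) : FieldsCommute (R.fp μ) (R.fphi A) := fun _ _ =>
  R.commute_of_bracket rfl rfl

theorem ModeRep.fp_fpi (μ : Fin N) (A : ι) : FieldsCommute (R.fp μ) (R.fpi A) := fun _ _ =>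
  R.commute_of_bracket rfl rfl

/-- The constant field `1`. -/
def fone : RField F :=
  ⟨oneField, fun v => by
    filter_upwards [eventually_lt_atBot (0 : ℤ)] with n hn
    simp [oneField, hn.ne]⟩

theorem fone_apply (n : ℤ) :
    (fone : RField F) n = if n = 0 then 1 else 0 := rfl

/-- Extracting mode l of p from δ(s - t) leaves the scalar function exp(ilt)/2π, which is a shift of
the constant field. -/
theorem ModeRep.tad_fp_fq (μ ν : Fin N) (l : ℤ) :
    tad (R.fp μ l) 1 (R.fq ν) =
      (if μ = ν then (1 / (2 * (Real.pi : ℂ))) else 0) • shift (-l) fone := by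
  ext n : 1
  have h := R.op_mul (.p μ l : Mode N ι) (.q ν n)
  change R.op _ * R.op _ - (1 : ℂ) • (R.op _ * R.op _) = _
  rw [h, RField.smul_apply, shift_apply, fone_apply]
  have e : exchangeSign s (.p μ l : Mode N ι) (.q ν n) = 1 := rfl
  rw [e, add_sub_cancel_left]
  simp only [modeBracket]
  by_cases h₁ : μ = ν <;> by_cases h₂ : l + n = 0
  · rw [if_pos ⟨h₁, h₂⟩, if_pos h₁, if_pos (by omega)]
  · rw [if_neg (by tauto), if_neg (show ¬ (n - -l = 0) by omega)]; simp
  · rw [if_neg (by tauto), if_neg h₁]; simp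
  · rw [if_neg (by tauto), if_neg h₁]; simp

theorem ModeRep.tad_fpi_fphi (A B : ι) (l : ℤ) :
    tad (R.fpi A l) s.sgn (R.fphi B) =
      (if A = B then (1 / (2 * (Real.pi : ℂ))) else 0) • shift (-l) fone := by
  ext n : 1
  have h := R.op_mul (.π A l : Mode N ι) (.φ B n)
  change R.op _ * R.op _ - s.sgn • (R.op _ * R.op _) = _
  rw [h, RField.smul_apply, shift_apply, fone_apply]
  have e : exchangeSign s (.π A l : Mode N ι) (.φ B n) = s.sgn := rfl
  rw [e, add_sub_cancel_left]
  simp only [modeBracket]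
  by_cases h₁ : A = B <;> by_cases h₂ : l + n = 0
  · rw [if_pos ⟨h₁, h₂⟩, if_pos h₁, if_pos (by omega)]
  · rw [if_neg (by tauto), if_neg (show ¬ (n - -l = 0) by omega)]; simp
  · rw [if_neg (by tauto), if_neg h₁]; simp
  · rw [if_neg (by tauto), if_neg h₁]; simp

theorem ModeRep.tad_fpi_fpi (A B : ι) (l : ℤ) : tad (R.fpi A l) s.sgn (R.fpi B) = 0 := by
  ext n : 1
  have h := R.op_mul (.π A l : Mode N ι) (.π B n)
  change R.op _ * R.op _ - s.sgn • (R.op _ * R.op _) = _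
  rw [h]
  have e : exchangeSign s (.π A l : Mode N ι) (.π B n) = s.sgn := rfl
  rw [e, add_sub_cancel_left]
  simp [modeBracket]

theorem ModeRep.tad_fphi_fphi (A B : ι) (l : ℤ) : tad (R.fphi A l) s.sgn (R.fphi B) = 0 := by
  ext n : 1
  have h := R.op_mul (.φ A l : Mode N ι) (.φ B n)
  change R.op _ * R.op _ - s.sgn • (R.op _ * R.op _) = _
  rw [h]
  have e : exchangeSign s (.φ A l : Mode N ι) (.φ B n) = s.sgn := rfl
  rw [e, add_sub_cancel_left]
  simp [modeBracket]

end FockFields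
end JetFock
end

noncomputable section

namespace JetFock

/-! ## The commutative algebra of functions of the trajectory -/

section TrajectoryAlgebra

variable {N : ℕ} {ι : Type} [DecidableEq ι] {s : Parity} {F : Type*} [AddCommGroup F] [Module ℂ F]

theorem commute_fone (A : RField F) : FieldsCommute fone A := fun m n => by
  rw [fone_apply]
  split_ifs
  · exact Commute.one_left _
  · exact Commute.zero_left _

theorem commute_shift {A B : RField F} (h : FieldsCommute A B) (r : ℤ) :
    FieldsCommute (shift r A) B := fun m n => h (m - r) n

theorem nop_fone_left (A : RField F) : nop 1 fone A = A := by
  ext k v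
  rw [(commute_fone A).nop_apply, finsum_eq_single _ 0 (fun j hj => by
    rw [fone_apply, if_neg hj, LinearMap.zero_apply]), fone_apply, if_pos rfl, sub_zero]
  rfl

theorem nop_fone_right (A : RField F) : nop 1 A fone = A := by
  rw [← (commute_fone A).nop_comm, nop_fone_left]

theorem nop_shift_fone_left (r : ℤ) (A : RField F) : nop 1 (shift r fone) A = shift r A := by
  rw [(commute_shift (commute_fone A) r).nop_comm, nop_shift_right, nop_fone_right]

theorem nop_shift_fone_right (r : ℤ) (A : RField F) : nop 1 A (shift r fone) = shift r A := by
  rw [nop_shift_right, nop_fone_right]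

variable (R : ModeRep N ι s F)

/-- The fields whose modes commute with all operators that commute with the trajectory. -/
def ModeRep.QF : Submodule ℂ (RField F) where
  carrier := {A | ∀ x, (∀ μ, tad x 1 (R.fq μ) = 0) → tad x 1 A = 0}
  add_mem' := fun hA hB x hx => by rw [map_add, hA x hx, hB x hx, add_zero]
  zero_mem' := fun x _ => map_zero _
  smul_mem' := fun c A hA x hx => by rw [map_smul, hA x hx, smul_zero]

variable {R}

theorem ModeRep.tad_QF (A : R.QF) {x : Module.End ℂ F} (hx : ∀ μ, tad x 1 (R.fq μ) = 0) :
    tad x 1 (A : RField F) = 0 := A.2 x hx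

/-- `QF` is a double commutant: whatever commutes with q commutes with A. Since q commutes with
itself, applying this twice shows that elements of `QF` commute with each other. -/
theorem ModeRep.QF_commute_of (A : R.QF) {B : RField F} (hB : ∀ μ, FieldsCommute (R.fq μ) B) :
    FieldsCommute (A : RField F) B := fun m n =>
  (tad_one_eq_zero_iff.1 (R.tad_QF A (x := B n)
    fun μ => tad_one_eq_zero_iff.2 fun k => (hB μ k n).symm) m).symm

theorem ModeRep.QF_fphi (A : R.QF) (i : ι) : FieldsCommute (A : RField F) (R.fphi i) :=
  R.QF_commute_of A fun μ => R.fq_fphi μ i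

theorem ModeRep.QF_fpi (A : R.QF) (i : ι) : FieldsCommute (A : RField F) (R.fpi i) :=
  R.QF_commute_of A fun μ => R.fq_fpi μ i

theorem ModeRep.QF_commute (A B : R.QF) : FieldsCommute (A : RField F) (B : RField F) :=
  R.QF_commute_of A fun μ => (R.QF_commute_of B fun ν => R.fq_fq ν μ).symm

instance : Mul R.QF := ⟨fun A B => ⟨nop 1 (A : RField F) (B : RField F), fun x hx => by
  rw [ad_nop, R.tad_QF A hx, R.tad_QF B hx, map_zero, map_zero, LinearMap.zero_apply, add_zero]⟩⟩

theorem tad_fone (x : Module.End ℂ F) : tad x 1 (fone : RField F) = 0 :=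
  tad_one_eq_zero_iff.2 fun n => by
    rw [fone_apply]
    split_ifs
    · exact Commute.one_right _
    · exact Commute.zero_right _

instance : One R.QF := ⟨⟨fone, fun x _ => tad_fone x⟩⟩

theorem ModeRep.coe_mul (A B : R.QF) :
    ((A * B : R.QF) : RField F) = nop 1 (A : RField F) (B : RField F) := rfl

theorem ModeRep.coe_one : ((1 : R.QF) : RField F) = fone := rfl

/-- Commuting fields have no contractions, so the Schwinger term in `nop_nop` vanishes and the
normally ordered product is associative. The ring structure makes polynomials in the trajectory
ordinary evaluations. -/
instance : CommRing R.QF :=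
  { (inferInstance : AddCommGroup R.QF) with
    mul_assoc := fun A B C => Subtype.ext (by
      simp only [R.coe_mul]
      exact nop_assoc 1 (R.QF_commute B C) fun l m => by
        rw [one_smul]; exact R.QF_commute A C l m)
    mul_comm := fun A B => Subtype.ext ((R.QF_commute A B).nop_comm)
    one_mul := fun A => Subtype.ext (nop_fone_left _)
    mul_one := fun A => Subtype.ext (nop_fone_right _)
    zero_mul := fun A => Subtype.ext (by simp [R.coe_mul])
    mul_zero := fun A => Subtype.ext (by simp [R.coe_mul])
    left_distrib := fun A B C => Subtype.ext (by simp [R.coe_mul])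
    right_distrib := fun A B C => Subtype.ext (by simp [R.coe_mul]) }

instance : Algebra ℂ R.QF :=
  Algebra.ofModule (fun c A B => Subtype.ext (by simp [R.coe_mul]))
    (fun c A B => Subtype.ext (by simp [R.coe_mul]))

/-- The time derivative of a function of the trajectory. -/
def ModeRep.qder (R : ModeRep N ι s F) : R.QF →ₗ[ℂ] R.QF :=
  tder.restrict fun A hA x hx => by rw [tad_tder, hA x hx, map_zero]

theorem ModeRep.coe_qder (A : R.QF) : (R.qder A : RField F) = tder (A : RField F) := rfl

theorem ModeRep.qder_mul (A B : R.QF) : R.qder (A * B) = R.qder A * B + A * R.qder B :=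
  by
  refine Subtype.ext ?_
  rw [Submodule.coe_add, R.coe_mul, R.coe_mul, R.coe_qder, R.coe_mul, tder_nop, R.coe_qder,
    R.coe_qder]

/-- The field `exp (-i r t)`. -/
def ModeRep.expQ (R : ModeRep N ι s F) (r : ℤ) : R.QF :=
  ⟨shift r fone, fun x hx => by rw [tad_shift, tad_fone, map_zero]⟩

theorem ModeRep.expQ_mul (r : ℤ) (A : R.QF) :
    ((R.expQ r * A : R.QF) : RField F) = shift r (A : RField F) :=
  (R.coe_mul _ _).trans (nop_shift_fone_left r _)

/-- Trigonometric polynomials as fields. -/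
def ModeRep.trigQ (R : ModeRep N ι s F) : Trig →ₐ[ℂ] R.QF :=
  AddMonoidAlgebra.lift ℂ R.QF ℤ
    { toFun := fun r => R.expQ r.toAdd
      map_one' := Subtype.ext (by ext n; simp [ModeRep.expQ, R.coe_one])
      map_mul' := fun a b => Subtype.ext (by
        rw [R.expQ_mul]
        ext n
        simp [ModeRep.expQ, sub_sub]) }

theorem ModeRep.trigQ_single (r : ℤ) (c : ℂ) :
    R.trigQ (AddMonoidAlgebra.single r c) = c • R.expQ r := by
  rw [ModeRep.trigQ, AddMonoidAlgebra.lift_single]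
  rfl

theorem ModeRep.qder_expQ (r : ℤ) : R.qder (R.expQ r) = (-Complex.I * (r : ℂ)) • R.expQ r := by
  refine Subtype.ext ?_
  ext n : 1
  change tder (shift r (fone : RField F)) n =
    (-Complex.I * (r : ℂ)) • shift r (fone : RField F) n
  rw [tder_apply, shift_apply, fone_apply]
  by_cases h : n = r
  · rw [h]
  · rw [if_neg (by omega), smul_zero, smul_zero]

theorem ModeRep.qder_trigQ (f : Trig) : R.qder (R.trigQ f) = R.trigQ (trigDeriv f) := by
  induction f using AddMonoidAlgebra.induction_linear with
  | zero => simp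
  | add f g hf hg => simp only [map_add, hf, hg]
  | single n a =>
    have : trigDeriv (AddMonoidAlgebra.single n a) =
      AddMonoidAlgebra.single n (-Complex.I * (n : ℂ) * a) := trigDerivLin_single n a
    rw [this, R.trigQ_single, R.trigQ_single, map_smul, R.qder_expQ, smul_smul, mul_comm a]

variable (R) in
/-- The coordinate `q^μ(t)` as an element of the algebra of functions of the trajectory. -/
def ModeRep.coordQ (μ : Fin N) : R.QF := ⟨R.fq μ, fun _ hx => hx μ⟩

variable (R) in
/-- Differential polynomials of the trajectory as fields. -/
def ModeRep.diffQ : DiffPoly N →+* R.QF :=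
  MvPolynomial.eval₂Hom (R.trigQ : Trig →+* R.QF) (fun v => R.qder^[v.2] (R.coordQ v.1))

@[simp] theorem ModeRep.diffQ_C (f : Trig) : R.diffQ (MvPolynomial.C f) = R.trigQ f :=
  MvPolynomial.eval₂Hom_C _ _ _

theorem ModeRep.diffQ_X (v : Fin N × ℕ) :
    R.diffQ (MvPolynomial.X v) = R.qder^[v.2] (R.coordQ v.1) :=
  MvPolynomial.eval₂Hom_X' _ _ _

/-- `diffQ` is built as a ring homomorphism on polynomials with coefficients in `Trig`; complex
scalars enter it as constant trigonometric polynomials. -/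
theorem ModeRep.diffQ_smul (c : ℂ) (P : DiffPoly N) : R.diffQ (c • P) = c • R.diffQ P := by
  have h : c • P = MvPolynomial.C (algebraMap ℂ Trig c) * P := by
    rw [← MvPolynomial.smul_eq_C_mul, algebraMap_smul]
  rw [h, map_mul, R.diffQ_C, AlgHom.commutes, Algebra.smul_def]

theorem ModeRep.qder_diffQ (P : DiffPoly N) : R.qder (R.diffQ P) = R.diffQ (totalDeriv N P) := by
  induction P using MvPolynomial.induction_on with
  | C a => rw [totalDeriv_C, R.diffQ_C, R.diffQ_C, R.qder_trigQ]
  | add p q hp hq => simp only [map_add, hp, hq]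
  | mul_X p v hp =>
    rw [map_mul, R.qder_mul, hp, Derivation.leibniz, totalDeriv_X, map_add, smul_eq_mul,
      smul_eq_mul, map_mul, map_mul, R.diffQ_X, R.diffQ_X, Function.iterate_succ_apply']
    ring

theorem ModeRep.qder_iterate_diffQ (k : ℕ) (P : DiffPoly N) :
    R.qder^[k] (R.diffQ P) = R.diffQ ((totalDeriv N)^[k] P) := by
  induction k with
  | zero => rfl
  | succ k ih => rw [Function.iterate_succ_apply', ih, R.qder_diffQ, Function.iterate_succ_apply']

theorem tad_expQ (x : Module.End ℂ F) (r : ℤ) : tad x 1 (R.expQ r : RField F) = 0 := by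
  change tad x 1 (shift r fone) = 0
  rw [tad_shift, tad_fone, map_zero]

theorem tad_trigQ (x : Module.End ℂ F) (f : Trig) : tad x 1 (R.trigQ f : RField F) = 0 := by
  induction f using AddMonoidAlgebra.induction_linear with
  | zero => simp
  | add f g hf hg => simp only [map_add, Submodule.coe_add, hf, hg, add_zero]
  | single n a => rw [R.trigQ_single, Submodule.coe_smul, map_smul, tad_expQ, smul_zero]

theorem coe_qder_iterate (k : ℕ) (A : R.QF) :
    ((R.qder^[k] A : R.QF) : RField F) = tder^[k] (A : RField F) := by
  induction k with
  | zero => rfl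
  | succ k ih => rw [Function.iterate_succ_apply', R.coe_qder, ih, Function.iterate_succ_apply']

theorem tad_tder_iterate (x : Module.End ℂ F) (k : ℕ) (A : RField F) :
    tad x 1 (tder^[k] A) = tder^[k] (tad x 1 A) := by
  induction k with
  | zero => rfl
  | succ k ih => rw [Function.iterate_succ_apply', tad_tder, ih, Function.iterate_succ_apply']

/-- The action of an operator on functions of the trajectory is determined by its action on the
trajectory. -/
theorem tad_diffQ {x : Module.End ℂ F} {Q : Fin N → DiffPoly N}
    (hx : ∀ μ, tad x 1 (R.fq μ) = R.diffQ (Q μ)) (P : DiffPoly N) :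
    tad x 1 (R.diffQ P : RField F) = R.diffQ (variation Q P) := by
  induction P using MvPolynomial.induction_on with
  | C a => rw [R.diffQ_C, tad_trigQ, MvPolynomial.derivation_C, map_zero, Submodule.coe_zero]
  | add p q hp hq => simp only [map_add, Submodule.coe_add, hp, hq]
  | mul_X p v hp =>
    -- Commutation with a fixed operator commutes with d/dt, so the action on q fixes the action on
    -- all its derivatives, just as in `variation`.
    have h : tad x 1 (R.diffQ (MvPolynomial.X v) : RField F) =
        R.diffQ ((totalDeriv N)^[v.2] (Q v.1)) := by
      rw [R.diffQ_X, coe_qder_iterate, tad_tder_iterate, ← R.qder_iterate_diffQ, coe_qder_iterate]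
      exact congrArg _ (hx v.1)
    have e : variation Q (p * MvPolynomial.X v) =
        variation Q p * MvPolynomial.X v + p * (totalDeriv N)^[v.2] (Q v.1) := by
      rw [Derivation.leibniz, variation, MvPolynomial.mkDerivation_X, smul_eq_mul, smul_eq_mul]
      ring
    rw [e, map_mul, R.coe_mul, ad_nop, hp, h, map_add, map_mul, map_mul, Submodule.coe_add,
      R.coe_mul, R.coe_mul]

/-! ### Comparison with words, monomials and polynomials in fields -/

theorem wordField_eq {σ : Type*} (Q : σ → R.QF) (l : List σ) :
    wordField (fun a => ((Q a : RField F) : OpField F)) l =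
      (((l.map Q).prod : R.QF) : RField F) := by
  induction l with
  | nil => rfl
  | cons a l ih =>
    rw [wordField, ih, (R.QF_commute _ _).mulField_eq, List.map_cons, List.prod_cons, R.coe_mul]

/-- The word is built from an arbitrary enumeration of the factors; commutativity of `QF` makes the
choice irrelevant. -/
theorem monoField_eq {σ : Type*} (Q : σ → R.QF) (m : σ →₀ ℕ) :
    monoField (fun a => ((Q a : RField F) : OpField F)) m =
      ((m.prod fun a k => Q a ^ k : R.QF) : RField F) := by
  rw [monoField, wordField_eq, Multiset.prod_map_toList, Finsupp.toMultiset_map,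
    Finsupp.prod_toMultiset, Finsupp.prod_mapDomain_index (by simp) (by simp [pow_add])]

theorem polyField_eq {σ : Type*} (Q : σ → R.QF) (P : MvPolynomial σ ℂ) :
    polyField (fun a => ((Q a : RField F) : OpField F)) P =
      ((MvPolynomial.aeval Q P : R.QF) : RField F) := by
  funext k
  rw [polyField, MvPolynomial.aeval_def, MvPolynomial.eval₂_eq]
  rw [AddSubmonoidClass.coe_finsetSum, RField.sum_apply]
  refine Finset.sum_congr rfl fun m _ => ?_
  rw [monoField_eq, ← Algebra.smul_def, Submodule.coe_smul]
  rfl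

theorem polyField_fq (P : Poly N) :
    polyField (fun μ => (R.fq μ : OpField F)) P = (R.diffQ (atTraj P) : RField F) := by
  have h := polyField_eq R.coordQ P
  rw [show (fun μ => (R.fq μ : OpField F)) =
    fun μ => ((R.coordQ μ : RField F) : OpField F) from rfl, h]
  congr 2
  clear h
  induction P using MvPolynomial.induction_on with
  | C a =>
    rw [MvPolynomial.aeval_C, atTraj, MvPolynomial.aeval_C]
    have : algebraMap ℂ (DiffPoly N) a = MvPolynomial.C (algebraMap ℂ Trig a) := rfl
    rw [this, R.diffQ_C, AlgHom.commutes]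
  | add p q hp hq => simp only [map_add, hp, hq]
  | mul_X p v hp =>
    rw [map_mul, map_mul, map_mul, MvPolynomial.aeval_X, atTraj, MvPolynomial.aeval_X, R.diffQ_X, hp]
    rfl

end TrajectoryAlgebra
end JetFock
end

noncomputable section

namespace JetFock

/-! ## The generators and their action on the elementary fields -/

section Generators

variable {N : ℕ} {ι : Type} [DecidableEq ι] {s : Parity} {F : Type*} [AddCommGroup F] [Module ℂ F]

/-! ### Contractions of normally ordered products with elementary fields. -/

theorem tad_comm_apply (A X : RField F) (k n : ℤ) : tad (A k) 1 X n = -(tad (X n) 1 A k) := by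
  simp [tad_apply]

theorem tad_add_left (x y : Module.End ℂ F) (B : RField F) :
    tad (x + y) 1 B = tad x 1 B + tad y 1 B := by
  ext n : 1
  simp only [tad_apply, RField.add_apply, one_smul, add_mul, mul_add]
  abel

theorem tad_smul_left (c : ℂ) (x : Module.End ℂ F) (B : RField F) :
    tad (c • x) 1 B = c • tad x 1 B := by
  ext n : 1
  simp only [tad_apply, RField.smul_apply, one_smul, smul_mul_assoc, mul_smul_comm, smul_sub]

/-- `x ↦ [x, B(t)]` as a linear map. -/
def adLin (B : RField F) : Module.End ℂ F →ₗ[ℂ] RField F where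
  toFun x := tad x 1 B
  map_add' x y := tad_add_left x y B
  map_smul' c x := tad_smul_left c x B

theorem adLin_apply (B : RField F) (x : Module.End ℂ F) : adLin B x = tad x 1 B := rfl

/-- Turning the commutator round lets the single mode X(n) act on the product by the Leibniz rule.
Only P is contracted, to a scalar function, so no infinite sum remains and no ordering anomaly
arises. Two twists by ε combine to an untwisted commutator. -/
theorem tad_nop_mode_of_left {ε : ℂ} (hε : ε * ε = 1) {P G X : RField F} {a : ℂ}
    (hP : ∀ n, tad (X n) ε P = a • shift (-n) fone) (hG : ∀ n, tad (X n) ε G = 0) (k : ℤ) :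
    tad (nop ε P G k) 1 X = -a • shift (-k) G := by
  ext n : 1
  have h := tad_nop (X n) hε ε ε P G
  rw [hP, hG, map_zero, smul_zero, add_zero, hε, map_smul, LinearMap.smul_apply,
    nop_shift_fone_left] at h
  rw [tad_comm_apply, h, RField.smul_apply, RField.smul_apply, shift_apply, shift_apply, neg_smul,
    show k - -n = n - -k by ring]

theorem tad_nop_mode_of_right {ε : ℂ} (hε : ε * ε = 1) {P G X H : RField F}
    (hP : ∀ n, tad (X n) ε P = 0) (hG : ∀ n, tad (X n) ε G = shift (-n) H) (k : ℤ) :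
    tad (nop ε P G k) 1 X = -ε • shift (-k) (nop 1 P H) := by
  ext n : 1
  have h := tad_nop (X n) hε ε ε P G
  rw [hP, hG, map_zero, LinearMap.zero_apply, zero_add, hε, nop_shift_right] at h
  rw [tad_comm_apply, h, RField.smul_apply, RField.smul_apply, shift_apply, shift_apply, neg_smul,
    show k - -n = n - -k by ring]

theorem shift_neg_zero (A : RField F) : shift (-0) A = A := by
  ext n : 1
  rw [shift_apply, neg_zero, sub_zero]

theorem tder_fone : tder (fone : RField F) = 0 := by
  ext n : 1
  rw [tder_apply, fone_apply, RField.zero_apply]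
  split_ifs with h
  · simp [h]
  · rw [smul_zero]

/-- The contraction is a derivative of a delta function; integrating by parts puts the derivative on
exp(ikt) P, hence on P together with the smearing function. -/
theorem tad_nop_mode_of_right_deriv {ε : ℂ} (hε : ε * ε = 1) {P G X : RField F} {a : ℂ}
    (hP : ∀ n, tad (X n) ε P = 0) (hG : ∀ n, tad (X n) ε G = a • tder (shift (-n) fone)) (k : ℤ) :
    tad (nop ε P G k) 1 X = (ε * a) • tder (shift (-k) P) := by
  ext n : 1
  have h := tad_nop (X n) hε ε ε P G
  rw [hP, hG, map_zero, LinearMap.zero_apply, zero_add, hε, tder_shift, tder_fone, map_zero,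
    zero_sub, map_smul, map_neg, map_smul, nop_shift_fone_right] at h
  rw [tad_comm_apply, h, RField.smul_apply, RField.smul_apply, RField.smul_apply,
    RField.neg_apply, RField.smul_apply, tder_apply, shift_apply, shift_apply,
    show k - -n = n - -k by ring]
  push_cast
  module

variable {R : ModeRep N ι s F}

theorem ModeRep.tad_fq_fp (ν μ : Fin N) (l : ℤ) :
    tad (R.fq ν l) 1 (R.fp μ) =
      (if ν = μ then -(1 / (2 * (Real.pi : ℂ))) else 0) • shift (-l) fone := by
  ext n : 1
  rw [tad_comm_apply, R.tad_fp_fq, RField.smul_apply, RField.smul_apply, shift_apply, shift_apply,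
    fone_apply, fone_apply, ← neg_smul, apply_ite Neg.neg, neg_zero]
  simp only [show (l - -n = 0) = (n - -l = 0) by rw [sub_neg_eq_add, sub_neg_eq_add, add_comm],
    eq_comm (a := μ)]

theorem ModeRep.tad_fphi_fpi (A B : ι) (l : ℤ) :
    tad (R.fphi A l) s.sgn (R.fpi B) =
      (if A = B then -(s.sgn * (1 / (2 * (Real.pi : ℂ)))) else 0) • shift (-l) fone := by
  ext n : 1
  have h := R.op_mul (.φ A l : Mode N ι) (.π B n)
  change R.op _ * R.op _ - s.sgn • (R.op _ * R.op _) = _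
  rw [h, RField.smul_apply, shift_apply, fone_apply]
  have e : exchangeSign s (.φ A l : Mode N ι) (.π B n) = s.sgn := rfl
  rw [e, add_sub_cancel_left]
  simp only [modeBracket, eq_comm (a := B), add_comm n]
  by_cases h₁ : A = B <;> by_cases h₂ : l + n = 0
  · rw [if_pos ⟨h₁, h₂⟩, if_pos h₁, if_pos (by omega)]
  · rw [if_neg (by tauto), if_neg (show ¬ (n - -l = 0) by omega)]; simp
  · rw [if_neg (by tauto), if_neg h₁]; simp
  · rw [if_neg (by tauto), if_neg h₁]; simp

variable (R) in
/-- The function `P(q(t))` of the trajectory. -/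
def ModeRep.trajQ : Poly N →ₐ[ℂ] R.QF := MvPolynomial.aeval R.coordQ

theorem ModeRep.trajQ_X (μ : Fin N) : R.trajQ (MvPolynomial.X μ) = R.coordQ μ :=
  MvPolynomial.aeval_X _ _

theorem ModeRep.diffQ_atTraj (P : Poly N) : R.diffQ (atTraj P) = R.trajQ P := by
  induction P using MvPolynomial.induction_on with
  | C a =>
    have : algebraMap ℂ (DiffPoly N) a = MvPolynomial.C (algebraMap ℂ Trig a) := rfl
    rw [ModeRep.trajQ, MvPolynomial.aeval_C, atTraj, MvPolynomial.aeval_C, this, R.diffQ_C,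
      AlgHom.commutes]
  | add p q hp hq => simp only [map_add, hp, hq]
  | mul_X p v hp =>
    rw [map_mul, map_mul, map_mul, R.trajQ_X, hp, atTraj, MvPolynomial.aeval_X, R.diffQ_X]
    rfl

/-- Both sides are derivations in P with values in `QF`, so it suffices to compare them on the
coordinates. -/
theorem ModeRep.tad_fp_trajQ (μ : Fin N) (l : ℤ) (P : Poly N) :
    tad (R.fp μ l) 1 (R.trajQ P : RField F) =
      shift (-l) ((1 / (2 * (Real.pi : ℂ))) • (R.trajQ (MvPolynomial.pderiv μ P) : RField F)) := by
  rw [← Submodule.coe_smul, ← R.expQ_mul]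
  induction P using MvPolynomial.induction_on with
  | C a =>
    rw [MvPolynomial.pderiv_C, ← R.diffQ_atTraj, atTraj, MvPolynomial.aeval_C]
    have : algebraMap ℂ (DiffPoly N) a = MvPolynomial.C (algebraMap ℂ Trig a) := rfl
    rw [this, R.diffQ_C, tad_trigQ]; simp
  | add p q hp hq => simp only [map_add, Submodule.coe_add, hp, hq, smul_add, mul_add]
  | mul_X p v hp =>
    have h : tad (R.fp μ l) 1 (R.coordQ v : RField F) =
        ((R.expQ (-l) * ((1 / (2 * (Real.pi : ℂ))) •
          R.trajQ (MvPolynomial.pderiv μ (MvPolynomial.X v))) : R.QF) : RField F) := by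
      rw [MvPolynomial.pderiv_X]
      change tad (R.fp μ l) 1 (R.fq v) = _
      rw [R.tad_fp_fq, R.expQ_mul]
      by_cases hv : v = μ
      · subst hv
        rw [if_pos rfl, Pi.single_eq_same, map_one, Submodule.coe_smul, map_smul]; rfl
      · rw [if_neg (Ne.symm hv), Pi.single_eq_of_ne hv]; simp
    rw [map_mul, R.trajQ_X, R.coe_mul, ad_nop, hp, h, ← R.coe_mul, ← R.coe_mul,
      ← Submodule.coe_add, Derivation.leibniz, map_add, smul_eq_mul, smul_eq_mul, map_mul, map_mul,
      R.trajQ_X]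
    congr 1
    simp only [Algebra.smul_def]
    ring

variable (R) in
/-- The field `P(q(t)) φ_A(t)`. -/
def ModeRep.trajPhi (P : Poly N) (A : ι) : RField F := nop 1 (R.trajQ P : RField F) (R.fphi A)

theorem ModeRep.tad_fpi_trajPhi (A B : ι) (l : ℤ) (P : Poly N) :
    tad (R.fpi A l) s.sgn (R.trajPhi P B) =
      shift (-l) ((if A = B then (1 / (2 * (Real.pi : ℂ))) else 0) • (R.trajQ P : RField F)) := by
  have h := tad_nop (R.fpi A l) (one_mul 1) s.sgn 1 (R.trajQ P : RField F) (R.fphi B)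
  rw [tad_one_eq_zero_iff.2 (fun n => (R.QF_fpi (R.trajQ P) A n l).symm), map_zero,
    LinearMap.zero_apply, zero_add, one_smul, one_mul, one_mul, R.tad_fpi_fphi, map_smul,
    nop_shift_fone_right] at h
  rw [ModeRep.trajPhi, h, map_smul]

theorem ModeRep.tad_fphi_trajPhi (A B : ι) (l : ℤ) (P : Poly N) :
    tad (R.fphi A l) s.sgn (R.trajPhi P B) = 0 := by
  have h := tad_nop (R.fphi A l) (one_mul 1) s.sgn 1 (R.trajQ P : RField F) (R.fphi B)
  rw [tad_one_eq_zero_iff.2 (fun n => (R.QF_fphi (R.trajQ P) A n l).symm), map_zero,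
    LinearMap.zero_apply, zero_add, one_smul, one_mul, one_mul, R.tad_fphi_fphi, map_zero] at h
  rw [ModeRep.trajPhi, h]

variable (R) in
/-- The field `:ξ^μ(q(t)) p_μ(t):`. -/
def ModeRep.vecF (ξ : VecField N) : RField F :=
  ∑ μ, nop 1 (R.fp μ) (R.trajQ (ξ μ) : RField F)

variable (R) in
/-- The field `∓ :π(t) A(q(t)) φ(t):`. -/
def ModeRep.bilF [Fintype ι] (A : Matrix ι ι (Poly N)) : RField F :=
  -s.sgn • ∑ i, ∑ j, nop s.sgn (R.fpi i) (R.trajPhi (A i j) j)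

variable (R) in
/-- The reparametrization current of the trajectory. -/
def ModeRep.repTrajF : RField F := -∑ μ, nop 1 (R.fp μ) (tder (R.fq μ))

variable (R) in
/-- The reparametrization current of the matter fields. -/
def ModeRep.repMatF [Fintype ι] (lam w : ℂ) : RField F :=
  s.sgn • ∑ A, (-nop s.sgn (R.fpi A) (tder (R.fphi A)) +
    lam • tder (nop s.sgn (R.fpi A) (R.fphi A)) +
    (Complex.I * w) • nop s.sgn (R.fpi A) (R.fphi A))

/-- The integral over the circle. -/
def circInt : RField F →ₗ[ℂ] Module.End ℂ F := (2 * (Real.pi : ℂ)) • modeLin 0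

theorem circInt_apply (A : RField F) : circInt A = (2 * (Real.pi : ℂ)) • A 0 := rfl

theorem two_pi_mul : (2 * (Real.pi : ℂ)) * (1 / (2 * (Real.pi : ℂ))) = 1 :=
  mul_one_div_cancel (by simp [Real.pi_ne_zero])

/-! ### The action of vector fields -/

theorem tad_sum_left {κ : Type*} (t : Finset κ) (x : κ → Module.End ℂ F) (B : RField F) :
    tad (∑ i ∈ t, x i) 1 B = ∑ i ∈ t, tad (x i) 1 B := map_sum (adLin B) x t

theorem tad_eq_zero_of_commute {x : Module.End ℂ F} {B : RField F} (h : ∀ n, Commute x (B n)) :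
    tad x 1 B = 0 := tad_one_eq_zero_iff.2 h

theorem tad_nop_mode_eq_zero {P G X : RField F} (ε : ℂ) (hP : FieldsCommute X P)
    (hG : FieldsCommute X G) (k : ℤ) : tad (nop ε P G k) 1 X = 0 :=
  tad_eq_zero_of_commute fun n => (hP.nop_right hG ε n k).symm

theorem ModeRep.ad_vec_fq (ξ : VecField N) (μ : Fin N) :
    tad (circInt (R.vecF ξ)) 1 (R.fq μ) = R.trajQ (ξ μ) := by
  have h : ∀ ν, tad (nop 1 (R.fp ν) (R.trajQ (ξ ν) : RField F) 0) 1 (R.fq μ) =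
      (if μ = ν then (1 / (2 * (Real.pi : ℂ))) else 0) • (R.trajQ (ξ ν) : RField F) := by
    intro ν
    rw [tad_nop_mode_of_left (one_mul 1) (R.tad_fq_fp μ ν)
      (fun n => tad_eq_zero_of_commute fun m => (R.QF_commute (R.coordQ μ) _ n m))]
    rw [apply_ite Neg.neg, neg_neg, neg_zero, shift_neg_zero]
  rw [circInt_apply, tad_smul_left, ModeRep.vecF, RField.sum_apply, tad_sum_left]
  simp only [h, ite_smul, zero_smul]
  rw [Finset.sum_ite_eq, if_pos (Finset.mem_univ _), smul_smul, two_pi_mul, one_smul]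

theorem ModeRep.ad_vec_fp (ξ : VecField N) (μ : Fin N) :
    tad (circInt (R.vecF ξ)) 1 (R.fp μ) =
      -∑ ν, nop 1 (R.fp ν) (R.trajQ (MvPolynomial.pderiv μ (ξ ν)) : RField F) := by
  have h : ∀ ν, tad (nop 1 (R.fp ν) (R.trajQ (ξ ν) : RField F) 0) 1 (R.fp μ) =
      -(1 / (2 * (Real.pi : ℂ))) •
        nop 1 (R.fp ν) (R.trajQ (MvPolynomial.pderiv μ (ξ ν)) : RField F) := by
    intro ν
    rw [tad_nop_mode_of_right (one_mul 1)
      (fun n => tad_eq_zero_of_commute fun m => (R.fp_fp μ ν n m))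
      (fun n => R.tad_fp_trajQ μ n (ξ ν)), map_smul, map_smul, smul_smul, neg_one_mul,
      shift_neg_zero]
  rw [circInt_apply, tad_smul_left, ModeRep.vecF, RField.sum_apply, tad_sum_left]
  simp only [h]
  rw [← Finset.smul_sum, smul_smul, mul_neg, two_pi_mul, neg_one_smul]

theorem ModeRep.ad_vec_fphi (ξ : VecField N) (A : ι) :
    tad (circInt (R.vecF ξ)) 1 (R.fphi A) = 0 := by
  rw [circInt_apply, tad_smul_left, ModeRep.vecF, RField.sum_apply, tad_sum_left,
    Finset.sum_eq_zero, smul_zero]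
  exact fun ν _ => tad_nop_mode_eq_zero 1 (R.fp_fphi ν A).symm (R.QF_fphi _ A).symm 0

theorem ModeRep.ad_vec_fpi (ξ : VecField N) (A : ι) :
    tad (circInt (R.vecF ξ)) 1 (R.fpi A) = 0 := by
  rw [circInt_apply, tad_smul_left, ModeRep.vecF, RField.sum_apply, tad_sum_left,
    Finset.sum_eq_zero, smul_zero]
  exact fun ν _ => tad_nop_mode_eq_zero 1 (R.fp_fpi ν A).symm (R.QF_fpi _ A).symm 0

/-! ### The action of reparametrizations on the trajectory -/

/-- The integral against `exp (-i r t)`. -/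
def modeInt (r : ℤ) : RField F →ₗ[ℂ] Module.End ℂ F := (2 * (Real.pi : ℂ)) • modeLin (-r)

theorem modeInt_apply (r : ℤ) (A : RField F) :
    modeInt r A = (2 * (Real.pi : ℂ)) • A (-r) := rfl

theorem ModeRep.modeInt_repTrajF (r : ℤ) : modeInt r R.repTrajF =
    -(2 * (Real.pi : ℂ)) • ∑ μ, nop 1 (R.fp μ) (tder (R.fq μ)) (-r) := by
  rw [modeInt_apply, ModeRep.repTrajF, RField.neg_apply, RField.sum_apply, smul_neg, neg_smul]

theorem ModeRep.ad_repTraj_fq (r : ℤ) (μ : Fin N) :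
    tad (modeInt r R.repTrajF) 1 (R.fq μ) = -shift r (tder (R.fq μ)) := by
  have h : ∀ ν, tad (nop 1 (R.fp ν) (tder (R.fq ν)) (-r)) 1 (R.fq μ) =
      if μ = ν then (1 / (2 * (Real.pi : ℂ))) • shift r (tder (R.fq ν)) else 0 := by
    intro ν
    rw [tad_nop_mode_of_left (one_mul 1) (R.tad_fq_fp μ ν)
      (fun n => by rw [tad_tder, tad_eq_zero_of_commute fun m => R.fq_fq μ ν n m, map_zero]),
      apply_ite Neg.neg, neg_neg, neg_zero, ite_smul, zero_smul, neg_neg]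
  rw [R.modeInt_repTrajF, tad_smul_left, tad_sum_left]
  simp only [h, Finset.sum_ite_eq, Finset.mem_univ, if_true]
  rw [smul_smul, neg_mul, two_pi_mul, neg_one_smul]

theorem ModeRep.ad_repTraj_fp (r : ℤ) (μ : Fin N) :
    tad (modeInt r R.repTrajF) 1 (R.fp μ) = -tder (shift r (R.fp μ)) := by
  have h : ∀ ν, tad (nop 1 (R.fp ν) (tder (R.fq ν)) (-r)) 1 (R.fp μ) =
      if μ = ν then (1 / (2 * (Real.pi : ℂ))) • tder (shift r (R.fp ν)) else 0 := by
    intro ν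
    rw [tad_nop_mode_of_right_deriv (one_mul 1)
      (a := if μ = ν then (1 / (2 * (Real.pi : ℂ))) else 0)
      (fun n => tad_eq_zero_of_commute fun m => R.fp_fp μ ν n m)
      (fun n => by rw [tad_tder, R.tad_fp_fq, map_smul]), one_mul, ite_smul, zero_smul, neg_neg]
  rw [R.modeInt_repTrajF, tad_smul_left, tad_sum_left]
  simp only [h, Finset.sum_ite_eq, Finset.mem_univ, if_true]
  rw [smul_smul, neg_mul, two_pi_mul, neg_one_smul]

theorem commute_tder {A B : RField F} (h : FieldsCommute A B) : FieldsCommute A (tder B) :=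
  fun m n => by rw [tder_apply]; exact (h m n).smul_right _

theorem ModeRep.ad_repTraj_of_commute (r : ℤ) {X : RField F}
    (hp : ∀ μ, FieldsCommute X (R.fp μ)) (hq : ∀ μ, FieldsCommute X (R.fq μ)) :
    tad (modeInt r R.repTrajF) 1 X = 0 := by
  rw [R.modeInt_repTrajF, tad_smul_left, tad_sum_left, Finset.sum_eq_zero, smul_zero]
  exact fun μ _ => tad_nop_mode_eq_zero 1 (hp μ) (commute_tder (hq μ)) _

/-! ### The action of bilinears in the matter fields -/

theorem ModeRep.fq_trajPhi (μ : Fin N) (P : Poly N) (A : ι) :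
    FieldsCommute (R.fq μ) (R.trajPhi P A) :=
  FieldsCommute.nop_right (R.QF_commute (R.coordQ μ) _) (R.fq_fphi μ A) 1

variable [Fintype ι]

theorem ModeRep.ad_bil_fq (A : Matrix ι ι (Poly N)) (μ : Fin N) :
    tad (circInt (R.bilF A)) 1 (R.fq μ) = 0 := by
  rw [circInt_apply, tad_smul_left, ModeRep.bilF, RField.smul_apply, tad_smul_left,
    RField.sum_apply, tad_sum_left, Finset.sum_eq_zero, smul_zero, smul_zero]
  intro i _
  rw [RField.sum_apply, tad_sum_left, Finset.sum_eq_zero]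
  exact fun j _ => tad_nop_mode_eq_zero _ (R.fq_fpi μ i) (R.fq_trajPhi μ _ j) 0

theorem ModeRep.ad_bil_fphi (A : Matrix ι ι (Poly N)) (i : ι) :
    tad (circInt (R.bilF A)) 1 (R.fphi i) = -∑ j, R.trajPhi (A i j) j := by
  have h : ∀ k j, tad (nop s.sgn (R.fpi k) (R.trajPhi (A k j) j) 0) 1 (R.fphi i) =
      if i = k then (s.sgn * (1 / (2 * (Real.pi : ℂ)))) • R.trajPhi (A k j) j else 0 := by
    intro k j
    rw [tad_nop_mode_of_left s.sgn_mul_self (R.tad_fphi_fpi i k)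
      (fun n => R.tad_fphi_trajPhi i j n _), apply_ite Neg.neg, neg_neg, neg_zero, ite_smul,
      zero_smul, shift_neg_zero]
  rw [circInt_apply, tad_smul_left, ModeRep.bilF, RField.smul_apply, tad_smul_left,
    RField.sum_apply, tad_sum_left]
  simp only [RField.sum_apply, tad_sum_left, h]
  rw [Finset.sum_comm]
  simp only [Finset.sum_ite_eq, Finset.mem_univ, if_true]
  rw [← Finset.smul_sum, smul_smul, smul_smul]
  -- The scalars 2π from the integral, minus the sign from the current and sign/2π from the
  -- contraction multiply to -1.
  convert neg_one_smul ℂ _ using 2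
  linear_combination (-1 : ℂ) * s.sgn_mul_self - s.sgn * s.sgn * two_pi_mul

theorem ModeRep.ad_bil_fpi (A : Matrix ι ι (Poly N)) (i : ι) :
    tad (circInt (R.bilF A)) 1 (R.fpi i) =
      ∑ k, nop 1 (R.fpi k) (R.trajQ (A k i) : RField F) := by
  have h : ∀ k j, tad (nop s.sgn (R.fpi k) (R.trajPhi (A k j) j) 0) 1 (R.fpi i) =
      if i = j then -(s.sgn * (1 / (2 * (Real.pi : ℂ)))) •
        nop 1 (R.fpi k) (R.trajQ (A k j) : RField F) else 0 := by
    intro k j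
    rw [tad_nop_mode_of_right s.sgn_mul_self (fun n => R.tad_fpi_fpi i k n)
      (fun n => R.tad_fpi_trajPhi i j n _), ite_smul, zero_smul]
    split_ifs
    · rw [map_smul, map_smul, smul_smul, neg_mul, shift_neg_zero]
    · simp
  rw [circInt_apply, tad_smul_left, ModeRep.bilF, RField.smul_apply, tad_smul_left,
    RField.sum_apply, tad_sum_left]
  simp only [RField.sum_apply, tad_sum_left, h, Finset.sum_ite_eq, Finset.mem_univ, if_true]
  rw [← Finset.smul_sum, smul_smul, smul_smul]
  convert one_smul ℂ _ using 2
  linear_combination s.sgn_mul_self + s.sgn * s.sgn * two_pi_mul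

/-! ### The action of reparametrizations on matter -/

/-- Mode -r of the total derivative carries the factor ir, so λ and w enter only through λr + w. -/
theorem ModeRep.modeInt_repMatF (lam w : ℂ) (r : ℤ) : modeInt r (R.repMatF lam w) =
    (2 * (Real.pi : ℂ) * s.sgn) • ∑ A, (-nop s.sgn (R.fpi A) (tder (R.fphi A)) (-r) +
      (Complex.I * (lam * r + w)) • nop s.sgn (R.fpi A) (R.fphi A) (-r)) := by
  rw [modeInt_apply, ModeRep.repMatF, RField.smul_apply, RField.sum_apply, smul_smul]
  congr 1
  refine Finset.sum_congr rfl fun A _ => ?_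
  rw [RField.add_apply, RField.add_apply, RField.neg_apply, RField.smul_apply, RField.smul_apply,
    tder_apply, add_assoc, smul_smul, ← add_smul]
  congr 2
  push_cast
  ring

theorem ModeRep.ad_repMat_of_commute (lam w : ℂ) (r : ℤ) {X : RField F}
    (hπ : ∀ A, FieldsCommute X (R.fpi A)) (hφ : ∀ A, FieldsCommute X (R.fphi A)) :
    tad (modeInt r (R.repMatF lam w)) 1 X = 0 := by
  rw [R.modeInt_repMatF, tad_smul_left, tad_sum_left, Finset.sum_eq_zero, smul_zero]
  intro A _
  rw [← adLin_apply, map_add, map_neg, map_smul, adLin_apply, adLin_apply,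
    tad_nop_mode_eq_zero _ (hπ A) (commute_tder (hφ A)), tad_nop_mode_eq_zero _ (hπ A) (hφ A),
    neg_zero, smul_zero, add_zero]

/-- This is a density of weight λ, with w as an additional twist under exp(-irt). -/
theorem ModeRep.ad_repMat_fphi (lam w : ℂ) (r : ℤ) (i : ι) :
    tad (modeInt r (R.repMatF lam w)) 1 (R.fphi i) =
      shift r (-tder (R.fphi i) + (Complex.I * (lam * r + w)) • R.fphi i) := by
  have h₁ : ∀ A, tad (nop s.sgn (R.fpi A) (tder (R.fphi A)) (-r)) 1 (R.fphi i) =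
      if i = A then (s.sgn * (1 / (2 * (Real.pi : ℂ)))) • shift r (tder (R.fphi A)) else 0 := by
    intro A
    rw [tad_nop_mode_of_left s.sgn_mul_self (R.tad_fphi_fpi i A)
      (fun n => by rw [tad_tder, R.tad_fphi_fphi, map_zero]),
      apply_ite Neg.neg, neg_neg, neg_zero, ite_smul, zero_smul, neg_neg]
  have h₂ : ∀ A, tad (nop s.sgn (R.fpi A) (R.fphi A) (-r)) 1 (R.fphi i) =
      if i = A then (s.sgn * (1 / (2 * (Real.pi : ℂ)))) • shift r (R.fphi A) else 0 := by
    intro A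
    rw [tad_nop_mode_of_left s.sgn_mul_self (R.tad_fphi_fpi i A) (R.tad_fphi_fphi i A),
      apply_ite Neg.neg, neg_neg, neg_zero, ite_smul, zero_smul, neg_neg]
  rw [R.modeInt_repMatF, ← adLin_apply, map_smul, map_sum]
  simp only [map_add, map_neg, map_smul, adLin_apply, h₁, h₂, smul_ite, smul_zero,
    Finset.sum_add_distrib, Finset.sum_neg_distrib, Finset.sum_ite_eq, Finset.mem_univ, if_true]
  have e : (2 * (Real.pi : ℂ) * s.sgn) * (s.sgn * (1 / (2 * (Real.pi : ℂ)))) = 1 := by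
    linear_combination s.sgn_mul_self + s.sgn * s.sgn * two_pi_mul
  rw [smul_add, smul_neg, smul_smul, e, one_smul, smul_comm (2 * (Real.pi : ℂ) * s.sgn),
    smul_smul (2 * (Real.pi : ℂ) * s.sgn), e, one_smul]

/-- Dual to the action on φ, so the weight is 1 - λ: the total derivative acts on exp(-irt) π as a
whole, and the λ, w term changes sign. -/
theorem ModeRep.ad_repMat_fpi (lam w : ℂ) (r : ℤ) (i : ι) :
    tad (modeInt r (R.repMatF lam w)) 1 (R.fpi i) =
      -tder (shift r (R.fpi i)) - (Complex.I * (lam * r + w)) • shift r (R.fpi i) := by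
  have h₁ : ∀ A, tad (nop s.sgn (R.fpi A) (tder (R.fphi A)) (-r)) 1 (R.fpi i) =
      if i = A then (s.sgn * (1 / (2 * (Real.pi : ℂ)))) • tder (shift r (R.fpi A)) else 0 := by
    intro A
    rw [tad_nop_mode_of_right_deriv s.sgn_mul_self
      (a := if i = A then (1 / (2 * (Real.pi : ℂ))) else 0) (R.tad_fpi_fpi i A)
      (fun n => by rw [tad_tder, R.tad_fpi_fphi, map_smul]), mul_ite, mul_zero, ite_smul,
      zero_smul, neg_neg]
  have h₂ : ∀ A, tad (nop s.sgn (R.fpi A) (R.fphi A) (-r)) 1 (R.fpi i) =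
      if i = A then -((s.sgn * (1 / (2 * (Real.pi : ℂ)))) • shift r (R.fpi A)) else 0 := by
    intro A
    rw [tad_nop_mode_of_right s.sgn_mul_self
      (H := (if i = A then (1 / (2 * (Real.pi : ℂ))) else 0) • fone) (R.tad_fpi_fpi i A)
      (fun n => by rw [R.tad_fpi_fphi, map_smul]), map_smul, nop_fone_right, map_smul,
      ite_smul, zero_smul, neg_neg, smul_ite, smul_zero]
    congr 1
    module
  rw [R.modeInt_repMatF, ← adLin_apply, map_smul, map_sum]
  simp only [map_add, map_neg, map_smul, adLin_apply, h₁, h₂, smul_ite, smul_zero, smul_neg,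
    Finset.sum_add_distrib, Finset.sum_neg_distrib, Finset.sum_ite_eq, Finset.mem_univ, if_true]
  have e : (2 * (Real.pi : ℂ) * s.sgn) * (s.sgn * (1 / (2 * (Real.pi : ℂ)))) = 1 := by
    linear_combination s.sgn_mul_self + s.sgn * s.sgn * two_pi_mul
  rw [smul_add, smul_neg, smul_neg, smul_smul, e, one_smul, smul_comm (2 * (Real.pi : ℂ) * s.sgn),
    smul_smul (2 * (Real.pi : ℂ) * s.sgn), e, one_smul, sub_eq_add_neg]

end Generators
end JetFock
end

noncomputable section

namespace JetFock

/-! ## Commutators of the generators -/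

/-- The derivative of a matrix of functions along a vector field. -/
def alongMat {N : ℕ} {ι : Type*} (ξ : VecField N) (A : Matrix ι ι (Poly N)) :
   Matrix ι ι (Poly N) := fun i j =>
  ∑ ν, ξ ν * MvPolynomial.pderiv ν (A i j)

section Commutators

variable {N : ℕ} {ι : Type} [DecidableEq ι] {s : Parity} {F : Type*} [AddCommGroup F] [Module ℂ F]

theorem commutator_modeInt (x : Module.End ℂ F) (r : ℤ) (B : RField F) :
    x * modeInt r B - modeInt r B * x = modeInt r (tad x 1 B) := by
  rw [modeInt_apply, modeInt_apply, tad_apply, one_smul, smul_sub, mul_smul_comm, smul_mul_assoc]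

theorem commutator_circInt (x : Module.End ℂ F) (B : RField F) :
    x * circInt B - circInt B * x = circInt (tad x 1 B) := commutator_modeInt x 0 B

theorem circInt_tder (B : RField F) : circInt (tder B) = 0 := by
  rw [circInt_apply, tder_apply, Int.cast_zero, mul_zero, zero_smul, smul_zero]

/-- The chain rule along the trajectory; `totalDeriv_atTraj` is its counterpart for d/dt. -/
theorem variation_atTraj (Q : Fin N → DiffPoly N) (P : Poly N) :
    variation Q (atTraj P) = ∑ ν, Q ν * atTraj (MvPolynomial.pderiv ν P) := by
  induction P using MvPolynomial.induction_on with
  | C a =>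
    have : atTraj (N := N) (MvPolynomial.C a) = MvPolynomial.C (algebraMap ℂ Trig a) := by
      rw [atTraj, MvPolynomial.aeval_C]; rfl
    simp [this]
  | add p q hp hq => simp only [map_add, hp, hq, mul_add, Finset.sum_add_distrib]
  | mul_X p v hp =>
    have hX : atTraj (N := N) (MvPolynomial.X v) = MvPolynomial.X (v, 0) :=
      MvPolynomial.aeval_X _ _
    simp only [Derivation.leibniz, map_mul, map_add, smul_eq_mul, hX, hp, mul_add,
      Finset.sum_add_distrib, MvPolynomial.pderiv_X]
    congr 1
    · rw [variation, MvPolynomial.mkDerivation_X, Finset.sum_eq_single v]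
      · simp [mul_comm]
      · intro b _ hb; simp [Pi.single_eq_of_ne (Ne.symm hb)]
      · simp
    · rw [Finset.mul_sum]
      exact Finset.sum_congr rfl fun ν _ => by ring

theorem totalDeriv_atTraj (P : Poly N) :
    totalDeriv N (atTraj P) = ∑ ν, velocity ν * atTraj (MvPolynomial.pderiv ν P) := by
  induction P using MvPolynomial.induction_on with
  | C a =>
    have : atTraj (N := N) (MvPolynomial.C a) = MvPolynomial.C (algebraMap ℂ Trig a) := by
      rw [atTraj, MvPolynomial.aeval_C]; rfl
    have h0 : trigDeriv (algebraMap ℂ Trig a) = 0 := trigDeriv.map_algebraMap a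
    rw [this, totalDeriv_C, h0, map_zero]
    simp
  | add p q hp hq => simp only [map_add, hp, hq, mul_add, Finset.sum_add_distrib]
  | mul_X p v hp =>
    have hX : atTraj (N := N) (MvPolynomial.X v) = MvPolynomial.X (v, 0) :=
      MvPolynomial.aeval_X _ _
    simp only [Derivation.leibniz, map_mul, map_add, smul_eq_mul, hX, hp, mul_add,
      Finset.sum_add_distrib, MvPolynomial.pderiv_X]
    congr 1
    · rw [totalDeriv_X, Finset.sum_eq_single v]
      · simp [velocity, mul_comm]
      · intro b _ hb; simp [Pi.single_eq_of_ne (Ne.symm hb)]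
      · simp
    · rw [Finset.mul_sum]
      exact Finset.sum_congr rfl fun ν _ => by ring

/-! ### Brackets of vector field currents and matter bilinears. -/

variable {R : ModeRep N ι s F}

theorem coe_sum_QF {κ : Type*} (t : Finset κ) (A : κ → R.QF) :
    ((∑ i ∈ t, A i : R.QF) : RField F) = ∑ i ∈ t, (A i : RField F) :=
  map_sum R.QF.subtype A t

theorem tad_trajQ {x : Module.End ℂ F} {Q : Fin N → DiffPoly N}
    (hx : ∀ μ, tad x 1 (R.fq μ) = R.diffQ (Q μ)) (P : Poly N) :
    tad x 1 (R.trajQ P : RField F) =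
      ((∑ ν, R.diffQ (Q ν) * R.trajQ (MvPolynomial.pderiv ν P) : R.QF) : RField F) := by
  rw [← R.diffQ_atTraj, tad_diffQ hx, variation_atTraj, map_sum]
  simp only [map_mul, R.diffQ_atTraj]

theorem ad_vec_fq_diffQ (ξ : VecField N) (μ : Fin N) :
    tad (circInt (R.vecF ξ)) 1 (R.fq μ) = R.diffQ (atTraj (ξ μ)) := by
  rw [R.ad_vec_fq, R.diffQ_atTraj]

theorem ad_vec_trajQ (ξ : VecField N) (P : Poly N) :
    tad (circInt (R.vecF ξ)) 1 (R.trajQ P : RField F) =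
      R.trajQ (∑ ν, ξ ν * MvPolynomial.pderiv ν P) := by
  rw [tad_trajQ (ad_vec_fq_diffQ ξ), map_sum]
  simp only [map_mul, R.diffQ_atTraj]

/-- The Leibniz rule gives the classical bracket, but the term where ∫:ξp: acts on p comes out as
:(:p ∂ξ:) η:. Re-bracketing it produces the Schwinger term, the source of the summand 1 in c₁. -/
theorem ad_vec_vec (ξ η : VecField N) :
    tad (circInt (R.vecF ξ)) 1 (R.vecF η) = R.vecF (vecBracket ξ η) -
      (Complex.I * (1 / (2 * (Real.pi : ℂ)))) • ((∑ μ, ∑ ν,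
        R.qder (R.trajQ (MvPolynomial.pderiv μ (ξ ν))) *
          R.trajQ (MvPolynomial.pderiv ν (η μ)) : R.QF) : RField F) := by
  have h : ∀ μ, tad (circInt (R.vecF ξ)) 1 (nop 1 (R.fp μ) (R.trajQ (η μ) : RField F)) =
      nop 1 (R.fp μ) (R.trajQ (∑ ν, ξ ν * MvPolynomial.pderiv ν (η μ)) : RField F) -
      ∑ ν, (nop 1 (R.fp ν) (R.trajQ (η μ * MvPolynomial.pderiv μ (ξ ν)) : RField F) +
        (Complex.I * (1 / (2 * (Real.pi : ℂ)))) • ((R.qder (R.trajQ (MvPolynomial.pderiv μ (ξ ν))) *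
          R.trajQ (MvPolynomial.pderiv ν (η μ)) : R.QF) : RField F)) := by
    intro μ
    rw [ad_nop, R.ad_vec_fp, ad_vec_trajQ, map_neg, LinearMap.neg_apply, map_sum,
      LinearMap.sum_apply, neg_add_eq_sub]
    congr 1
    refine Finset.sum_congr rfl fun ν _ => ?_
    -- Here H is ∂_μ ξ^ν, and the contraction of p_ν with η^μ(q) is ∂_ν η^μ/2π.
    rw [nop_nop 1 (C := (1 / (2 * (Real.pi : ℂ))) •
      (R.trajQ (MvPolynomial.pderiv ν (η μ)) : RField F)) (R.QF_commute _ _)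
      (by rw [← Submodule.coe_smul]; exact R.QF_commute _ _)
      (fun l m => by
        have := congrArg (fun A : RField F => A m) (R.tad_fp_trajQ ν l (η μ))
        rw [tad_apply, shift_apply] at this
        rw [this, show m - -l = l + m by ring])]
    rw [map_smul, smul_smul, ← R.coe_mul, ← map_mul, mul_comm (η μ), R.coe_mul, R.coe_qder]
  generalize circInt (R.vecF ξ) = x at h ⊢
  simp only [ModeRep.vecF, map_sum (tad _ _)]
  rw [Finset.sum_congr rfl fun μ _ => h μ, Finset.sum_sub_distrib]
  simp only [Finset.sum_add_distrib, vecBracket, Finset.sum_sub_distrib, map_sub, map_sum,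
    Submodule.coe_sub, coe_sum_QF, Finset.smul_sum]
  rw [Finset.sum_comm (f := fun μ ν => nop 1 (R.fp ν)
    (R.trajQ (η μ * MvPolynomial.pderiv μ (ξ ν)) : RField F))]
  abel

theorem ModeRep.trajPhi_sum {κ : Type*} (t : Finset κ) (P : κ → Poly N) (i : ι) :
    R.trajPhi (∑ k ∈ t, P k) i = ∑ k ∈ t, R.trajPhi (P k) i := by
  simp only [ModeRep.trajPhi, map_sum, coe_sum_QF, LinearMap.sum_apply]

theorem ModeRep.nop_trajPhi (P Q : Poly N) (i : ι) :
    nop 1 (R.trajQ P : RField F) (R.trajPhi Q i) = R.trajPhi (P * Q) i := by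
  rw [ModeRep.trajPhi, ModeRep.trajPhi, map_mul, R.coe_mul, nop_assoc 1 (R.QF_fphi _ i)]
  intro l m
  rw [one_smul]
  exact R.QF_fphi _ i l m

theorem ModeRep.QF_trajPhi (A : R.QF) (P : Poly N) (i : ι) :
    FieldsCommute (A : RField F) (R.trajPhi P i) :=
  FieldsCommute.nop_right (R.QF_commute A _) (R.QF_fphi A i) 1

theorem fpi_trajPhi_commutator (i j : ι) (P : Poly N) (l m : ℤ) :
    R.fpi i l * R.trajPhi P j m - s.sgn • (R.trajPhi P j m * R.fpi i l) =
      ((if i = j then (1 / (2 * (Real.pi : ℂ))) else 0) • (R.trajQ P : RField F)) (l + m) := by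
  have := congrArg (fun A : RField F => A m) (R.tad_fpi_trajPhi i j l P)
  rw [tad_apply, shift_apply] at this
  rw [this, show m - -l = l + m by ring]

theorem fp_trajQ_commutator (μ : Fin N) (P : Poly N) (l m : ℤ) :
    R.fp μ l * (R.trajQ P : RField F) m - (1 : ℂ) • ((R.trajQ P : RField F) m * R.fp μ l) =
      (1 / (2 * (Real.pi : ℂ))) • (R.trajQ (MvPolynomial.pderiv μ P) : RField F) (l + m) := by
  have := congrArg (fun A : RField F => A m) (R.tad_fp_trajQ μ l P)
  rw [tad_apply, shift_apply] at this
  rw [this, show m - -l = l + m by ring]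
  rfl

theorem commutator_diffQ {x : Module.End ℂ F} {Q : Fin N → DiffPoly N}
    (hx : ∀ μ, tad x 1 (R.fq μ) = R.diffQ (Q μ)) (P : DiffPoly N) :
    x * circInt (R.diffQ P : RField F) - circInt (R.diffQ P : RField F) * x =
      circInt (R.diffQ (variation Q P) : RField F) := by
  rw [commutator_circInt, tad_diffQ hx]
variable [Fintype ι]

/-- Anomaly-free: the vector field current commutes with π and φ and only differentiates the
coefficients, so nothing has to be reordered. -/
theorem ad_vec_bil (ξ : VecField N) (A : Matrix ι ι (Poly N)) :
    tad (circInt (R.vecF ξ)) 1 (R.bilF A) = R.bilF (alongMat ξ A) := by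
  simp only [ModeRep.bilF, map_smul, map_sum (tad _ _), ad_nop, R.ad_vec_fpi, map_zero,
    LinearMap.zero_apply, zero_add, ModeRep.trajPhi, R.ad_vec_fphi, add_zero, ad_vec_trajQ,
    alongMat]

theorem ad_bil_trajQ (A : Matrix ι ι (Poly N)) (P : Poly N) :
    tad (circInt (R.bilF A)) 1 (R.trajQ P : RField F) = 0 :=
  R.tad_QF _ (R.ad_bil_fq A)

theorem ModeRep.bilF_sub (A B : Matrix ι ι (Poly N)) : R.bilF (A - B) = R.bilF A - R.bilF B := by
  have h : ∀ i j, R.trajPhi ((A - B) i j) j = R.trajPhi (A i j) j - R.trajPhi (B i j) j := by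
    intro i j
    simp [ModeRep.trajPhi]
  simp only [ModeRep.bilF, h, map_sub, Finset.sum_sub_distrib, smul_sub]

/-- The action on φ leaves the order standard; the action on π requires re-bracketing, and the
contraction of π with φ closes the product of the matrices into a trace. -/
theorem ad_bil_bil (A B : Matrix ι ι (Poly N)) :
    tad (circInt (R.bilF A)) 1 (R.bilF B) = R.bilF (A * B - B * A) -
      (s.sgn * (Complex.I * (1 / (2 * (Real.pi : ℂ))))) • ((∑ i, ∑ k,
        R.qder (R.trajQ (A k i)) * R.trajQ (B i k) : R.QF) : RField F) := by
  have h : ∀ i j, tad (circInt (R.bilF A)) 1 (nop s.sgn (R.fpi i) (R.trajPhi (B i j) j)) =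
      (∑ k, nop s.sgn (R.fpi k) (R.trajPhi (A k i * B i j) j) +
        (Complex.I * (1 / (2 * (Real.pi : ℂ)))) •
          ((R.qder (R.trajQ (A j i)) * R.trajQ (B i j) : R.QF) : RField F)) -
      ∑ k, nop s.sgn (R.fpi i) (R.trajPhi (B i j * A j k) k) := by
    intro i j
    have h₁ : tad (circInt (R.bilF A)) 1 (R.trajPhi (B i j) j) =
        -∑ k, R.trajPhi (B i j * A j k) k := by
      rw [ModeRep.trajPhi, ad_nop, ad_bil_trajQ, map_zero, LinearMap.zero_apply, zero_add,
        R.ad_bil_fphi, map_neg, map_sum]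
      simp only [R.nop_trajPhi]
    -- π^k and B φ_j have a contraction only for k = j, and it equals B/2π.
    have h₂ : ∀ k, nop s.sgn (nop 1 (R.fpi k) (R.trajQ (A k i) : RField F)) (R.trajPhi (B i j) j) =
        nop s.sgn (R.fpi k) (R.trajPhi (A k i * B i j) j) +
        if k = j then (Complex.I * (1 / (2 * (Real.pi : ℂ)))) •
          ((R.qder (R.trajQ (A k i)) * R.trajQ (B i j) : R.QF) : RField F) else 0 := by
      intro k
      rw [nop_nop s.sgn (R.QF_trajPhi _ _ j)
        (by rw [← Submodule.coe_smul]; exact R.QF_commute _ _)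
        (fpi_trajPhi_commutator k j (B i j)), R.nop_trajPhi, map_smul, smul_smul, mul_ite, mul_zero,
        ite_smul, zero_smul, R.coe_mul, R.coe_qder]
    rw [ad_nop, R.ad_bil_fpi, map_sum, LinearMap.sum_apply, h₁, map_neg, map_sum,
      Finset.sum_congr rfl fun k _ => h₂ k, Finset.sum_add_distrib, Finset.sum_ite_eq',
      if_pos (Finset.mem_univ _), ← sub_eq_add_neg]
  rw [R.bilF_sub]
  generalize circInt (R.bilF A) = x at h ⊢
  simp only [ModeRep.bilF, map_smul, map_sum (tad _ _)]
  rw [Finset.sum_congr rfl fun i _ => Finset.sum_congr rfl fun j _ => h i j]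
  simp only [Finset.sum_sub_distrib, Finset.sum_add_distrib, Matrix.mul_apply, R.trajPhi_sum,
    map_sum (nop _ _), coe_sum_QF]
  have e₁ : ∑ i, ∑ j, ∑ k, nop s.sgn (R.fpi k) (R.trajPhi (A k i * B i j) j) =
      ∑ i, ∑ j, ∑ k, nop s.sgn (R.fpi i) (R.trajPhi (A i k * B k j) j) := by
    rw [Finset.sum_congr rfl fun i _ => Finset.sum_comm, Finset.sum_comm]
    exact Finset.sum_congr rfl fun i _ => Finset.sum_comm
  have e₂ : ∑ i, ∑ j, ∑ k, nop s.sgn (R.fpi i) (R.trajPhi (B i j * A j k) k) =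
      ∑ i, ∑ j, ∑ k, nop s.sgn (R.fpi i) (R.trajPhi (B i k * A k j) j) :=
    Finset.sum_congr rfl fun i _ => Finset.sum_comm
  rw [e₁, e₂]
  simp only [← Finset.smul_sum]
  module

/-! ### Reparametrizations of conjugate pairs of fields -/

section ConjugatePairs

variable {ε : ℂ} {P G C : RField F}

/-- In this and the next two lemmas the contraction is a polynomial in the mode m of G, of degree 0,
1 and 2. The coefficients are the power sums of m = (k - r) + ρ over 0 ≤ ρ < r, continued
polynomially to negative r. -/
theorem nop_shift_left_zero
    (hPG : ∀ l m, P l * G m - ε • (G m * P l) = (1 / (2 * (Real.pi : ℂ))) • C (l + m)) (k r : ℤ) :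
    nop ε (shift r P) G k = nop ε P G (k - r) + ((r : ℂ) / (2 * (Real.pi : ℂ))) • C (k - r) := by
  have := nop_shift_left ε (C := C) (a := fun _ _ => 1 / (2 * (Real.pi : ℂ))) hPG (k - r)
    (b := fun r => (r : ℂ) / (2 * (Real.pi : ℂ))) (by simp) (fun r => by push_cast; ring) r
  rwa [sub_add_cancel] at this

theorem nop_shift_left_one
    (hPG : ∀ l m, P l * G m - ε • (G m * P l) = (1 / (2 * (Real.pi : ℂ))) • C (l + m)) (k r : ℤ) :
    nop ε (shift r P) (tder G) k = nop ε P (tder G) (k - r) +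
      (-Complex.I * ((k - r) * r + r * (r - 1) / 2) / (2 * (Real.pi : ℂ))) • C (k - r) := by
  have := nop_shift_left ε (P := P) (G := tder G) (C := C) (a := fun _ m => -Complex.I * m * (1 / (2 * (Real.pi : ℂ))))
    (fun l m => by
      rw [tder_apply, mul_smul_comm, smul_mul_assoc, smul_comm ε, ← smul_sub, hPG, smul_smul])
    (k - r)
    (b := fun ρ : ℤ => -Complex.I * ((k - r) * ρ + ρ * (ρ - 1) / 2) / (2 * (Real.pi : ℂ)))
    (by simp) (fun ρ => by push_cast; ring) r
  rwa [sub_add_cancel] at this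

theorem nop_shift_left_two
    (hPG : ∀ l m, P l * G m - ε • (G m * P l) = (1 / (2 * (Real.pi : ℂ))) • C (l + m)) (k r : ℤ) :
    nop ε (shift r P) (tder (tder G)) k = nop ε P (tder (tder G)) (k - r) +
      (-((k - r) ^ 2 * r + (k - r) * r * (r - 1) + (r - 1) * r * (2 * r - 1) / 6) /
        (2 * (Real.pi : ℂ))) • C (k - r) := by
  have := nop_shift_left ε (P := P) (G := tder (tder G)) (C := C) (a := fun _ m => -(m : ℂ) ^ 2 * (1 / (2 * (Real.pi : ℂ))))
    (fun l m => by
      rw [tder_apply, tder_apply, smul_smul, mul_smul_comm, smul_mul_assoc, smul_comm ε, ← smul_sub,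
        hPG, smul_smul]
      congr 1
      linear_combination (m : ℂ) ^ 2 * (1 / (2 * (Real.pi : ℂ))) * Complex.I_mul_I)
    (k - r)
    (b := fun ρ : ℤ => -((k - r) ^ 2 * ρ + (k - r) * ρ * (ρ - 1) + (ρ - 1) * ρ * (2 * ρ - 1) / 6) /
        (2 * (Real.pi : ℂ)))
    (by simp) (fun ρ => by push_cast; ring) r
  rwa [sub_add_cancel] at this

/-- The anomaly in the reparametrization of `∫ :P(t) G(t):` if `P` has weight `1 - λ` and `G` has
weight `λ`, where `e = λ r + w`. -/
theorem ad_rep_nop {x : Module.End ℂ F} {r : ℤ} {e : ℂ}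
    (hPG : ∀ l m, P l * G m - ε • (G m * P l) = (1 / (2 * (Real.pi : ℂ))) • C (l + m))
    (hP : tad x 1 P = -tder (shift r P) - (Complex.I * e) • shift r P)
    (hG : tad x 1 G = shift r (-tder G + (Complex.I * e) • G)) :
    tad x 1 (nop ε P G) 0 =
      (Complex.I * ((r ^ 2 + r) / 2 - e * r) / (2 * (Real.pi : ℂ))) • C (-r) := by
  -- Mode 0 of a total derivative vanishes, so the derivative can be moved from exp(-irt) P to G.
  -- What is left compares products with P shifted and unshifted.
  have h := tder_nop ε (shift r P) G
  have h' := congrArg (fun A : RField F => A 0) h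
  simp only [tder_apply, Int.cast_zero, mul_zero, zero_smul, RField.add_apply] at h'
  rw [ad_nop, hP, hG]
  simp only [map_sub, map_neg, map_smul, LinearMap.sub_apply, LinearMap.neg_apply,
    LinearMap.smul_apply, nop_shift_right, map_add, RField.add_apply, RField.sub_apply,
    RField.neg_apply, RField.smul_apply, shift_apply]
  rw [eq_neg_of_add_eq_zero_left h'.symm, nop_shift_left_zero hPG, nop_shift_left_one hPG, zero_sub]
  push_cast
  module

theorem ad_rep_rep {x : Module.End ℂ F} {r : ℤ} (lam w : ℂ)
    (hPG : ∀ l m, P l * G m - ε • (G m * P l) =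
      (1 / (2 * (Real.pi : ℂ))) • (fone : RField F) (l + m))
    (hP : tad x 1 P = -tder (shift r P) - (Complex.I * (lam * r + w)) • shift r P)
    (hG : tad x 1 G = shift r (-tder G + (Complex.I * (lam * r + w)) • G)) (q : ℤ) :
    tad x 1 (-nop ε P (tder G) + (Complex.I * (lam * q + w)) • nop ε P G) (-q) =
      (Complex.I * (r - q)) • (-nop ε P (tder G) +
        (Complex.I * (lam * (r + q : ℤ) + w)) • nop ε P G) (-(r + q)) +
      ((-(1 / 6 - lam + lam ^ 2) * r ^ 3 + (1 / 6 - w + w ^ 2) * r) / (2 * (Real.pi : ℂ))) •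
        (fone : RField F) (r + q) := by
  have h₀ := congrArg (fun A : RField F => A (-q)) (tder_nop ε (shift r P) G)
  have h₁ := congrArg (fun A : RField F => A (-q)) (tder_nop ε (shift r P) (tder G))
  simp only [tder_apply, RField.add_apply] at h₀ h₁
  have hDG : tad x 1 (tder G) = shift r (-tder (tder G) + (Complex.I * (lam * r + w)) • tder G) -
      (Complex.I * r) • shift r (-tder G + (Complex.I * (lam * r + w)) • G) := by
    rw [tad_tder, hG, tder_shift, map_add, map_neg, map_smul]
  simp only [map_add, map_neg, map_smul, ad_nop, hP, hDG, hG, map_sub,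
    LinearMap.sub_apply, LinearMap.neg_apply, LinearMap.smul_apply, nop_shift_right,
    RField.add_apply, RField.sub_apply, RField.neg_apply, RField.smul_apply, shift_apply]
  rw [eq_sub_of_add_eq h₀.symm, eq_sub_of_add_eq h₁.symm, nop_shift_left_zero hPG,
    nop_shift_left_one hPG, nop_shift_left_two hPG, show -(r + q) = -q - r by ring]
  -- The central term is a multiple of the constant field and survives only for q = -r. There the
  -- three power sums combine to a cubic in r; elsewhere the identity is the classical one.
  by_cases hrq : r + q = 0
  · obtain rfl : q = -r := by omega
    rw [fone_apply, fone_apply, if_pos (by omega), if_pos (by omega)]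
    push_cast
    match_scalars <;> ring_nf <;> (simp only [Complex.I_sq]; ring)
  · rw [fone_apply, fone_apply, if_neg (by omega), if_neg (by omega)]
    push_cast
    match_scalars <;> ring_nf

end ConjugatePairs

/-! ### Brackets with the reparametrization current. -/

variable (R) in
/-- The integral of the reparametrization current against `exp (-i r t)`, without its constant
term. -/
def ModeRep.repGen (lam w : ℂ) (r : ℤ) : Module.End ℂ F :=
  modeInt r (R.repTrajF + R.repMatF lam w)

theorem tad_repGen (lam w : ℂ) (r : ℤ) (B : RField F) : tad (R.repGen lam w r) 1 B =
    tad (modeInt r R.repTrajF) 1 B + tad (modeInt r (R.repMatF lam w)) 1 B := by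
  rw [ModeRep.repGen, map_add, tad_add_left]

theorem ad_rep_fq (lam w : ℂ) (r : ℤ) (μ : Fin N) :
    tad (R.repGen lam w r) 1 (R.fq μ) = -shift r (tder (R.fq μ)) := by
  rw [tad_repGen, R.ad_repTraj_fq, R.ad_repMat_of_commute lam w r (R.fq_fpi μ) (R.fq_fphi μ),
    add_zero]

theorem ad_rep_fp (lam w : ℂ) (r : ℤ) (μ : Fin N) :
    tad (R.repGen lam w r) 1 (R.fp μ) = -tder (shift r (R.fp μ)) := by
  rw [tad_repGen, R.ad_repTraj_fp, R.ad_repMat_of_commute lam w r (R.fp_fpi μ) (R.fp_fphi μ),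
    add_zero]

theorem ad_rep_fphi (lam w : ℂ) (r : ℤ) (i : ι) :
    tad (R.repGen lam w r) 1 (R.fphi i) =
      shift r (-tder (R.fphi i) + (Complex.I * (lam * r + w)) • R.fphi i) := by
  rw [tad_repGen, R.ad_repMat_fphi, R.ad_repTraj_of_commute r (fun μ => (R.fp_fphi μ i).symm)
    (fun μ => (R.fq_fphi μ i).symm), zero_add]

theorem ad_rep_fpi (lam w : ℂ) (r : ℤ) (i : ι) :
    tad (R.repGen lam w r) 1 (R.fpi i) =
      -tder (shift r (R.fpi i)) - (Complex.I * (lam * r + w)) • shift r (R.fpi i) := by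
  rw [tad_repGen, R.ad_repMat_fpi, R.ad_repTraj_of_commute r (fun μ => (R.fp_fpi μ i).symm)
    (fun μ => (R.fq_fpi μ i).symm), zero_add]

theorem ad_rep_fq_diffQ (lam w : ℂ) (r : ℤ) (μ : Fin N) :
    tad (R.repGen lam w r) 1 (R.fq μ) =
      R.diffQ (-(MvPolynomial.C (AddMonoidAlgebra.single r 1) * velocity μ)) := by
  rw [ad_rep_fq, map_neg, map_mul, R.diffQ_C, R.trigQ_single, one_smul, Submodule.coe_neg,
    R.expQ_mul, velocity, R.diffQ_X]
  rfl

theorem ad_rep_trajQ (lam w : ℂ) (r : ℤ) (P : Poly N) :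
    tad (R.repGen lam w r) 1 (R.trajQ P : RField F) =
      -shift r (tder (R.trajQ P : RField F)) := by
  rw [tad_trajQ (ad_rep_fq_diffQ lam w r), ← R.coe_qder, ← R.expQ_mul, ← Submodule.coe_neg]
  congr 1
  rw [← R.diffQ_atTraj P, R.qder_diffQ, totalDeriv_atTraj, map_sum, Finset.mul_sum,
    ← Finset.sum_neg_distrib]
  refine Finset.sum_congr rfl fun ν _ => ?_
  rw [map_neg, map_mul, map_mul, R.diffQ_C, R.trigQ_single, one_smul, R.diffQ_atTraj]
  ring

/-- Functions of q have weight zero, so P(q) φ transforms exactly like φ and can take its place in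
`ad_rep_nop`. -/
theorem ad_rep_trajPhi (lam w : ℂ) (r : ℤ) (P : Poly N) (i : ι) :
    tad (R.repGen lam w r) 1 (R.trajPhi P i) =
      shift r (-tder (R.trajPhi P i) + (Complex.I * (lam * r + w)) • R.trajPhi P i) := by
  have h : nop 1 (shift r (tder (R.trajQ P : RField F))) (R.fphi i) =
      shift r (nop 1 (tder (R.trajQ P : RField F)) (R.fphi i)) := by
    have hc : FieldsCommute (tder (R.trajQ P : RField F)) (R.fphi i) :=
      R.QF_fphi (R.qder (R.trajQ P)) i
    rw [(commute_shift hc r).nop_comm, hc.nop_comm, nop_shift_right]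
  rw [ModeRep.trajPhi, ad_nop, ad_rep_trajQ, ad_rep_fphi, tder_nop]
  simp only [map_neg, map_add, map_smul, LinearMap.neg_apply, h, nop_shift_right]
  abel

/-- The pair p_μ, ξ^μ(q) has weights 1 and 0 and contraction ∂_μ ξ^μ. This yields the summand 1 in
c₃ and a₃. -/
theorem ad_rep_vec (lam w : ℂ) (r : ℤ) (ξ : VecField N) :
    circInt (tad (R.repGen lam w r) 1 (R.vecF ξ)) =
      (Complex.I * (r ^ 2 + r) / 2) • (R.trajQ (divergence ξ) : RField F) (-r) := by
  have h : ∀ μ, tad (R.repGen lam w r) 1 (nop 1 (R.fp μ) (R.trajQ (ξ μ) : RField F)) 0 = _ :=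
    fun μ => ad_rep_nop (r := r) (e := 0) (fp_trajQ_commutator μ (ξ μ))
      (by rw [ad_rep_fp]; simp) (by rw [ad_rep_trajQ]; simp)
  rw [circInt_apply, ModeRep.vecF, map_sum, RField.sum_apply, Finset.sum_congr rfl fun μ _ => h μ,
    ← Finset.smul_sum, smul_smul, divergence, map_sum, coe_sum_QF, RField.sum_apply]
  congr 1
  have := two_pi_mul
  field_simp
  ring

/-- Only diagonal terms of the bilinear contract, hence the trace; the polynomial in r already
displays the factors 2λ - 1 and 2w - 1. -/
theorem ad_rep_bil (lam w : ℂ) (r : ℤ) (A : Matrix ι ι (Poly N)) :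
    circInt (tad (R.repGen lam w r) 1 (R.bilF A)) =
      (s.sgn * (Complex.I * ((2 * lam - 1) * r ^ 2 + (2 * w - 1) * r) / 2)) •
        (R.trajQ A.trace : RField F) (-r) := by
  have h : ∀ i j, tad (R.repGen lam w r) 1 (nop s.sgn (R.fpi i) (R.trajPhi (A i j) j)) 0 =
      if i = j then (Complex.I * ((r ^ 2 + r) / 2 - (lam * r + w) * r) / (2 * (Real.pi : ℂ))) •
        (R.trajQ (A i j) : RField F) (-r) else 0 := by
    intro i j
    have := ad_rep_nop (x := R.repGen lam w r) (r := r) (e := lam * r + w)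
      (C := (if i = j then 1 else 0 : ℂ) • (R.trajQ (A i j) : RField F))
      (fun l m => by
        rw [fpi_trajPhi_commutator i j (A i j) l m, RField.smul_apply, RField.smul_apply, smul_smul,
          mul_ite, mul_one, mul_zero])
      (ad_rep_fpi lam w r i) (ad_rep_trajPhi lam w r (A i j) j)
    rw [this, RField.smul_apply, ite_smul, one_smul, zero_smul, smul_ite, smul_zero]
  rw [circInt_apply, ModeRep.bilF, map_smul, map_sum, RField.smul_apply, RField.sum_apply]
  simp only [map_sum, RField.sum_apply, h, Finset.sum_ite_eq, Finset.mem_univ, if_true]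
  rw [← Finset.smul_sum, smul_smul, smul_smul, Matrix.trace, map_sum, coe_sum_QF, RField.sum_apply]
  simp only [Matrix.diag_apply]
  congr 1
  have hpi : (Real.pi : ℂ) ≠ 0 := by simp [Real.pi_ne_zero]
  field_simp
  ring

/-- The current is a sum over conjugate pairs: N pairs (p, q) with λ = w = 0, and one pair (π, φ)
for each jet component with parameters λ, w. Their central terms add up. -/
theorem ad_rep_repGen (lam w : ℂ) (r q : ℤ) :
    modeInt q (tad (R.repGen lam w r) 1 (R.repTrajF + R.repMatF lam w)) =
      (Complex.I * (r - q)) • R.repGen lam w (r + q) +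
      ((N : ℂ) * (-(1 / 6) * r ^ 3 + (1 / 6) * r) + s.sgn * Fintype.card ι *
        (-(1 / 6 - lam + lam ^ 2) * r ^ 3 + (1 / 6 - w + w ^ 2) * r)) •
          (fone : RField F) (r + q) := by
  have h₁ : ∀ μ, tad (R.repGen lam w r) 1 (-nop 1 (R.fp μ) (tder (R.fq μ))) (-q) =
      (Complex.I * (r - q)) • (-nop 1 (R.fp μ) (tder (R.fq μ)) : RField F) (-(r + q)) +
      ((-(1 / 6) * r ^ 3 + (1 / 6) * r) / (2 * (Real.pi : ℂ))) • (fone : RField F) (r + q) := by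
    intro μ
    have := ad_rep_rep (x := R.repGen lam w r) (r := r) (ε := 1) (P := R.fp μ) (G := R.fq μ) 0 0
      (fun l m => by
        have := congrArg (fun A : RField F => A m) (R.tad_fp_fq μ μ l)
        rw [tad_apply, if_pos rfl, RField.smul_apply, shift_apply] at this
        rw [this, show m - -l = l + m by ring])
      (by rw [ad_rep_fp]; simp) (by rw [ad_rep_fq]; simp) q
    simpa using this
  have h₂ : ∀ A, tad (R.repGen lam w r) 1 (-nop s.sgn (R.fpi A) (tder (R.fphi A)) +
        (Complex.I * (lam * q + w)) • nop s.sgn (R.fpi A) (R.fphi A)) (-q) = _ :=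
    fun A => ad_rep_rep lam w
      (fun l m => by
        have := congrArg (fun B : RField F => B m) (R.tad_fpi_fphi A A l)
        rw [tad_apply, if_pos rfl, RField.smul_apply, shift_apply] at this
        rw [this, show m - -l = l + m by ring])
      (ad_rep_fpi lam w r A) (ad_rep_fphi lam w r A) q
  have e₁ : ∀ k, tad (R.repGen lam w r) 1 R.repTrajF k =
      ∑ μ, tad (R.repGen lam w r) 1 (-nop 1 (R.fp μ) (tder (R.fq μ))) k := by
    intro k
    rw [ModeRep.repTrajF, ← Finset.sum_neg_distrib, map_sum, RField.sum_apply]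
  have e₂ : tad (R.repGen lam w r) 1 (R.repMatF lam w) (-q) =
      s.sgn • ∑ A, tad (R.repGen lam w r) 1 (-nop s.sgn (R.fpi A) (tder (R.fphi A)) +
        (Complex.I * (lam * q + w)) • nop s.sgn (R.fpi A) (R.fphi A)) (-q) := by
    rw [ModeRep.repMatF, map_smul, map_sum, RField.smul_apply, RField.sum_apply]
    congr 1
    refine Finset.sum_congr rfl fun A _ => ?_
    simp only [map_add, map_smul, tad_tder, RField.add_apply, RField.smul_apply, tder_apply]
    push_cast
    module
  have e₃ : R.repGen lam w (r + q) = (2 * (Real.pi : ℂ)) •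
      (∑ μ, (-nop 1 (R.fp μ) (tder (R.fq μ)) : RField F) (-(r + q))) +
      (2 * (Real.pi : ℂ) * s.sgn) • ∑ A, (-nop s.sgn (R.fpi A) (tder (R.fphi A)) +
        (Complex.I * (lam * (r + q : ℤ) + w)) • nop s.sgn (R.fpi A) (R.fphi A)) (-(r + q)) := by
    rw [ModeRep.repGen, map_add, R.modeInt_repTrajF, R.modeInt_repMatF]
    simp only [RField.neg_apply, RField.add_apply, RField.smul_apply, Finset.sum_neg_distrib,
      smul_neg, neg_smul]
  have hpi : (Real.pi : ℂ) ≠ 0 := by simp [Real.pi_ne_zero]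
  rw [modeInt_apply, map_add, RField.add_apply, e₁, e₂, Finset.sum_congr rfl fun μ _ => h₁ μ,
    Finset.sum_congr rfl fun A _ => h₂ A, e₃]
  simp only [Finset.sum_add_distrib, ← Finset.smul_sum, Finset.sum_const, Finset.card_univ,
    Fintype.card_fin, ← Nat.cast_smul_eq_nsmul ℂ]
  match_scalars <;> field_simp


end Commutators
end JetFock
end

noncomputable section

namespace JetFock

/-! ## Multi-indices and iterated partial derivatives -/

section MultiIndices

variable {N : ℕ}

theorem pderiv_comm (μ ν : Fin N) (P : Poly N) :
    MvPolynomial.pderiv μ (MvPolynomial.pderiv ν P) =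
      MvPolynomial.pderiv ν (MvPolynomial.pderiv μ P) := by
  have h : ⁅(MvPolynomial.pderiv μ : Derivation ℂ (Poly N) (Poly N)),
      (MvPolynomial.pderiv ν : Derivation ℂ (Poly N) (Poly N))⁆ = 0 := by
    apply MvPolynomial.derivation_ext
    intro i
    rw [Derivation.commutator_apply, MvPolynomial.pderiv_X, MvPolynomial.pderiv_X]
    by_cases hμ : i = μ <;> by_cases hν : i = ν <;>
      simp [Pi.single_apply, hμ, hν, apply_ite]
  have := congrArg (fun D : Derivation ℂ (Poly N) (Poly N) => D P) h
  rw [Derivation.commutator_apply] at this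
  exact sub_eq_zero.mp this

/-- The partial derivative `∂_m` as a linear map. -/
def multiDerivLin (m : Fin N → ℕ) : Module.End ℂ (Poly N) :=
  ((List.finRange N).map fun μ =>
    ((MvPolynomial.pderiv μ).toLinearMap : Module.End ℂ (Poly N)) ^ m μ).prod

theorem multiDerivLin_apply (m : Fin N → ℕ) (P : Poly N) :
    multiDerivLin m P = multiDeriv m P := by
  unfold multiDerivLin multiDeriv
  induction List.finRange N with
  | nil => rfl
  | cons μ l ih =>
    rw [List.map_cons, List.prod_cons, Module.End.mul_apply, ih, List.foldr_cons,
      Module.End.pow_apply]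
    rfl

theorem commute_pderiv (μ ν : Fin N) :
    Commute ((MvPolynomial.pderiv μ).toLinearMap : Module.End ℂ (Poly N))
      (MvPolynomial.pderiv ν).toLinearMap :=
  LinearMap.ext fun P => pderiv_comm μ ν P

theorem multiDerivLin_add (m n : Fin N → ℕ) :
    (multiDerivLin (m + n) : Module.End ℂ (Poly N)) = multiDerivLin m * multiDerivLin n := by
  unfold multiDerivLin
  induction List.finRange N with
  | nil => simp
  | cons μ l ih =>
    rw [List.map_cons, List.prod_cons, ih, List.map_cons, List.prod_cons, List.map_cons,
      List.prod_cons, Pi.add_apply, pow_add, mul_assoc, mul_assoc]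
    congr 1
    rw [← mul_assoc, ← mul_assoc]
    congr 1
    refine Commute.list_prod_right _ _ fun x hx => ?_
    obtain ⟨ν, _, rfl⟩ := List.mem_map.mp hx
    exact (commute_pderiv μ ν).pow_pow _ _

theorem multiDerivLin_single (μ : Fin N) :
    (multiDerivLin (Pi.single μ 1) : Module.End ℂ (Poly N)) =
      (MvPolynomial.pderiv μ).toLinearMap := by
  have key : ∀ l : List (Fin N), l.Nodup →
      (l.map fun ν => ((MvPolynomial.pderiv ν).toLinearMap : Module.End ℂ (Poly N)) ^
        (Pi.single μ 1 : Fin N → ℕ) ν).prod =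
      if μ ∈ l then (MvPolynomial.pderiv μ).toLinearMap else 1 := by
    intro l hl
    induction l with
    | nil => simp
    | cons ν l ih =>
      rw [List.map_cons, List.prod_cons, ih (List.nodup_cons.mp hl).2]
      by_cases h : μ = ν
      · subst h
        simp [(List.nodup_cons.mp hl).1]
      · simp [h, Ne.symm h]
  rw [multiDerivLin, key _ (List.nodup_finRange N)]
  simp

theorem multiDeriv_zero (P : Poly N) : multiDeriv 0 P = P := by
  rw [← multiDerivLin_apply, multiDerivLin]
  simp

theorem multiDeriv_add_index (m n : Fin N → ℕ) (P : Poly N) :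
    multiDeriv (m + n) P = multiDeriv m (multiDeriv n P) := by
  simp only [← multiDerivLin_apply, multiDerivLin_add, Module.End.mul_apply]

theorem multiDeriv_single (μ : Fin N) (P : Poly N) :
    multiDeriv (Pi.single μ 1) P = MvPolynomial.pderiv μ P := by
  rw [← multiDerivLin_apply, multiDerivLin_single]; rfl

theorem multiDeriv_succ (m : Fin N → ℕ) (μ : Fin N) (P : Poly N) :
    multiDeriv (m + Pi.single μ 1) P = MvPolynomial.pderiv μ (multiDeriv m P) := by
  rw [add_comm, multiDeriv_add_index, multiDeriv_single]

theorem multiDeriv_succ' (m : Fin N → ℕ) (μ : Fin N) (P : Poly N) :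
    multiDeriv (m + Pi.single μ 1) P = multiDeriv m (MvPolynomial.pderiv μ P) := by
  rw [multiDeriv_add_index, multiDeriv_single]

theorem multiDeriv_add (m : Fin N → ℕ) (P Q : Poly N) :
    multiDeriv m (P + Q) = multiDeriv m P + multiDeriv m Q := by
  simp only [← multiDerivLin_apply, map_add]

theorem multiDeriv_sub (m : Fin N → ℕ) (P Q : Poly N) :
    multiDeriv m (P - Q) = multiDeriv m P - multiDeriv m Q := by
  simp only [← multiDerivLin_apply, map_sub]

theorem multiDeriv_apply_zero (m : Fin N → ℕ) : multiDeriv m (0 : Poly N) = 0 := by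
  simp only [← multiDerivLin_apply, map_zero]

theorem multiDeriv_sum {κ : Type*} (S : Finset κ) (m : Fin N → ℕ) (P : κ → Poly N) :
    multiDeriv m (∑ i ∈ S, P i) = ∑ i ∈ S, multiDeriv m (P i) := by
  simp only [← multiDerivLin_apply, map_sum]

theorem multiIndex_induction {motive : (Fin N → ℕ) → Prop} (zero : motive 0)
    (succ : ∀ m μ, motive m → motive (m + Pi.single μ 1)) (m : Fin N → ℕ) : motive m := by
  suffices h : ∀ (d : ℕ) (m : Fin N → ℕ), ∑ μ, m μ = d → motive m from h _ m rfl
  intro d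
  induction d with
  | zero =>
    intro m hm
    have : m = 0 := funext fun μ => (Finset.sum_eq_zero_iff.mp hm) μ (Finset.mem_univ μ)
    exact this ▸ zero
  | succ d ih =>
    intro m hm
    obtain ⟨μ, hμ⟩ : ∃ μ, m μ ≠ 0 := by
      by_contra! h
      simp [h] at hm
    have hle : Pi.single μ 1 ≤ m := by
      intro ν
      by_cases h : ν = μ
      · subst h; simpa using Nat.one_le_iff_ne_zero.mpr hμ
      · simp [h]
    have e : m = (m - Pi.single μ 1) + Pi.single μ 1 := (tsub_add_cancel_of_le hle).symm
    rw [e]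
    apply succ
    apply ih
    have : ∑ ν, m ν = ∑ ν, (m - Pi.single μ 1 : Fin N → ℕ) ν + ∑ ν, (Pi.single μ 1 : Fin N → ℕ) ν := by
      rw [← Finset.sum_add_distrib]
      conv_lhs => rw [e]
      rfl
    rw [hm, Finset.sum_pi_single'] at this
    simpa using this.symm

theorem single_le_iff {μ : Fin N} {m : Fin N → ℕ} : Pi.single μ 1 ≤ m ↔ 1 ≤ m μ := by
  constructor
  · intro h; simpa using h μ
  · intro h ν
    by_cases h' : ν = μ
    · subst h'; simpa using h
    · simp [h']

theorem sum_add_single (m : Fin N → ℕ) (μ : Fin N) :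
    ∑ ν, (m + Pi.single μ 1 : Fin N → ℕ) ν = ∑ ν, m ν + 1 := by
  simp [Finset.sum_add_distrib]

theorem multiChoose_eq_zero {n k : Fin N → ℕ} (h : ¬ k ≤ n) : multiChoose n k = 0 := by
  obtain ⟨μ, hμ⟩ := not_forall.mp h
  exact Finset.prod_eq_zero (Finset.mem_univ μ) (Nat.choose_eq_zero_of_lt (not_le.mp hμ))

theorem multiChoose_self (n : Fin N → ℕ) : multiChoose n n = 1 := by
  simp [multiChoose]

/-- Pascal's rule in the factor at μ; the other factors are unchanged. -/
theorem multiChoose_succ (n k : Fin N → ℕ) (μ : Fin N) :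
    multiChoose (n + Pi.single μ 1) k =
      multiChoose n k + if 1 ≤ k μ then multiChoose n (k - Pi.single μ 1) else 0 := by
  have split : ∀ a b : Fin N → ℕ, multiChoose a b =
      (a μ).choose (b μ) * ∏ ν ∈ Finset.univ.erase μ, (a ν).choose (b ν) := fun a b =>
    (Finset.mul_prod_erase _ _ (Finset.mem_univ μ)).symm
  have h1 : ∏ ν ∈ Finset.univ.erase μ, ((n + Pi.single μ 1 : Fin N → ℕ) ν).choose (k ν) =
      ∏ ν ∈ Finset.univ.erase μ, (n ν).choose (k ν) :=
    Finset.prod_congr rfl fun ν hν => by simp [Finset.ne_of_mem_erase hν]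
  have h2 : ∏ ν ∈ Finset.univ.erase μ, (n ν).choose ((k - Pi.single μ 1 : Fin N → ℕ) ν) =
      ∏ ν ∈ Finset.univ.erase μ, (n ν).choose (k ν) :=
    Finset.prod_congr rfl fun ν hν => by simp [Finset.ne_of_mem_erase hν]
  rw [split, split n k, split n (k - _), h1, h2]
  split_ifs with h
  · rw [← add_mul]
    congr 1
    obtain ⟨j, hj⟩ := Nat.exists_eq_add_of_le' h
    simp [hj, Nat.choose_succ_succ, add_comm]
  · have : k μ = 0 := by omega
    simp [this]

/-- The general Leibniz rule, by induction on n: the further derivative falls on f or on g, matching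
the two terms of Pascal's rule. -/
theorem multiDeriv_mul (n : Fin N → ℕ) (f g : Poly N) :
    multiDeriv n (f * g) = ∑ k ∈ Finset.Iic n,
      MvPolynomial.C (multiChoose n k : ℂ) * multiDeriv (n - k) f * multiDeriv k g := by
  induction n using multiIndex_induction with
  | zero =>
    have : Finset.Iic (0 : Fin N → ℕ) = {0} := by
      ext k; simp
    rw [this, Finset.sum_singleton]
    simp [multiDeriv_zero, multiChoose]
  | succ n μ ih =>
    set e : Fin N → ℕ := Pi.single μ 1 with he
    have hA : ∑ k ∈ Finset.Iic (n + e), MvPolynomial.C (multiChoose n k : ℂ) *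
        multiDeriv (n + e - k) f * multiDeriv k g =
        ∑ k ∈ Finset.Iic n, MvPolynomial.C (multiChoose n k : ℂ) *
          MvPolynomial.pderiv μ (multiDeriv (n - k) f) * multiDeriv k g := by
      symm
      rw [← Finset.sum_subset (Finset.Iic_subset_Iic.mpr (le_self_add : n ≤ n + e))]
      · refine Finset.sum_congr rfl fun k hk => ?_
        have hk' : k ≤ n := Finset.mem_Iic.mp hk
        rw [← multiDeriv_succ, tsub_add_eq_add_tsub hk']
      · intro k _ hk
        rw [multiChoose_eq_zero (fun h => hk (Finset.mem_Iic.mpr h))]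
        simp
    have hB : ∑ k ∈ Finset.Iic (n + e), MvPolynomial.C
          ((if 1 ≤ k μ then multiChoose n (k - e) else 0 : ℕ) : ℂ) *
        multiDeriv (n + e - k) f * multiDeriv k g =
        ∑ k ∈ Finset.Iic n, MvPolynomial.C (multiChoose n k : ℂ) *
          multiDeriv (n - k) f * MvPolynomial.pderiv μ (multiDeriv k g) := by
      symm
      have hinj : Function.Injective (fun k : Fin N → ℕ => k + e) := add_left_injective e
      have himg : (Finset.Iic n).image (fun k => k + e) ⊆ Finset.Iic (n + e) := by
        intro k hk
        obtain ⟨j, hj, rfl⟩ := Finset.mem_image.mp hk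
        exact Finset.mem_Iic.mpr (add_le_add_left (Finset.mem_Iic.mp hj) e)
      rw [← Finset.sum_subset himg, Finset.sum_image hinj.injOn]
      · refine Finset.sum_congr rfl fun k hk => ?_
        have h1 : 1 ≤ (k + e) μ := by simp [he]
        rw [if_pos h1, add_tsub_cancel_right, add_tsub_add_eq_tsub_right, multiDeriv_succ]
      · intro k hk hk'
        split_ifs with h
        · exfalso
          apply hk'
          have hek : e ≤ k := single_le_iff.mpr h
          refine Finset.mem_image.mpr ⟨k - e, Finset.mem_Iic.mpr ?_, tsub_add_cancel_of_le hek⟩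
          exact tsub_le_iff_right.mpr (Finset.mem_Iic.mp hk)
        · simp
    have hc : ∀ k, multiChoose (n + e) k =
        multiChoose n k + if 1 ≤ k μ then multiChoose n (k - e) else 0 := fun k =>
      multiChoose_succ n k μ
    rw [he, multiDeriv_succ, ih, map_sum, ← he]
    simp only [hc, Nat.cast_add, map_add, add_mul, Finset.sum_add_distrib]
    rw [hA, hB, ← Finset.sum_add_distrib]
    refine Finset.sum_congr rfl fun k _ => ?_
    simp only [Derivation.leibniz, smul_eq_mul, MvPolynomial.pderiv_C]
    ring

/-- The truncated subtraction in the exponent is harmless: if some entry of k exceeds that of m, its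
falling factorial is zero. -/
theorem multiDeriv_monomial (k : Fin N → ℕ) (m : Fin N →₀ ℕ) (a : ℂ) :
    multiDeriv k (MvPolynomial.monomial m a) =
      MvPolynomial.monomial (m - Finsupp.equivFunOnFinite.symm k)
        (a * ∏ μ, ((m μ).descFactorial (k μ) : ℂ)) := by
  induction k using multiIndex_induction with
  | zero =>
    have : (Finsupp.equivFunOnFinite.symm (0 : Fin N → ℕ)) = 0 := by ext; rfl
    simp [multiDeriv_zero, this]
  | succ k μ ih =>
    rw [multiDeriv_succ, ih, MvPolynomial.pderiv_monomial]
    refine congrArg₂ (fun (l : Fin N →₀ ℕ) (c : ℂ) => MvPolynomial.monomial l c) ?_ ?_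
    · ext ν
      change m ν - k ν - (Finsupp.single μ 1) ν = m ν - (k ν + (Pi.single μ 1 : Fin N → ℕ) ν)
      rw [Nat.sub_sub, Finsupp.single_apply, Pi.single_apply]
      simp only [eq_comm]
    · rw [mul_assoc]
      congr 1
      have split : ∀ l : Fin N → ℕ, ∏ ν, ((m ν).descFactorial (l ν) : ℂ) =
          (m μ).descFactorial (l μ) * ∏ ν ∈ Finset.univ.erase μ, ((m ν).descFactorial (l ν) : ℂ) :=
        fun l => (Finset.mul_prod_erase _ _ (Finset.mem_univ μ)).symm
      rw [split, split (k + Pi.single μ 1)]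
      have h1 : ∏ ν ∈ Finset.univ.erase μ,
          ((m ν).descFactorial ((k + Pi.single μ 1 : Fin N → ℕ) ν) : ℂ) =
          ∏ ν ∈ Finset.univ.erase μ, ((m ν).descFactorial (k ν) : ℂ) :=
        Finset.prod_congr rfl fun ν hν => by simp [Finset.ne_of_mem_erase hν]
      rw [h1]
      have h2 : ((m - Finsupp.equivFunOnFinite.symm k) μ : ℕ) = m μ - k μ := rfl
      rw [h2]
      simp only [Pi.add_apply, Pi.single_eq_same, Nat.descFactorial_succ, Nat.cast_mul]
      ring

end MultiIndices

/-! ## Sums over multi-indices of bounded length -/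

section MultiIdxSums

variable {N p : ℕ}

theorem MultiIdx.exps_injective : Function.Injective (MultiIdx.exps : MultiIdx N p → _) := by
  intro m n h
  apply Subtype.ext
  funext μ
  exact Fin.ext (congrFun h μ)

theorem MultiIdx.len_le (m : MultiIdx N p) : m.len ≤ p := m.2

theorem MultiIdx.exists_exps {k : Fin N → ℕ} (h : ∑ μ, k μ ≤ p) :
    ∃ m : MultiIdx N p, m.exps = k := by
  have hk : ∀ μ, k μ < p + 1 := fun μ =>
    Nat.lt_succ_of_le ((Finset.single_le_sum (fun _ _ => Nat.zero_le _) (Finset.mem_univ μ)).trans h)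
  exact ⟨⟨fun μ => ⟨k μ, hk μ⟩, h⟩, rfl⟩

/-- Lets sums over bounded multi-indices be replaced by sums over the actual support, such as the
range of the Leibniz rule. -/
theorem MultiIdx.sum_exps {X : Type*} [AddCommMonoid X] (S : Finset (Fin N → ℕ))
    (g : (Fin N → ℕ) → X) (hS : ∀ k ∈ S, ∑ μ, k μ ≤ p)
    (hg : ∀ k, ∑ μ, k μ ≤ p → k ∉ S → g k = 0) :
    ∑ m : MultiIdx N p, g m.exps = ∑ k ∈ S, g k := by
  rw [← Finset.sum_image (s := Finset.univ) (g := MultiIdx.exps) (f := g)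
    MultiIdx.exps_injective.injOn]
  symm
  apply Finset.sum_subset
  · intro k hk
    obtain ⟨m, rfl⟩ := MultiIdx.exists_exps (hS k hk)
    exact Finset.mem_image_of_mem _ (Finset.mem_univ m)
  · intro k hk hk'
    obtain ⟨m, _, rfl⟩ := Finset.mem_image.mp hk
    exact hg _ m.len_le hk'

end MultiIdxSums

/-! ## First order matrix differential operators -/

section FirstOrder

variable {N : ℕ} {κ : Type*}

/-- The derivation `ξ^μ ∂_μ`. -/
def vecDeriv (ξ : VecField N) : Derivation ℂ (Poly N) (Poly N) :=
  ∑ μ, ξ μ • MvPolynomial.pderiv μ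

theorem vecDeriv_apply (ξ : VecField N) (P : Poly N) :
    vecDeriv ξ P = ∑ μ, ξ μ * MvPolynomial.pderiv μ P := by
  have key : ∀ S : Finset (Fin N), (∑ μ ∈ S, ξ μ • MvPolynomial.pderiv μ :
      Derivation ℂ (Poly N) (Poly N)) P = ∑ μ ∈ S, ξ μ * MvPolynomial.pderiv μ P := by
    intro S
    induction S using Finset.cons_induction with
    | empty => simp
    | cons a S ha ih => rw [Finset.sum_cons, Finset.sum_cons, Derivation.add_apply, ih]; rfl
  exact key _

theorem vecDeriv_X (ξ : VecField N) (μ : Fin N) : vecDeriv ξ (MvPolynomial.X μ) = ξ μ := by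
  rw [vecDeriv_apply, Finset.sum_eq_single μ]
  · simp
  · intro b _ hb; simp [MvPolynomial.pderiv_X, hb.symm]
  · simp

theorem vecBracket_apply (ξ η : VecField N) (μ : Fin N) :
    vecBracket ξ η μ = vecDeriv ξ (η μ) - vecDeriv η (ξ μ) := by
  rw [vecDeriv_apply, vecDeriv_apply, ← Finset.sum_sub_distrib]; rfl

/-- Both sides are derivations of the polynomial ring, so it suffices to compare them on
coordinates. -/
theorem vecDeriv_vecBracket (ξ η : VecField N) (P : Poly N) :
    vecDeriv (vecBracket ξ η) P = vecDeriv ξ (vecDeriv η P) - vecDeriv η (vecDeriv ξ P) := by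
  have h : vecDeriv (vecBracket ξ η) = ⁅vecDeriv ξ, vecDeriv η⁆ := by
    apply MvPolynomial.derivation_ext
    intro μ
    rw [Derivation.commutator_apply, vecDeriv_X, vecDeriv_X, vecDeriv_X, vecBracket_apply]
  rw [h, Derivation.commutator_apply]

theorem alongMat_apply (ξ : VecField N) (A : Matrix κ κ (Poly N)) (i j : κ) :
    alongMat ξ A i j = vecDeriv ξ (A i j) := (vecDeriv_apply ξ _).symm

variable [Fintype κ]

/-- The first order differential operator `ξ^μ ∂_μ + A` on vector-valued functions. -/
def firstOrder (ξ : VecField N) (A : Matrix κ κ (Poly N)) (u : κ → Poly N) : κ → Poly N := fun i =>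
  vecDeriv ξ (u i) + ∑ j, A i j * u j

theorem firstOrder_commutator (ξ η : VecField N) (A B : Matrix κ κ (Poly N)) (u : κ → Poly N) :
    firstOrder ξ A (firstOrder η B u) - firstOrder η B (firstOrder ξ A u) =
      firstOrder (vecBracket ξ η) (alongMat ξ B - alongMat η A + (A * B - B * A)) u := by
  funext i
  simp only [Pi.sub_apply, firstOrder, vecDeriv_vecBracket, map_add, map_sum, Derivation.leibniz,
    smul_eq_mul, Matrix.add_apply, Matrix.sub_apply, alongMat_apply, Matrix.mul_apply, mul_add,
    add_mul, sub_mul, Finset.sum_add_distrib, Finset.sum_sub_distrib]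
  have h : ∀ A B : Matrix κ κ (Poly N), ∑ x, (∑ j, A i j * B j x) * u x =
      ∑ x, A i x * ∑ j, B x j * u j := by
    intro A B
    simp only [Finset.sum_mul, Finset.mul_sum]
    rw [Finset.sum_comm]
    exact Finset.sum_congr rfl fun _ _ => Finset.sum_congr rfl fun _ _ => by ring
  rw [h A B, h B A]
  have c1 : ∑ x, u x * vecDeriv ξ (B i x) = ∑ x, vecDeriv ξ (B i x) * u x :=
    Finset.sum_congr rfl fun _ _ => mul_comm _ _
  have c2 : ∑ x, u x * vecDeriv η (A i x) = ∑ x, vecDeriv η (A i x) * u x :=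
    Finset.sum_congr rfl fun _ _ => mul_comm _ _
  rw [c1, c2]
  ring

end FirstOrder

end JetFock

end

noncomputable section

namespace JetFock

/-! ## Prolongation of first order operators to jets -/

section Prolongation

variable {N : ℕ} {V : Type*} (p : ℕ)

/-- The `p`-jet of a vector-valued function. -/
def jetVec (u : V → Poly N) : V × MultiIdx N p → Poly N := fun x => multiDeriv x.2.exps (u x.1)

theorem jetVec_sub (u v : V → Poly N) : jetVec p (u - v) = jetVec p u - jetVec p v :=
  funext fun _ => multiDeriv_sub _ _ _

variable [Fintype V] [DecidableEq V]

/-- The part of the prolongation of a vector field that acts on the multi-indices; the contribution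
of one component. -/
def jetShiftTerm (n : Fin N → ℕ) (μ : Fin N) (P : Poly N) (m : Fin N → ℕ) : Poly N :=
  if ∑ ν, m ν ≤ ∑ ν, n ν ∧ 1 ≤ m μ then
    MvPolynomial.C (multiChoose n (m - Pi.single μ 1) : ℂ) *
      multiDeriv (n - (m - Pi.single μ 1)) P
  else 0

/-- The part of the prolongation of a vector field that acts on the multi-indices. -/
def jetShift (ξ : VecField N) (n m : Fin N → ℕ) : Poly N := ∑ μ, jetShiftTerm n μ (ξ μ) m

/-- The matrix by which the operator `ξ^μ ∂_μ + A` acts on `p`-jets, apart from `ξ^μ ∂_μ`. -/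
def jetMat (ξ : VecField N) (A : Matrix V V (Poly N)) :
    Matrix (V × MultiIdx N p) (V × MultiIdx N p) (Poly N) := fun x y =>
  MvPolynomial.C (multiChoose x.2.exps y.2.exps : ℂ) *
      multiDeriv (x.2.exps - y.2.exps) (A x.1 y.1) +
    if x.1 = y.1 then jetShift ξ x.2.exps y.2.exps else 0

/-- Substituting m = k + e_μ identifies the shift matrix with the Leibniz terms k < n. The
derivative order |k| + 1 ≤ |n| ≤ p never leaves the p-jets, which is why first order operators
prolong. -/
theorem sum_jetShiftTerm (n : MultiIdx N p) (μ : Fin N) (P f : Poly N) :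
    ∑ m : MultiIdx N p, jetShiftTerm n.exps μ P m.exps * multiDeriv m.exps f =
      ∑ k ∈ (Finset.Iic n.exps).erase n.exps, MvPolynomial.C (multiChoose n.exps k : ℂ) *
        multiDeriv (n.exps - k) P * multiDeriv k (MvPolynomial.pderiv μ f) := by
  have hinj : Function.Injective (fun k : Fin N → ℕ => k + Pi.single μ 1) := add_left_injective _
  have hlt : ∀ k ∈ (Finset.Iic n.exps).erase n.exps, ∑ ν, k ν + 1 ≤ ∑ ν, n.exps ν := by
    intro k hk
    obtain ⟨h1, h2⟩ := Finset.mem_erase.mp hk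
    have h3 := lt_of_le_of_ne (Finset.mem_Iic.mp h2) h1
    obtain ⟨h4, ν, h5⟩ := Pi.lt_def.mp h3
    exact Finset.sum_lt_sum (fun i _ => h4 i) ⟨ν, Finset.mem_univ ν, h5⟩
  rw [MultiIdx.sum_exps (p := p) (((Finset.Iic n.exps).erase n.exps).image (· + Pi.single μ 1))
    (fun k => jetShiftTerm n.exps μ P k * multiDeriv k f), Finset.sum_image hinj.injOn]
  · refine Finset.sum_congr rfl fun k hk => ?_
    have h1 : 1 ≤ (k + Pi.single μ 1 : Fin N → ℕ) μ := by simp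
    rw [jetShiftTerm, if_pos ⟨(sum_add_single k μ).trans_le (hlt k hk), h1⟩,
      add_tsub_cancel_right, multiDeriv_succ']
  · intro k hk
    obtain ⟨j, hj, rfl⟩ := Finset.mem_image.mp hk
    exact ((sum_add_single j μ).trans_le (hlt j hj)).trans n.len_le
  · intro k _ hk
    rw [jetShiftTerm]
    split_ifs with h
    · have e : k - Pi.single μ 1 + Pi.single μ 1 = k :=
        tsub_add_cancel_of_le (single_le_iff.mpr h.2)
      have hs := sum_add_single (k - Pi.single μ 1) μ
      rw [e] at hs
      rw [multiChoose_eq_zero]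
      · simp
      · intro hle
        apply hk
        refine Finset.mem_image.mpr ⟨k - Pi.single μ 1, Finset.mem_erase.mpr
          ⟨fun h' => ?_, Finset.mem_Iic.mpr hle⟩, e⟩
        -- If m - e_μ = n, then |m| = |n| + 1, against the length guard.
        rw [h'] at hs
        have := h.1
        omega
    · simp

/-- The Leibniz term k = n differentiates f once more than n allows in general, but it is exactly
ξ^μ∂_μ applied to the jet coordinate; all other terms are linear in the jet. -/
theorem multiDeriv_vecDeriv (ξ : VecField N) (n : MultiIdx N p) (f : Poly N) :
    multiDeriv n.exps (vecDeriv ξ f) = vecDeriv ξ (multiDeriv n.exps f) +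
      ∑ m : MultiIdx N p, jetShift ξ n.exps m.exps * multiDeriv m.exps f := by
  simp only [jetShift, Finset.sum_mul]
  rw [Finset.sum_comm, Finset.sum_congr rfl fun μ _ => sum_jetShiftTerm p n μ (ξ μ) f,
    vecDeriv_apply, vecDeriv_apply, multiDeriv_sum, ← Finset.sum_add_distrib]
  refine Finset.sum_congr rfl fun μ _ => ?_
  rw [multiDeriv_mul, ← Finset.add_sum_erase _ _ (Finset.mem_Iic.mpr (le_refl n.exps)),
    multiChoose_self, tsub_self, multiDeriv_zero, ← multiDeriv_succ', multiDeriv_succ]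
  simp

theorem jetVec_firstOrder (ξ : VecField N) (A : Matrix V V (Poly N)) (u : V → Poly N) :
    jetVec p (firstOrder ξ A u) = firstOrder ξ (jetMat p ξ A) (jetVec p u) := by
  funext ⟨β, n⟩
  simp only [jetVec, firstOrder, multiDeriv_add, multiDeriv_sum, multiDeriv_vecDeriv, jetMat,
    Fintype.sum_prod_type, add_mul, Finset.sum_add_distrib]
  have h1 : ∑ α, ∑ m : MultiIdx N p, (if β = α then jetShift ξ n.exps m.exps else 0) *
      multiDeriv m.exps (u α) = ∑ m : MultiIdx N p, jetShift ξ n.exps m.exps *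
      multiDeriv m.exps (u β) := by
    rw [Finset.sum_eq_single β]
    · simp
    · intro α _ hα; simp [hα.symm]
    · simp
  have h2 : ∀ α, ∑ m : MultiIdx N p, MvPolynomial.C (multiChoose n.exps m.exps : ℂ) *
      multiDeriv (n.exps - m.exps) (A β α) * multiDeriv m.exps (u α) =
      multiDeriv n.exps (A β α * u α) := by
    intro α
    rw [multiDeriv_mul, MultiIdx.sum_exps (p := p) (Finset.Iic n.exps) (fun m =>
      MvPolynomial.C (multiChoose n.exps m : ℂ) * multiDeriv (n.exps - m) (A β α) *
        multiDeriv m (u α))]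
    · intro k hk
      exact (Finset.sum_le_sum fun i _ => Finset.mem_Iic.mp hk i).trans n.len_le
    · intro k _ hk
      rw [multiChoose_eq_zero (fun h => hk (Finset.mem_Iic.mpr h))]
      simp
  rw [h1, Finset.sum_congr rfl fun α _ => h2 α]
  ring

/-- Jets of polynomials separate matrices. -/
theorem eq_zero_of_mulVec_jetVec {κ : Type*} (R : Matrix κ (V × MultiIdx N p) (Poly N))
    (h : ∀ u, R.mulVec (jetVec p u) = 0) : R = 0 := by
  suffices key : ∀ (d : ℕ) (i : κ) (α : V) (m : MultiIdx N p), m.len = d → R i (α, m) = 0 from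
    Matrix.ext fun i x => key _ i x.1 x.2 rfl
  intro d
  induction d using Nat.strong_induction_on with
  | _ d ih =>
    intro i α m hm
    -- The test function is the monomial x^m in component α. Its jet vanishes at k unless k ≤ m;
    -- entries at k < m are zero by induction, and at k = m the jet is the nonzero constant m!.
    set M : Fin N →₀ ℕ := Finsupp.equivFunOnFinite.symm m.exps with hM
    have hMv : ∀ μ, M μ = m.exps μ := fun μ => rfl
    have h0 := congrFun (h (Pi.single α (MvPolynomial.monomial M 1))) i
    simp only [Matrix.mulVec, dotProduct, Pi.zero_apply] at h0
    rw [Finset.sum_eq_single (α, m)] at h0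
    · simp only [jetVec, Pi.single_eq_same, multiDeriv_monomial, one_mul] at h0
      have hz : M - Finsupp.equivFunOnFinite.symm m.exps = 0 := tsub_self _
      rw [hz] at h0
      refine (mul_eq_zero.mp h0).resolve_right ?_
      rw [MvPolynomial.monomial_zero', MvPolynomial.C_eq_zero]
      refine Finset.prod_ne_zero_iff.mpr fun μ _ => ?_
      rw [hMv, Nat.descFactorial_self]
      exact_mod_cast Nat.factorial_ne_zero _
    · rintro ⟨β, k⟩ _ hne
      simp only [jetVec]
      by_cases hβ : β = α
      · subst hβ
        have hk : k ≠ m := fun e => hne (by rw [e])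
        by_cases hle : k.exps ≤ m.exps
        · have hlt : k.len < m.len := by
            have h3 := lt_of_le_of_ne hle fun e => hk (MultiIdx.exps_injective e)
            obtain ⟨h4, ν, h5⟩ := Pi.lt_def.mp h3
            exact Finset.sum_lt_sum (fun i _ => h4 i) ⟨ν, Finset.mem_univ ν, h5⟩
          rw [ih _ (hm ▸ hlt) i β k rfl, zero_mul]
        · obtain ⟨μ, hμ⟩ := not_forall.mp hle
          rw [Pi.single_eq_same, multiDeriv_monomial, Finset.prod_eq_zero (Finset.mem_univ μ)]
          · simp
          · rw [hMv, Nat.descFactorial_eq_zero_iff_lt.mpr (not_le.mp hμ), Nat.cast_zero]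
      · rw [Pi.single_eq_of_ne hβ, multiDeriv_apply_zero, mul_zero]
    · simp

/-- Prolongation to jets is compatible with commutators. -/
theorem jetMat_commutator (ξ η : VecField N) (A B : Matrix V V (Poly N)) :
    jetMat p (vecBracket ξ η) (alongMat ξ B - alongMat η A + (A * B - B * A)) =
      alongMat ξ (jetMat p η B) - alongMat η (jetMat p ξ A) +
        (jetMat p ξ A * jetMat p η B - jetMat p η B * jetMat p ξ A) := by
  rw [← sub_eq_zero]
  -- Both matrices describe the action of the same commutator on jets of actual functions, computed
  -- before and after prolongation. Jets separate matrices, so the matrices agree.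
  apply eq_zero_of_mulVec_jetVec p
  intro u
  have e1 := congrArg (jetVec p) (firstOrder_commutator ξ η A B u)
  rw [jetVec_sub, jetVec_firstOrder, jetVec_firstOrder, jetVec_firstOrder, jetVec_firstOrder,
    jetVec_firstOrder, firstOrder_commutator] at e1
  rw [Matrix.sub_mulVec, sub_eq_zero]
  funext i
  have e2 := congrFun e1 i
  exact (add_left_cancel e2).symm

end Prolongation

end JetFock

end

noncomputable section

namespace JetFock

/-! ## Counting multi-indices -/

section Counting

/-- The upper-index Vandermonde identity: choose a + b + 1 elements out of M + 1 and sort by the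
position j of the one with a elements before it. -/
theorem sum_choose_mul_choose (M a b : ℕ) :
    ∑ j ∈ Finset.range (M + 1), j.choose a * (M - j).choose b = (M + 1).choose (a + b + 1) := by
  induction M generalizing b with
  | zero =>
    rcases a with _ | a <;> rcases b with _ | b <;> simp [Nat.choose]
  | succ M ih =>
    rw [Finset.sum_range_succ]
    rcases b with _ | b
    · have := ih 0
      simp only [Nat.choose_zero_right, mul_one, add_zero] at this ⊢
      rw [this, add_comm, ← Nat.choose_succ_succ]
    · have h : ∀ j ∈ Finset.range (M + 1), j.choose a * (M + 1 - j).choose (b + 1) =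
          j.choose a * (M - j).choose b + j.choose a * (M - j).choose (b + 1) := by
        intro j hj
        have hj' : M + 1 - j = (M - j) + 1 := by
          have := Finset.mem_range.mp hj
          omega
        rw [hj', Nat.choose_succ_succ, mul_add]
      rw [Finset.sum_congr rfl h, Finset.sum_add_distrib, ih, ih, Nat.sub_self,
        Nat.choose_zero_succ, mul_zero, add_zero, ← add_assoc a b 1, ← Nat.choose_succ_succ]

/-- Induction on N, splitting off one entry j and applying Vandermonde. The separate bound B keeps
the index type fixed while p drops to p - j. -/
theorem sum_prod_choose (N p B : ℕ) (hB : p ≤ B) (a : Fin N → ℕ) :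
    ∑ n : Fin N → Fin (B + 1), (if ∑ μ, (n μ : ℕ) ≤ p then ∏ μ, (n μ : ℕ).choose (a μ) else 0) =
      (N + p).choose (N + ∑ μ, a μ) := by
  induction N generalizing p with
  | zero => simp
  | succ N ih =>
    rw [← (Fin.consEquiv fun _ : Fin (N + 1) => Fin (B + 1)).sum_comp, Fintype.sum_prod_type]
    have h : ∀ j : Fin (B + 1), ∑ n : Fin N → Fin (B + 1),
        (if ∑ μ, ((Fin.consEquiv (fun _ : Fin (N + 1) => Fin (B + 1)) (j, n)) μ : ℕ) ≤ p then
          ∏ μ, ((Fin.consEquiv (fun _ : Fin (N + 1) => Fin (B + 1)) (j, n)) μ : ℕ).choose (a μ)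
          else 0) =
        if (j : ℕ) < p + 1 then
          (j : ℕ).choose (a 0) * (N + p - j).choose (N + ∑ μ : Fin N, a μ.succ) else 0 := by
      intro j
      simp only [Fin.consEquiv_apply, Fin.sum_univ_succ, Fin.prod_univ_succ, Fin.cons_zero,
        Fin.cons_succ]
      split_ifs with hj
      · have e : N + p - (j : ℕ) = N + (p - j) := by omega
        rw [e, ← ih (p - j) (by omega), Finset.mul_sum]
        refine Finset.sum_congr rfl fun n _ => ?_
        have hiff : (j : ℕ) + ∑ μ, (n μ : ℕ) ≤ p ↔ ∑ μ, (n μ : ℕ) ≤ p - j := by omega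
        simp only [hiff, mul_ite, mul_zero]
      · refine Finset.sum_eq_zero fun n _ => if_neg ?_
        omega
    rw [Finset.sum_congr rfl fun j _ => h j, Fin.sum_univ_eq_sum_range (fun j =>
      if j < p + 1 then j.choose (a 0) * (N + p - j).choose (N + ∑ μ : Fin N, a μ.succ) else 0)
      (B + 1), ← Finset.sum_filter]
    have hf : (Finset.range (B + 1)).filter (· < p + 1) = Finset.range (p + 1) := by
      ext j; simp; omega
    rw [hf, Finset.sum_subset (Finset.range_subset_range.mpr (by omega : p + 1 ≤ N + p + 1)),
      sum_choose_mul_choose, Fin.sum_univ_succ]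
    · congr 1 <;> ring
    · intro j _ hj
      have hj' : ¬ j < p + 1 := fun h => hj (Finset.mem_range.mpr h)
      -- For p < j ≤ N + p the upper entry is below N, so lengthening the range to that of
      -- Vandermonde adds only zeros.
      rw [Nat.choose_eq_zero_of_lt (n := N + p - j) (by
        have h1 := Finset.mem_range.mp ‹_›
        have : N + p - j < N := by omega
        omega), mul_zero]

/-! ### Moments of multi-indices. -/

variable {N p : ℕ}

theorem MultiIdx.sum_multiChoose (a : Fin N → ℕ) :
    ∑ n : MultiIdx N p, multiChoose n.exps a = (N + p).choose (N + ∑ μ, a μ) := by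
  rw [← sum_prod_choose N p p le_rfl a, ← Finset.sum_filter]
  exact (Finset.sum_subtype (p := fun n : Fin N → Fin (p + 1) => ∑ μ, (n μ : ℕ) ≤ p)
    (Finset.univ.filter fun n : Fin N → Fin (p + 1) => ∑ μ, (n μ : ℕ) ≤ p) (by simp)
    (fun n => ∏ μ, (n μ : ℕ).choose (a μ))).symm

theorem MultiIdx.card : Fintype.card (MultiIdx N p) = (N + p).choose p := by
  have h := MultiIdx.sum_multiChoose (N := N) (p := p) 0
  simp only [multiChoose, Pi.zero_apply, Nat.choose_zero_right, Finset.prod_const_one,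
    Finset.sum_const, Finset.card_univ, smul_eq_mul, mul_one, mul_zero, add_zero] at h
  rw [h, Nat.choose_symm_add]

theorem multiChoose_single (n : Fin N → ℕ) (μ : Fin N) : multiChoose n (Pi.single μ 1) = n μ := by
  rw [multiChoose, Finset.prod_eq_single μ]
  · simp
  · intro ν _ hν; simp [hν]
  · simp

theorem MultiIdx.sum_exps_apply (μ : Fin N) :
    ∑ n : MultiIdx N p, n.exps μ = (N + p).choose (N + 1) := by
  have h := MultiIdx.sum_multiChoose (N := N) (p := p) (Pi.single μ 1)
  rw [Finset.sum_pi_single'] at h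
  simpa [multiChoose_single] using h

theorem MultiIdx.sum_exps_mul_of_ne {μ ν : Fin N} (hμν : μ ≠ ν) :
    ∑ n : MultiIdx N p, n.exps μ * n.exps ν = (N + p).choose (N + 2) := by
  have h := MultiIdx.sum_multiChoose (N := N) (p := p) (Pi.single μ 1 + Pi.single ν 1)
  rw [sum_add_single, Finset.sum_pi_single'] at h
  simp only [Finset.mem_univ, if_true] at h
  rw [← h]
  refine Finset.sum_congr rfl fun n _ => ?_
  rw [multiChoose, ← Finset.mul_prod_erase _ _ (Finset.mem_univ μ),
    ← Finset.mul_prod_erase _ _ (Finset.mem_erase.mpr ⟨hμν.symm, Finset.mem_univ ν⟩),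
    Finset.prod_eq_one]
  · simp [hμν, hμν.symm]
  · intro σ hσ
    simp only [Finset.mem_erase] at hσ
    simp [hσ.1, hσ.2.1]

/-- From n² = 2 binom(n, 2) + n. The two resulting binomial coefficients with lower entries N + 2
and N + 1 merge by Pascal's rule. -/
theorem MultiIdx.sum_exps_mul_self (μ : Fin N) :
    ∑ n : MultiIdx N p, n.exps μ * n.exps μ =
      (N + p).choose (N + 2) + (N + p + 1).choose (N + 2) := by
  have h := MultiIdx.sum_multiChoose (N := N) (p := p) (Pi.single μ 2)
  rw [Finset.sum_pi_single'] at h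
  simp only [Finset.mem_univ, if_true] at h
  have h2 : ∀ n : MultiIdx N p, n.exps μ * n.exps μ =
      2 * multiChoose n.exps (Pi.single μ 2) + n.exps μ := by
    intro n
    have : multiChoose n.exps (Pi.single μ 2) = (n.exps μ).choose 2 := by
      rw [multiChoose, Finset.prod_eq_single μ]
      · simp
      · intro ν _ hν; simp [hν]
      · simp
    rw [this, Nat.choose_two_right]
    rw [Nat.mul_div_cancel' (Nat.even_mul_pred_self (n.exps μ)).two_dvd]
    rcases n.exps μ with _ | j
    · simp
    · rw [Nat.add_sub_cancel]
      ring
  rw [Finset.sum_congr rfl fun n _ => h2 n, Finset.sum_add_distrib, ← Finset.mul_sum, h,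
    MultiIdx.sum_exps_apply, Nat.choose_succ_succ (N + p) (N + 1)]
  ring

/-- The coefficient of `∂_ν ξ^μ` in the prolongation of a vector field, for multi-indices of equal
length. -/
def shiftCoeff (n m : Fin N → ℕ) (μ ν : Fin N) : ℕ :=
  if n + Pi.single μ 1 = m + Pi.single ν 1 then n ν else 0

theorem shiftCoeff_self (n : Fin N → ℕ) (μ ν : Fin N) :
    shiftCoeff n n μ ν = if μ = ν then n μ else 0 := by
  unfold shiftCoeff
  by_cases h : μ = ν
  · subst h; simp
  · rw [if_neg h, if_neg]
    intro e
    have := congrFun (add_left_cancel e) μ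
    simp [h] at this

theorem sum_shiftCoeff_self (μ ν : Fin N) :
    ∑ n : MultiIdx N p, shiftCoeff n.exps n.exps μ ν =
      if μ = ν then (N + p).choose (N + 1) else 0 := by
  simp only [shiftCoeff_self]
  split_ifs with h
  · exact MultiIdx.sum_exps_apply μ
  · simp

/-- A nonzero product forces e_μ + e_σ = e_ν + e_τ, so the two pairs of indices agree as multisets.
These are the two index structures of c₁ and c₂. -/
theorem sum_shiftCoeff_mul (μ ν σ τ : Fin N) :
    ∑ n : MultiIdx N p, ∑ m : MultiIdx N p,
      shiftCoeff m.exps n.exps μ ν * shiftCoeff n.exps m.exps σ τ =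
      (if μ = ν ∧ σ = τ then (N + p).choose (N + 2) else 0) +
        if μ = τ ∧ σ = ν then (N + p + 1).choose (N + 2) else 0 := by
  by_cases hμν : μ = ν
  · subst hμν
    have h1 : ∀ n : MultiIdx N p, ∑ m : MultiIdx N p,
        shiftCoeff m.exps n.exps μ μ * shiftCoeff n.exps m.exps σ τ =
        if σ = τ then n.exps μ * n.exps σ else 0 := by
      intro n
      rw [Finset.sum_eq_single n]
      · simp [shiftCoeff_self]
      · intro m _ hm
        rw [shiftCoeff, if_neg, zero_mul]
        exact fun e => hm (MultiIdx.exps_injective (add_right_cancel e))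
      · simp
    rw [Finset.sum_congr rfl fun n _ => h1 n]
    by_cases hστ : σ = τ
    · subst hστ
      simp only [if_true, and_self]
      by_cases h : μ = σ
      · subst h
        rw [MultiIdx.sum_exps_mul_self]; simp
      · rw [MultiIdx.sum_exps_mul_of_ne h]; simp [h]
    · have : ¬ (μ = τ ∧ σ = μ) := fun h => hστ (h.2.trans h.1)
      simp [hστ, this]
  · by_cases h : μ = τ ∧ σ = ν
    · obtain ⟨rfl, rfl⟩ := h
      have h1 : ∀ n : MultiIdx N p, ∑ m : MultiIdx N p,
          shiftCoeff m.exps n.exps μ σ * shiftCoeff n.exps m.exps σ μ =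
          n.exps σ * n.exps μ + n.exps μ := by
        intro n
        have hzero : ∀ m : MultiIdx N p, m.exps + Pi.single μ 1 ≠ n.exps + Pi.single σ 1 →
            shiftCoeff m.exps n.exps μ σ * shiftCoeff n.exps m.exps σ μ = 0 := by
          intro m hm
          rw [shiftCoeff, if_neg hm, zero_mul]
        by_cases hn : 1 ≤ n.exps μ
        · have hk : n.exps - Pi.single μ 1 + Pi.single μ 1 = n.exps :=
            tsub_add_cancel_of_le (single_le_iff.mpr hn)
          have hlen : ∑ ν, (n.exps - Pi.single μ 1 + Pi.single σ 1 : Fin N → ℕ) ν ≤ p := by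
            have := sum_add_single (n.exps - Pi.single μ 1) μ
            rw [hk] at this
            rw [sum_add_single, ← this]
            exact n.len_le
          obtain ⟨m, hm⟩ := MultiIdx.exists_exps hlen
          -- The only partner of n is m = n - e_μ + e_σ. It contributes (n_σ + 1) n_μ, and the extra
          -- n_μ is what raises the binomial to N + p + 1.
          have hrel : m.exps + Pi.single μ 1 = n.exps + Pi.single σ 1 := by
            rw [hm, add_right_comm, hk]
          rw [Finset.sum_eq_single m]
          · rw [shiftCoeff, if_pos hrel, shiftCoeff, if_pos hrel.symm]
            have : m.exps σ = n.exps σ + 1 := by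
              have := congrFun hrel σ
              simpa [hμν, Ne.symm hμν] using this
            rw [this]
            ring
          · intro m' _ hm'
            exact hzero m' fun e => hm' (MultiIdx.exps_injective
              (add_right_cancel (e.trans hrel.symm)))
          · simp
        · have h0 : n.exps μ = 0 := by omega
          rw [h0, mul_zero, add_zero]
          refine Finset.sum_eq_zero fun m _ => ?_
          rw [shiftCoeff, shiftCoeff, h0]
          simp
      rw [Finset.sum_congr rfl fun n _ => h1 n, Finset.sum_add_distrib,
        MultiIdx.sum_exps_mul_of_ne (Ne.symm hμν), MultiIdx.sum_exps_apply,
        Nat.choose_succ_succ (N + p) (N + 1)]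
      simp [hμν]
      exact add_comm _ _
    · have : ¬ (μ = ν ∧ σ = τ) := fun h => hμν h.1
      rw [if_neg h, if_neg this, add_zero]
      refine Finset.sum_eq_zero fun n _ => Finset.sum_eq_zero fun m _ => ?_
      unfold shiftCoeff
      split_ifs with h1 h2
      · exfalso
        have e : (Pi.single μ 1 + Pi.single σ 1 : Fin N → ℕ) = Pi.single ν 1 + Pi.single τ 1 := by
          have e1 : m.exps + (n.exps + (Pi.single μ 1 + Pi.single σ 1)) =
              m.exps + (n.exps + (Pi.single ν 1 + Pi.single τ 1)) := by
            calc _ = (m.exps + Pi.single μ 1) + (n.exps + Pi.single σ 1) := by abel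
              _ = (n.exps + Pi.single ν 1) + (m.exps + Pi.single τ 1) := by rw [h1, h2]
              _ = _ := by abel
          exact add_left_cancel (add_left_cancel e1)
        have eμ := congrFun e μ
        have eν := congrFun e ν
        simp only [Pi.add_apply, Pi.single_apply] at eμ eν
        apply h
        constructor
        · by_contra hc
          simp [hμν, hc] at eμ
        · by_contra hc
          simp [Ne.symm hμν, Ne.symm hc] at eν
          omega
      all_goals simp

end Counting

end JetFock

end

noncomputable section

namespace JetFock

/-! ## Traces of prolongations -/

section Traces

variable {N : ℕ} {V : Type*} [DecidableEq V] (p : ℕ)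

/-- The part of `jetMat` that preserves the length of multi-indices. -/
def jetMatDiag (ξ : VecField N) (A : Matrix V V (Poly N)) :
    Matrix (V × MultiIdx N p) (V × MultiIdx N p) (Poly N) := fun x y =>
  (if x.2 = y.2 then A x.1 y.1 else 0) +
    if x.1 = y.1 then ∑ μ, ∑ ν, (shiftCoeff x.2.exps y.2.exps μ ν : ℂ) •
      MvPolynomial.pderiv ν (ξ μ) else 0

theorem multiChoose_of_len_eq {n m : MultiIdx N p} (h : n.len = m.len) :
    multiChoose n.exps m.exps = if n = m then 1 else 0 := by
  split_ifs with e
  · rw [e, multiChoose_self]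
  · apply multiChoose_eq_zero
    intro hle
    have h3 := lt_of_le_of_ne hle fun e' => e (MultiIdx.exps_injective e').symm
    obtain ⟨h4, ν, h5⟩ := Pi.lt_def.mp h3
    have := Finset.sum_lt_sum (fun i _ => h4 i) ⟨ν, Finset.mem_univ ν, h5⟩
    exact absurd h (ne_of_gt this)

theorem multiChoose_sub_single (n : Fin N → ℕ) (ν : Fin N) (hν : 1 ≤ n ν) :
    multiChoose n (n - Pi.single ν 1) = n ν := by
  rw [multiChoose, Finset.prod_eq_single ν]
  · simp only [Pi.sub_apply, Pi.single_eq_same]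
    obtain ⟨k, hk⟩ := Nat.exists_eq_add_of_le' hν
    rw [hk, Nat.add_sub_cancel, Nat.choose_succ_self_right]
  · intro μ _ hμ; simp [hμ]
  · simp

/-- A nonzero binomial needs m - e_μ ≤ n. As its length is one less than that of n, m - e_μ = n -
e_ν for some ν, so the binomial is n_ν and a single derivative ∂_ν falls on the vector field. -/
theorem jetShiftTerm_of_len_eq {n m : Fin N → ℕ} (h : ∑ ν, n ν = ∑ ν, m ν) (μ : Fin N)
    (P : Poly N) :
    jetShiftTerm n μ P m = ∑ ν, (shiftCoeff n m μ ν : ℂ) • MvPolynomial.pderiv ν P := by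
  by_cases hex : ∃ ν, n + Pi.single μ 1 = m + Pi.single ν 1 ∧ 1 ≤ n ν
  · obtain ⟨ν, hν, h1⟩ := hex
    have hn : n - Pi.single ν 1 + Pi.single ν 1 = n :=
      tsub_add_cancel_of_le (single_le_iff.mpr h1)
    have hm : m = n - Pi.single ν 1 + Pi.single μ 1 := by
      apply add_right_cancel (b := Pi.single ν 1)
      rw [← hν, add_right_comm, hn]
    have hmμ : 1 ≤ m μ := by rw [hm]; simp
    have hsub : m - Pi.single μ 1 = n - Pi.single ν 1 := by rw [hm, add_tsub_cancel_right]
    have hd : n - (n - Pi.single ν 1) = Pi.single ν 1 :=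
      tsub_tsub_cancel_of_le (single_le_iff.mpr h1)
    rw [jetShiftTerm, if_pos ⟨h.ge, hmμ⟩, hsub, hd, multiDeriv_single, multiChoose_sub_single n ν h1,
      Finset.sum_eq_single ν]
    · rw [shiftCoeff, if_pos hν, MvPolynomial.C_mul']
    · intro σ _ hσ
      rw [shiftCoeff, if_neg]
      · simp
      · intro e
        apply hσ
        have e2 := add_left_cancel (hν.symm.trans e)
        by_contra hne
        have := congrFun e2 σ
        simp [hne] at this
    · simp
  · have hz : ∀ ν, shiftCoeff n m μ ν = 0 := by
      intro ν
      rw [shiftCoeff]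
      split_ifs with e
      · by_contra h0
        exact hex ⟨ν, e, Nat.one_le_iff_ne_zero.mpr h0⟩
      · rfl
    simp only [hz, Nat.cast_zero, zero_smul, Finset.sum_const_zero]
    rw [jetShiftTerm]
    split_ifs with h1
    · rw [multiChoose_eq_zero]
      · simp
      · intro hle
        apply hex
        have hm : m - Pi.single μ 1 + Pi.single μ 1 = m :=
          tsub_add_cancel_of_le (single_le_iff.mpr h1.2)
        have hne : ∃ ν, (m - Pi.single μ 1 : Fin N → ℕ) ν < n ν := by
          by_contra! hall
          have e : m - Pi.single μ 1 = n := le_antisymm hle hall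
          have := sum_add_single (m - Pi.single μ 1) μ
          rw [hm, e] at this
          omega
        obtain ⟨ν, hν⟩ := hne
        have hle' : m - Pi.single μ 1 + Pi.single ν 1 ≤ n := by
          intro σ
          by_cases hσ : σ = ν
          · subst hσ; simpa using hν
          · simpa [hσ] using hle σ
        have hsum : ∑ σ, (m - Pi.single μ 1 + Pi.single ν 1 : Fin N → ℕ) σ = ∑ σ, n σ := by
          rw [sum_add_single, h, ← sum_add_single (m - Pi.single μ 1) μ, hm]
        have heq : m - Pi.single μ 1 + Pi.single ν 1 = n := by
          funext σ
          exact (Finset.sum_eq_sum_iff_of_le fun i _ => hle' i).mp hsum σ (Finset.mem_univ σ)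
        refine ⟨ν, ?_, by rw [← heq]; simp⟩
        rw [← heq, add_right_comm, hm]
    · rfl

theorem jetMat_of_len_eq (ξ : VecField N) (A : Matrix V V (Poly N)) {x y : V × MultiIdx N p}
    (h : x.2.len = y.2.len) : jetMat p ξ A x y = jetMatDiag p ξ A x y := by
  unfold jetMat jetMatDiag jetShift
  rw [multiChoose_of_len_eq p h, Finset.sum_congr rfl fun μ _ => jetShiftTerm_of_len_eq h μ (ξ μ)]
  congr 1
  split_ifs with e
  · rw [e, tsub_self, multiDeriv_zero]; simp
  · simp

/-- Derivatives of order |n| never involve jet coordinates of higher order, so the matrix is block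
triangular for the length. -/
theorem jetMat_of_len_lt (ξ : VecField N) (A : Matrix V V (Poly N)) {x y : V × MultiIdx N p}
    (h : x.2.len < y.2.len) : jetMat p ξ A x y = 0 := by
  have h1 : multiChoose x.2.exps y.2.exps = 0 := by
    apply multiChoose_eq_zero
    intro hle
    exact absurd (Finset.sum_le_sum fun i _ => hle i) (not_le.mpr h)
  have h2 : jetShift ξ x.2.exps y.2.exps = 0 :=
    Finset.sum_eq_zero fun μ _ => if_neg fun hc => absurd hc.1 (not_le.mpr h)
  simp [jetMat, h1, h2]

theorem jetMatDiag_of_len_ne (ξ : VecField N) (A : Matrix V V (Poly N)) {x y : V × MultiIdx N p}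
    (h : x.2.len ≠ y.2.len) : jetMatDiag p ξ A x y = 0 := by
  have h1 : x.2 ≠ y.2 := fun e => h (by rw [e])
  have h2 : ∀ μ ν, shiftCoeff x.2.exps y.2.exps μ ν = 0 := by
    intro μ ν
    rw [shiftCoeff, if_neg]
    intro e
    apply h
    have := congrArg (fun l : Fin N → ℕ => ∑ σ, l σ) e
    simp only [sum_add_single] at this
    exact Nat.add_right_cancel this
  simp [jetMatDiag, h1, h2]

theorem sum_shiftCoeff_pderiv (ξ : VecField N) :
    ∑ n : MultiIdx N p, ∑ μ, ∑ ν, (shiftCoeff n.exps n.exps μ ν : ℂ) •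
      MvPolynomial.pderiv ν (ξ μ) = ((N + p).choose (N + 1) : ℂ) • divergence ξ := by
  rw [Finset.sum_comm, divergence, Finset.smul_sum]
  refine Finset.sum_congr rfl fun μ _ => ?_
  rw [Finset.sum_comm, Finset.sum_eq_single μ]
  · rw [← Finset.sum_smul, ← Nat.cast_sum, sum_shiftCoeff_self, if_pos rfl]
  · intro ν _ hν
    rw [← Finset.sum_smul, ← Nat.cast_sum, sum_shiftCoeff_self, if_neg hν.symm, Nat.cast_zero,
      zero_smul]
  · simp

/-! ### Traces of products, for an arbitrary bilinear pairing of the entries. -/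

variable {S : Type*} [AddCommGroup S] [Module ℂ S] (B : Poly N →ₗ[ℂ] Poly N →ₗ[ℂ] S)

/-- If the lengths differ, one of the two transposed entries vanishes by triangularity, so products
under the trace see only the length-preserving blocks. -/
theorem jetMat_apply_mul (ξ η : VecField N) (A A' : Matrix V V (Poly N))
    (x y : V × MultiIdx N p) :
    B (jetMat p ξ A y x) (jetMat p η A' x y) =
      B (jetMatDiag p ξ A y x) (jetMatDiag p η A' x y) := by
  rcases lt_trichotomy x.2.len y.2.len with h | h | h
  · rw [jetMat_of_len_lt p η A' h, jetMatDiag_of_len_ne p η A' h.ne, map_zero, map_zero]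
  · rw [jetMat_of_len_eq p η A' h, jetMat_of_len_eq p ξ A h.symm]
  · rw [jetMat_of_len_lt p ξ A h, jetMatDiag_of_len_ne p ξ A h.ne, map_zero,
      LinearMap.zero_apply, LinearMap.zero_apply]

theorem sum_shiftCoeff_pderiv_mul (ξ η : VecField N) :
    ∑ n : MultiIdx N p, ∑ m : MultiIdx N p,
      B (∑ μ, ∑ ν, (shiftCoeff m.exps n.exps μ ν : ℂ) • MvPolynomial.pderiv ν (ξ μ))
        (∑ σ, ∑ τ, (shiftCoeff n.exps m.exps σ τ : ℂ) • MvPolynomial.pderiv τ (η σ)) =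
    ((N + p + 1).choose (N + 2) : ℂ) •
        ∑ μ, ∑ ν, B (MvPolynomial.pderiv ν (ξ μ)) (MvPolynomial.pderiv μ (η ν)) +
      ((N + p).choose (N + 2) : ℂ) • B (divergence ξ) (divergence η) := by
  have h1 : ∀ n m : MultiIdx N p,
      B (∑ μ, ∑ ν, (shiftCoeff m.exps n.exps μ ν : ℂ) • MvPolynomial.pderiv ν (ξ μ))
        (∑ σ, ∑ τ, (shiftCoeff n.exps m.exps σ τ : ℂ) • MvPolynomial.pderiv τ (η σ)) =
      ∑ σ, ∑ τ, ∑ μ, ∑ ν,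
        ((shiftCoeff m.exps n.exps μ ν * shiftCoeff n.exps m.exps σ τ : ℕ) : ℂ) •
          B (MvPolynomial.pderiv ν (ξ μ)) (MvPolynomial.pderiv τ (η σ)) := by
    intro n m
    simp only [map_sum, map_smul, LinearMap.sum_apply, LinearMap.smul_apply, Finset.smul_sum,
      smul_smul, Nat.cast_mul, mul_comm]
  have sw : ∀ G : MultiIdx N p → MultiIdx N p → Fin N → S,
      ∑ n, ∑ m, ∑ σ, G n m σ = ∑ σ, ∑ n, ∑ m, G n m σ := by
    intro G
    rw [Finset.sum_congr rfl fun n _ => Finset.sum_comm, Finset.sum_comm]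
  have h2 : ∀ σ τ μ ν : Fin N, ∑ n : MultiIdx N p, ∑ m : MultiIdx N p,
      ((shiftCoeff m.exps n.exps μ ν * shiftCoeff n.exps m.exps σ τ : ℕ) : ℂ) •
        B (MvPolynomial.pderiv ν (ξ μ)) (MvPolynomial.pderiv τ (η σ)) =
      (if μ = ν then if σ = τ then ((N + p).choose (N + 2) : ℂ) •
        B (MvPolynomial.pderiv ν (ξ μ)) (MvPolynomial.pderiv τ (η σ)) else 0 else 0) +
      (if σ = ν then if μ = τ then ((N + p + 1).choose (N + 2) : ℂ) •
        B (MvPolynomial.pderiv ν (ξ μ)) (MvPolynomial.pderiv τ (η σ)) else 0 else 0) := by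
    intro σ τ μ ν
    simp only [← Finset.sum_smul, ← Nat.cast_sum, sum_shiftCoeff_mul]
    rw [Nat.cast_add, add_smul, ite_and, ite_and]
    congr 1 <;> split_ifs <;> simp
  have h3 : ∑ n : MultiIdx N p, ∑ m : MultiIdx N p, ∑ σ, ∑ τ, ∑ μ, ∑ ν,
        ((shiftCoeff m.exps n.exps μ ν * shiftCoeff n.exps m.exps σ τ : ℕ) : ℂ) •
          B (MvPolynomial.pderiv ν (ξ μ)) (MvPolynomial.pderiv τ (η σ)) =
      ∑ σ, ∑ τ, ∑ μ, ∑ ν, ((if μ = ν then if σ = τ then ((N + p).choose (N + 2) : ℂ) •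
        B (MvPolynomial.pderiv ν (ξ μ)) (MvPolynomial.pderiv τ (η σ)) else 0 else 0) +
      (if σ = ν then if μ = τ then ((N + p + 1).choose (N + 2) : ℂ) •
        B (MvPolynomial.pderiv ν (ξ μ)) (MvPolynomial.pderiv τ (η σ)) else 0 else 0)) := by
    rw [sw]
    refine Finset.sum_congr rfl fun σ _ => ?_
    rw [sw]
    refine Finset.sum_congr rfl fun τ _ => ?_
    rw [sw]
    refine Finset.sum_congr rfl fun μ _ => ?_
    rw [sw]
    exact Finset.sum_congr rfl fun ν _ => h2 σ τ μ ν
  rw [Finset.sum_congr rfl fun n _ => Finset.sum_congr rfl fun m _ => h1 n m, h3]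
  simp only [Finset.sum_add_distrib, Finset.sum_ite_eq, Finset.mem_univ, if_true,
    Finset.sum_ite_eq']
  rw [add_comm]
  congr 1
  · rw [Finset.sum_comm]
    simp only [Finset.smul_sum]
  · simp only [divergence, map_sum, LinearMap.sum_apply, Finset.smul_sum]
    refine Finset.sum_congr rfl fun σ _ => ?_
    rw [Finset.sum_comm]
    simp

variable [Fintype V]

theorem jetMat_trace (ξ : VecField N) (A : Matrix V V (Poly N)) :
    (jetMat p ξ A).trace = ((N + p).choose p : ℂ) • A.trace +
      ((N + p).choose (N + 1) * Fintype.card V : ℂ) • divergence ξ := by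
  have h : ∀ x : V × MultiIdx N p, (jetMat p ξ A) x x = A x.1 x.1 + ∑ μ, ∑ ν,
      (shiftCoeff x.2.exps x.2.exps μ ν : ℂ) • MvPolynomial.pderiv ν (ξ μ) := by
    intro x
    rw [jetMat_of_len_eq p ξ A rfl]
    simp [jetMatDiag]
  simp only [Matrix.trace, Matrix.diag, h, Fintype.sum_prod_type, Finset.sum_add_distrib,
    sum_shiftCoeff_pderiv, Finset.sum_const, Finset.card_univ, MultiIdx.card]
  rw [← Finset.smul_sum, mul_comm, mul_smul, ← Nat.cast_smul_eq_nsmul ℂ,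
    ← Nat.cast_smul_eq_nsmul ℂ]

/-- The trace of a product of prolongations, with values under a bilinear map. -/
theorem jetMat_trace_mul (ξ η : VecField N) (A A' : Matrix V V (Poly N)) :
    ∑ x, ∑ y, B (jetMat p ξ A y x) (jetMat p η A' x y) =
      ((N + p).choose p : ℂ) • ∑ β, ∑ α, B (A α β) (A' β α) +
      ((N + p).choose (N + 1) : ℂ) • (B A.trace (divergence η) + B (divergence ξ) A'.trace) +
      (Fintype.card V : ℂ) • (((N + p + 1).choose (N + 2) : ℂ) •
          ∑ μ, ∑ ν, B (MvPolynomial.pderiv ν (ξ μ)) (MvPolynomial.pderiv μ (η ν)) +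
        ((N + p).choose (N + 2) : ℂ) • B (divergence ξ) (divergence η)) := by
  simp only [jetMat_apply_mul, jetMatDiag, map_add, LinearMap.add_apply, Fintype.sum_prod_type,
    Finset.sum_add_distrib]
  -- P denotes the part A ⊗ 1, Q the part 1 ⊗ shift. Mixed products factor into the trace of A and
  -- the trace of the shift; the square of the shift carries the second moments.
  have hPP : ∑ β, ∑ n : MultiIdx N p, ∑ α, ∑ m : MultiIdx N p,
      B (if m = n then A α β else 0) (if n = m then A' β α else 0) =
      ((N + p).choose p : ℂ) • ∑ β, ∑ α, B (A α β) (A' β α) := by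
    rw [Finset.smul_sum]
    refine Finset.sum_congr rfl fun β _ => ?_
    have : ∀ (n : MultiIdx N p) (α : V), ∑ m : MultiIdx N p,
        B (if m = n then A α β else 0) (if n = m then A' β α else 0) = B (A α β) (A' β α) := by
      intro n α
      rw [Finset.sum_eq_single n]
      · simp
      · intro m _ hm; simp [hm]
      · simp
    simp only [this, Finset.sum_const, Finset.card_univ, MultiIdx.card, Nat.cast_smul_eq_nsmul]
  have hQP : ∑ β, ∑ n : MultiIdx N p, ∑ α, ∑ m : MultiIdx N p,
      B (if α = β then ∑ μ, ∑ ν, (shiftCoeff m.exps n.exps μ ν : ℂ) •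
        MvPolynomial.pderiv ν (ξ μ) else 0) (if n = m then A' β α else 0) =
      ((N + p).choose (N + 1) : ℂ) • B (divergence ξ) A'.trace := by
    rw [← LinearMap.smul_apply, ← map_smul, ← sum_shiftCoeff_pderiv, Matrix.trace, map_sum]
    refine Finset.sum_congr rfl fun β _ => ?_
    rw [map_sum, LinearMap.sum_apply]
    refine Finset.sum_congr rfl fun n _ => ?_
    rw [Finset.sum_eq_single β, Finset.sum_eq_single n]
    · simp
    · intro m _ hm; simp [hm.symm]
    · simp
    · intro α _ hα; simp [hα]
    · simp
  have hPQ : ∑ β, ∑ n : MultiIdx N p, ∑ α, ∑ m : MultiIdx N p,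
      B (if m = n then A α β else 0) (if β = α then ∑ μ, ∑ ν,
        (shiftCoeff n.exps m.exps μ ν : ℂ) • MvPolynomial.pderiv ν (η μ) else 0) =
      ((N + p).choose (N + 1) : ℂ) • B A.trace (divergence η) := by
    rw [← map_smul, ← sum_shiftCoeff_pderiv, Matrix.trace, map_sum B, LinearMap.sum_apply]
    refine Finset.sum_congr rfl fun β _ => ?_
    rw [map_sum]
    refine Finset.sum_congr rfl fun n _ => ?_
    rw [Finset.sum_eq_single β, Finset.sum_eq_single n]
    · simp
    · intro m _ hm; simp [hm]
    · simp
    · intro α _ hα; simp [hα.symm]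
    · simp
  have hQQ : ∑ β : V, ∑ n : MultiIdx N p, ∑ α, ∑ m : MultiIdx N p,
      B (if α = β then ∑ μ, ∑ ν, (shiftCoeff m.exps n.exps μ ν : ℂ) •
          MvPolynomial.pderiv ν (ξ μ) else 0) (if β = α then ∑ μ, ∑ ν,
        (shiftCoeff n.exps m.exps μ ν : ℂ) • MvPolynomial.pderiv ν (η μ) else 0) =
      (Fintype.card V : ℂ) • (((N + p + 1).choose (N + 2) : ℂ) •
          ∑ μ, ∑ ν, B (MvPolynomial.pderiv ν (ξ μ)) (MvPolynomial.pderiv μ (η ν)) +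
        ((N + p).choose (N + 2) : ℂ) • B (divergence ξ) (divergence η)) := by
    rw [← sum_shiftCoeff_pderiv_mul, Nat.cast_smul_eq_nsmul, ← Finset.card_univ,
      ← Finset.sum_const]
    refine Finset.sum_congr rfl fun β _ => Finset.sum_congr rfl fun n _ => ?_
    rw [Finset.sum_eq_single β]
    · simp
    · intro α _ hα; simp [hα]
    · simp
  rw [hPP, hQP, hPQ, hQQ]
  simp only [smul_add]
  abel

end Traces

end JetFock

end

noncomputable section

namespace JetFock

open scoped Kronecker

/-! ## Matrices with polynomial entries from constant matrices -/

section PolyMat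

variable {N : ℕ} {V κ κ' : Type*} [Fintype V] [Fintype κ] [Fintype κ']

/-- The matrix `∑ₖ Pₖ Rₖ` for polynomials `Pₖ` and constant matrices `Rₖ`. -/
def polyMat (R : κ → Matrix V V ℂ) (P : κ → Poly N) : Matrix V V (Poly N) := fun β α =>
  ∑ k, R k β α • P k

theorem polyMat_mul (R : κ → Matrix V V ℂ) (P : κ → Poly N) (R' : κ' → Matrix V V ℂ)
    (Q : κ' → Poly N) (β α : V) : (polyMat R P * polyMat R' Q) β α =
      ∑ k, ∑ l, (R k * R' l) β α • (P k * Q l) := by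
  simp only [Matrix.mul_apply, polyMat, Finset.sum_mul_sum, smul_mul_smul_comm, Finset.sum_smul]
  rw [Finset.sum_comm]
  exact Finset.sum_congr rfl fun _ _ => Finset.sum_comm

theorem polyMat_commutator (R : κ → Matrix V V ℂ) (P : κ → Poly N) (R' : κ' → Matrix V V ℂ)
    (Q : κ' → Poly N) (β α : V) :
    (polyMat R P * polyMat R' Q - polyMat R' Q * polyMat R P) β α =
      ∑ k, ∑ l, (R k * R' l - R' l * R k) β α • (P k * Q l) := by
  rw [Matrix.sub_apply, polyMat_mul, polyMat_mul, Finset.sum_comm (s := Finset.univ (α := κ')),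
    ← Finset.sum_sub_distrib]
  refine Finset.sum_congr rfl fun k _ => ?_
  rw [← Finset.sum_sub_distrib]
  refine Finset.sum_congr rfl fun l _ => ?_
  rw [Matrix.sub_apply, sub_smul, mul_comm (P k)]

theorem polyMat_trace (R : κ → Matrix V V ℂ) (P : κ → Poly N) :
    (polyMat R P).trace = ∑ k, (R k).trace • P k := by
  simp only [Matrix.trace, Matrix.diag, polyMat, Finset.sum_smul]
  exact Finset.sum_comm

theorem polyMat_trace_mul {S : Type*} [AddCommGroup S] [Module ℂ S]
    (B : Poly N →ₗ[ℂ] Poly N →ₗ[ℂ] S) (R : κ → Matrix V V ℂ) (P : κ → Poly N)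
    (R' : κ' → Matrix V V ℂ) (Q : κ' → Poly N) :
    ∑ β, ∑ α, B (polyMat R P α β) (polyMat R' Q β α) =
      ∑ k, ∑ l, (R k * R' l).trace • B (P k) (Q l) := by
  have h : ∀ β α, B (polyMat R P α β) (polyMat R' Q β α) =
      ∑ k, ∑ l, (R k α β * R' l β α) • B (P k) (Q l) := by
    intro β α
    simp only [polyMat]
    rw [map_sum B, LinearMap.sum_apply]
    refine Finset.sum_congr rfl fun k _ => ?_
    rw [map_sum]
    refine Finset.sum_congr rfl fun l _ => ?_
    rw [map_smul, map_smul, LinearMap.smul_apply, smul_smul, mul_comm]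
  have sw : ∀ {κ₀ : Type _} [Fintype κ₀] (G : V → V → κ₀ → S),
      ∑ n, ∑ m, ∑ σ, G n m σ = ∑ σ, ∑ n, ∑ m, G n m σ := by
    intro _ _ G
    rw [Finset.sum_congr rfl fun n _ => Finset.sum_comm, Finset.sum_comm]
  rw [Finset.sum_congr rfl fun β _ => Finset.sum_congr rfl fun α _ => h β α, sw]
  refine Finset.sum_congr rfl fun k _ => ?_
  rw [Finset.sum_congr rfl fun n _ => Finset.sum_comm, Finset.sum_comm]
  refine Finset.sum_congr rfl fun l _ => ?_
  simp only [Matrix.trace, Matrix.diag, Matrix.mul_apply, ← Finset.sum_smul]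
  rw [Finset.sum_comm]

theorem alongMat_polyMat {V : Type*} (ξ : VecField N) (R : κ → Matrix V V ℂ) (P : κ → Poly N) :
    alongMat ξ (polyMat R P) = polyMat R fun k => vecDeriv ξ (P k) := by
  refine Matrix.ext fun β α => ?_
  rw [alongMat_apply]
  simp only [polyMat, map_sum, Derivation.map_smul]

end PolyMat

theorem sub_kronecker {l m n r : Type*} (A B : Matrix l m ℂ) (C : Matrix n r ℂ) :
    (A - B) ⊗ₖ C = A ⊗ₖ C - B ⊗ₖ C :=
  Matrix.ext fun _ _ => sub_mul _ _ _

theorem kronecker_sub {l m n r : Type*} (A : Matrix l m ℂ) (B C : Matrix n r ℂ) :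
    A ⊗ₖ (B - C) = A ⊗ₖ B - A ⊗ₖ C :=
  Matrix.ext fun _ _ => mul_sub _ _ _

/-! ## The action of `gl(N)` and of `𝔤` on `ϱ ⊗ M` -/

section Base

variable {N p dV dM dg : ℕ} (ϱ : Matrix (Fin N) (Fin N) ℂ →ₗ⁅ℂ⁆ Matrix (Fin dV) (Fin dV) ℂ)
  {𝔤 : Type*} [LieRing 𝔤] [LieAlgebra ℂ 𝔤] (J : Module.Basis (Fin dg) ℂ 𝔤)
  (M : 𝔤 →ₗ⁅ℂ⁆ Matrix (Fin dM) (Fin dM) ℂ)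

/-- The action of the `gl(N)`-valued function `∂_ν ξ^μ`. -/
def glMat (dM : ℕ) (ξ : VecField N) : Matrix (VIdx dV dM) (VIdx dV dM) (Poly N) :=
  polyMat (fun k : Fin N × Fin N => ϱ (glUnit k.2 k.1) ⊗ₖ (1 : Matrix (Fin dM) (Fin dM) ℂ))
    fun k => MvPolynomial.pderiv k.2 (ξ k.1)

/-- The action of a `𝔤`-valued function. -/
def gaugeMat (dV : ℕ) (X : Fin dg → Poly N) : Matrix (VIdx dV dM) (VIdx dV dM) (Poly N) :=
  polyMat (fun a => (1 : Matrix (Fin dV) (Fin dV) ℂ) ⊗ₖ M (J a)) X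

theorem glUnit_bracket (μ ν σ τ : Fin N) : (⁅glUnit μ ν, glUnit σ τ⁆ : Matrix (Fin N) (Fin N) ℂ) =
    (if ν = σ then glUnit μ τ else 0) - if τ = μ then glUnit σ ν else 0 := by
  rw [LieRing.of_associative_ring_bracket]
  unfold glUnit
  congr 1
  · split_ifs with h
    · subst h; simp
    · exact Matrix.single_mul_single_of_ne _ _ _ _ h _
  · split_ifs with h
    · subst h; simp
    · exact Matrix.single_mul_single_of_ne _ _ _ _ h _

/-- Differentiating [ξ, η] gives the derivatives of the Jacobians along ξ and η plus the products of
Jacobians, and the latter are the commutator of matrix units pushed through ϱ. -/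
theorem glMat_vecBracket (ξ η : VecField N) : glMat ϱ dM (vecBracket ξ η) =
    alongMat ξ (glMat ϱ dM η) - alongMat η (glMat ϱ dM ξ) +
      (glMat ϱ dM ξ * glMat ϱ dM η - glMat ϱ dM η * glMat ϱ dM ξ) := by
  refine Matrix.ext fun β α => ?_
  have hc : ∀ k l : Fin N × Fin N,
      (ϱ (glUnit k.2 k.1) ⊗ₖ (1 : Matrix (Fin dM) (Fin dM) ℂ)) *
        (ϱ (glUnit l.2 l.1) ⊗ₖ (1 : Matrix (Fin dM) (Fin dM) ℂ)) -
      (ϱ (glUnit l.2 l.1) ⊗ₖ (1 : Matrix (Fin dM) (Fin dM) ℂ)) *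
        (ϱ (glUnit k.2 k.1) ⊗ₖ (1 : Matrix (Fin dM) (Fin dM) ℂ)) =
      (if k.1 = l.2 then ϱ (glUnit k.2 l.1) ⊗ₖ (1 : Matrix (Fin dM) (Fin dM) ℂ) else 0) -
        if l.1 = k.2 then ϱ (glUnit l.2 k.1) ⊗ₖ (1 : Matrix (Fin dM) (Fin dM) ℂ) else 0 := by
    intro k l
    have h := congrArg ϱ (glUnit_bracket k.2 k.1 l.2 l.1)
    rw [LieHom.map_lie, LieRing.of_associative_ring_bracket, map_sub] at h
    rw [← Matrix.mul_kronecker_mul, ← Matrix.mul_kronecker_mul, mul_one, ← sub_kronecker, h,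
      sub_kronecker]
    congr 1 <;> split_ifs <;> simp
  unfold glMat
  rw [Matrix.add_apply, polyMat_commutator, Matrix.sub_apply, alongMat_polyMat,
    alongMat_polyMat]
  simp only [hc]
  simp only [Matrix.sub_apply, sub_smul, Finset.sum_sub_distrib]
  have h1 : ∑ k : Fin N × Fin N, ∑ l : Fin N × Fin N,
      (if k.1 = l.2 then ϱ (glUnit k.2 l.1) ⊗ₖ (1 : Matrix (Fin dM) (Fin dM) ℂ) else 0) β α •
        (MvPolynomial.pderiv k.2 (ξ k.1) * MvPolynomial.pderiv l.2 (η l.1)) =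
      ∑ k : Fin N × Fin N, (ϱ (glUnit k.2 k.1) ⊗ₖ (1 : Matrix (Fin dM) (Fin dM) ℂ)) β α •
        ∑ μ, MvPolynomial.pderiv k.2 (ξ μ) * MvPolynomial.pderiv μ (η k.1) := by
    simp only [Fintype.sum_prod_type, Finset.smul_sum]
    have e : ∀ μ ν σ : Fin N, ∑ τ, (if μ = τ then
        ϱ (glUnit ν σ) ⊗ₖ (1 : Matrix (Fin dM) (Fin dM) ℂ) else 0) β α •
        (MvPolynomial.pderiv ν (ξ μ) * MvPolynomial.pderiv τ (η σ)) =
        (ϱ (glUnit ν σ) ⊗ₖ (1 : Matrix (Fin dM) (Fin dM) ℂ)) β α •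
        (MvPolynomial.pderiv ν (ξ μ) * MvPolynomial.pderiv μ (η σ)) := by
      intro μ ν σ
      rw [Finset.sum_eq_single μ]
      · simp
      · intro τ _ hτ; simp [hτ.symm]
      · simp
    simp only [e]
    rw [Finset.sum_congr rfl fun μ _ => Finset.sum_comm, Finset.sum_comm]
    exact Finset.sum_congr rfl fun σ _ => Finset.sum_comm
  have h2 : ∑ k : Fin N × Fin N, ∑ l : Fin N × Fin N,
      (if l.1 = k.2 then ϱ (glUnit l.2 k.1) ⊗ₖ (1 : Matrix (Fin dM) (Fin dM) ℂ) else 0) β α •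
        (MvPolynomial.pderiv k.2 (ξ k.1) * MvPolynomial.pderiv l.2 (η l.1)) =
      ∑ k : Fin N × Fin N, (ϱ (glUnit k.2 k.1) ⊗ₖ (1 : Matrix (Fin dM) (Fin dM) ℂ)) β α •
        ∑ μ, MvPolynomial.pderiv k.2 (η μ) * MvPolynomial.pderiv μ (ξ k.1) := by
    simp only [Fintype.sum_prod_type, Finset.smul_sum]
    have e : ∀ μ ν : Fin N, ∑ σ, ∑ τ, (if σ = ν then
        ϱ (glUnit τ μ) ⊗ₖ (1 : Matrix (Fin dM) (Fin dM) ℂ) else 0) β α •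
        (MvPolynomial.pderiv ν (ξ μ) * MvPolynomial.pderiv τ (η σ)) =
        ∑ τ, (ϱ (glUnit τ μ) ⊗ₖ (1 : Matrix (Fin dM) (Fin dM) ℂ)) β α •
        (MvPolynomial.pderiv τ (η ν) * MvPolynomial.pderiv ν (ξ μ)) := by
      intro μ ν
      rw [Finset.sum_eq_single ν]
      · simp [mul_comm]
      · intro τ _ hτ; simp [hτ]
      · simp
    simp only [e]
    exact Finset.sum_congr rfl fun σ _ => Finset.sum_comm
  rw [h1, h2]
  simp only [polyMat, ← Finset.sum_sub_distrib, ← Finset.sum_add_distrib, ← smul_sub,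
    ← smul_add]
  refine Finset.sum_congr rfl fun k _ => ?_
  congr 1
  rw [vecBracket_apply, map_sub, vecDeriv_apply, vecDeriv_apply, vecDeriv_apply, vecDeriv_apply,
    map_sum, map_sum]
  simp only [Derivation.leibniz, smul_eq_mul, Finset.sum_add_distrib,
    Finset.sum_sub_distrib, pderiv_comm k.2]
  have c1 : ∀ ζ ω : VecField N, ∑ μ, MvPolynomial.pderiv μ (ζ k.1) * MvPolynomial.pderiv k.2 (ω μ) =
      ∑ μ, MvPolynomial.pderiv k.2 (ω μ) * MvPolynomial.pderiv μ (ζ k.1) := fun ζ ω =>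
    Finset.sum_congr rfl fun _ _ => mul_comm _ _
  rw [c1, c1]
  ring

theorem gaugeMat_gaugeBracket (X Y : Fin dg → Poly N) :
    gaugeMat J M dV (gaugeBracket J X Y) =
      gaugeMat J M dV X * gaugeMat J M dV Y - gaugeMat J M dV Y * gaugeMat J M dV X := by
  refine Matrix.ext fun β α => ?_
  unfold gaugeMat
  rw [polyMat_commutator]
  have hc : ∀ a b, ((1 : Matrix (Fin dV) (Fin dV) ℂ) ⊗ₖ M (J a)) *
        ((1 : Matrix (Fin dV) (Fin dV) ℂ) ⊗ₖ M (J b)) -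
      ((1 : Matrix (Fin dV) (Fin dV) ℂ) ⊗ₖ M (J b)) *
        ((1 : Matrix (Fin dV) (Fin dV) ℂ) ⊗ₖ M (J a)) =
      ∑ c, J.repr ⁅J a, J b⁆ c • ((1 : Matrix (Fin dV) (Fin dV) ℂ) ⊗ₖ M (J c)) := by
    intro a b
    have h : M ⁅J a, J b⁆ = ∑ c, J.repr ⁅J a, J b⁆ c • M (J c) := by
      conv_lhs => rw [← J.sum_repr ⁅J a, J b⁆]
      rw [map_sum]
      exact Finset.sum_congr rfl fun c _ => map_smul M _ _
    rw [LieHom.map_lie, LieRing.of_associative_ring_bracket] at h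
    rw [← Matrix.mul_kronecker_mul, ← Matrix.mul_kronecker_mul, mul_one, ← kronecker_sub, h]
    ext i j
    simp only [Matrix.kroneckerMap_apply, Matrix.sum_apply, Matrix.smul_apply, Finset.mul_sum,
      smul_eq_mul]
    exact Finset.sum_congr rfl fun _ _ => by ring
  simp only [hc]
  simp only [polyMat, gaugeBracket, Matrix.sum_apply, Matrix.smul_apply,
    Finset.sum_smul, Finset.smul_sum, smul_eq_mul]
  rw [Finset.sum_comm]
  refine Finset.sum_congr rfl fun a _ => ?_
  rw [Finset.sum_comm]
  refine Finset.sum_congr rfl fun b _ => Finset.sum_congr rfl fun c _ => ?_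
  rw [mul_assoc, MvPolynomial.C_mul', smul_smul, mul_comm]

theorem gaugeMat_alongVec (ξ : VecField N) (X : Fin dg → Poly N) :
    gaugeMat J M dV (alongVec ξ X) = alongMat ξ (gaugeMat J M dV X) := by
  rw [gaugeMat, gaugeMat, alongMat_polyMat]
  congr 1
  funext a
  rw [vecDeriv_apply]; rfl

theorem glMat_gaugeMat (ξ : VecField N) (X : Fin dg → Poly N) :
    glMat ϱ dM ξ * gaugeMat J M dV X = gaugeMat J M dV X * glMat ϱ dM ξ := by
  rw [← sub_eq_zero]
  refine Matrix.ext fun β α => ?_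
  unfold glMat gaugeMat
  rw [polyMat_commutator]
  refine Finset.sum_eq_zero fun k _ => Finset.sum_eq_zero fun l _ => ?_
  rw [← Matrix.mul_kronecker_mul, ← Matrix.mul_kronecker_mul, mul_one, one_mul, mul_one, one_mul,
    sub_self]
  simp

/-- The action of a pair of a vector field and a `𝔤`-valued function on functions with values in
`ϱ ⊗ M`, apart from `ξ^μ ∂_μ`. -/
def baseMat (ξ : VecField N) (X : Fin dg → Poly N) : Matrix (VIdx dV dM) (VIdx dV dM) (Poly N) :=
  glMat ϱ dM ξ + gaugeMat J M dV X

/-- The two actions commute on ϱ ⊗ M, so the cross terms reduce to differentiating Y along ξ and X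
along η. Treating the pair (ξ, X) at once gives all three geometric brackets from one formula. -/
theorem baseMat_bracket (ξ η : VecField N) (X Y : Fin dg → Poly N) :
    baseMat ϱ J M (vecBracket ξ η) (gaugeBracket J X Y + alongVec ξ Y - alongVec η X) =
      alongMat ξ (baseMat ϱ J M η Y) - alongMat η (baseMat ϱ J M ξ X) +
        (baseMat ϱ J M ξ X * baseMat ϱ J M η Y - baseMat ϱ J M η Y * baseMat ϱ J M ξ X) := by
  have hadd : ∀ X Y : Fin dg → Poly N,
      gaugeMat J M dV (X + Y) = gaugeMat J M dV X + gaugeMat J M dV Y := by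
    intro X Y
    refine Matrix.ext fun β α => ?_
    simp [gaugeMat, polyMat, Finset.sum_add_distrib]
  have hsub : ∀ X Y : Fin dg → Poly N,
      gaugeMat J M dV (X - Y) = gaugeMat J M dV X - gaugeMat J M dV Y := by
    intro X Y
    rw [eq_sub_iff_add_eq, ← hadd, sub_add_cancel]
  have halong : ∀ (ξ : VecField N) (A B : Matrix (VIdx dV dM) (VIdx dV dM) (Poly N)),
      alongMat ξ (A + B) = alongMat ξ A + alongMat ξ B := by
    intro ξ A B
    refine Matrix.ext fun β α => ?_
    simp only [alongMat_apply, Matrix.add_apply, map_add]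
  unfold baseMat
  rw [hsub, hadd, gaugeMat_gaugeBracket, gaugeMat_alongVec, gaugeMat_alongVec, glMat_vecBracket,
    halong, halong, add_mul, mul_add, mul_add, add_mul, mul_add, mul_add, glMat_gaugeMat,
    glMat_gaugeMat]
  abel

end Base

end JetFock

end

noncomputable section

namespace JetFock

open scoped Kronecker

/-! ## Traces in `ϱ ⊗ M` and in the space of jets -/

section BaseTraces

variable {N dV dM dg : ℕ} (ϱ : Matrix (Fin N) (Fin N) ℂ →ₗ⁅ℂ⁆ Matrix (Fin dV) (Fin dV) ℂ)
  {𝔤 : Type*} [LieRing 𝔤] [LieAlgebra ℂ 𝔤] (J : Module.Basis (Fin dg) ℂ 𝔤)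
  (M : 𝔤 →ₗ⁅ℂ⁆ Matrix (Fin dM) (Fin dM) ℂ)

/-- The function `δ^a X_a`. -/
def gaugeTrace (δ : Module.Dual ℂ 𝔤) (X : Fin dg → Poly N) : Poly N := ∑ a, δ (J a) • X a

variable {ϱ M} {k₀ k₁ k₂ y z u : ℂ} {κ : LinearMap.BilinForm ℂ 𝔤} {δ : Module.Dual ℂ 𝔤}

theorem glMat_trace (hk₀ : ∀ μ ν, (ϱ (glUnit μ ν)).trace = k₀ * (if μ = ν then 1 else 0))
    (ξ : VecField N) : (glMat ϱ dM ξ).trace = (dM * k₀) • divergence ξ := by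
  unfold glMat
  rw [polyMat_trace, Fintype.sum_prod_type, divergence, Finset.smul_sum]
  refine Finset.sum_congr rfl fun μ _ => ?_
  simp only [Matrix.trace_kronecker, hk₀, Matrix.trace_one, Fintype.card_fin]
  rw [Finset.sum_eq_single μ]
  · simp [mul_comm]
  · intro ν _ hν; simp [hν]
  · simp

theorem gaugeMat_trace (hz : ∀ x : 𝔤, (M x).trace = z * δ x) (X : Fin dg → Poly N) :
    (gaugeMat J M dV X).trace = (dV * z) • gaugeTrace J δ X := by
  unfold gaugeMat
  rw [polyMat_trace, gaugeTrace, Finset.smul_sum]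
  refine Finset.sum_congr rfl fun a _ => ?_
  rw [Matrix.trace_kronecker, hz, Matrix.trace_one, Fintype.card_fin, smul_smul, mul_assoc]

theorem baseMat_trace (hk₀ : ∀ μ ν, (ϱ (glUnit μ ν)).trace = k₀ * (if μ = ν then 1 else 0))
    (hz : ∀ x : 𝔤, (M x).trace = z * δ x) (ξ : VecField N) (X : Fin dg → Poly N) :
    (baseMat ϱ J M ξ X).trace = (dM * k₀) • divergence ξ + (dV * z) • gaugeTrace J δ X := by
  rw [baseMat, Matrix.trace_add, glMat_trace hk₀, gaugeMat_trace J hz]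

variable {S : Type*} [AddCommGroup S] [Module ℂ S] (B : Poly N →ₗ[ℂ] Poly N →ₗ[ℂ] S)

theorem glMat_trace_mul (hk : ∀ μ ν σ τ, (ϱ (glUnit μ ν) * ϱ (glUnit σ τ)).trace =
      k₁ * ((if μ = τ then 1 else 0) * (if σ = ν then 1 else 0)) +
        k₂ * ((if μ = ν then 1 else 0) * (if σ = τ then 1 else 0))) (ξ η : VecField N) :
    ∑ β, ∑ α, B (glMat ϱ dM ξ α β) (glMat ϱ dM η β α) =
      (dM * k₁) • ∑ μ, ∑ ν, B (MvPolynomial.pderiv ν (ξ μ)) (MvPolynomial.pderiv μ (η ν)) +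
      (dM * k₂) • B (divergence ξ) (divergence η) := by
  unfold glMat
  rw [polyMat_trace_mul]
  have h : ∀ k l : Fin N × Fin N, ((ϱ (glUnit k.2 k.1) ⊗ₖ (1 : Matrix (Fin dM) (Fin dM) ℂ)) *
      (ϱ (glUnit l.2 l.1) ⊗ₖ (1 : Matrix (Fin dM) (Fin dM) ℂ))).trace =
      (if k.2 = l.1 then if l.2 = k.1 then dM * k₁ else 0 else 0) +
        if k.2 = k.1 then if l.2 = l.1 then dM * k₂ else 0 else 0 := by
    intro k l
    rw [← Matrix.mul_kronecker_mul, Matrix.trace_kronecker, hk, mul_one, Matrix.trace_one,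
      Fintype.card_fin]
    split_ifs <;> ring
  simp only [h, Fintype.sum_prod_type, add_smul, Finset.sum_add_distrib, ite_smul, zero_smul]
  congr 1
  · simp only [Finset.smul_sum]
    refine Finset.sum_congr rfl fun μ _ => Finset.sum_congr rfl fun ν _ => ?_
    rw [Finset.sum_eq_single ν]
    · simp
    · intro σ _ hσ; simp [hσ.symm]
    · simp
  · rw [divergence, divergence, map_sum B, LinearMap.sum_apply, Finset.smul_sum]
    refine Finset.sum_congr rfl fun μ _ => ?_
    rw [Finset.sum_eq_single μ]
    · simp [Finset.smul_sum]
    · intro σ _ hσ; simp [hσ]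
    · simp

theorem gaugeMat_trace_mul
    (hyw : ∀ x x' : 𝔤, (M x * M x').trace = y * κ x x' + u * (δ x * δ x'))
    (X Y : Fin dg → Poly N) :
    ∑ β, ∑ α, B (gaugeMat J M dV X α β) (gaugeMat J M dV Y β α) =
      (dV * y) • ∑ a, ∑ b, κ (J a) (J b) • B (X a) (Y b) +
      (dV * u) • B (gaugeTrace J δ X) (gaugeTrace J δ Y) := by
  unfold gaugeMat
  rw [polyMat_trace_mul]
  have h : ∀ a b, (((1 : Matrix (Fin dV) (Fin dV) ℂ) ⊗ₖ M (J a)) *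
      ((1 : Matrix (Fin dV) (Fin dV) ℂ) ⊗ₖ M (J b))).trace =
      dV * y * κ (J a) (J b) + dV * u * (δ (J a) * δ (J b)) := by
    intro a b
    rw [← Matrix.mul_kronecker_mul, Matrix.trace_kronecker, hyw, mul_one, Matrix.trace_one,
      Fintype.card_fin]
    ring
  simp only [h, add_smul, Finset.sum_add_distrib]
  congr 1
  · simp only [Finset.smul_sum, mul_smul]
  · rw [gaugeTrace, gaugeTrace, map_sum B, LinearMap.sum_apply, Finset.smul_sum]
    refine Finset.sum_congr rfl fun a _ => ?_
    rw [map_sum, Finset.smul_sum]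
    refine Finset.sum_congr rfl fun b _ => ?_
    rw [map_smul, map_smul, LinearMap.smul_apply, smul_smul, smul_smul]
    congr 1
    ring

theorem glMat_gaugeMat_trace_mul
    (hk₀ : ∀ μ ν, (ϱ (glUnit μ ν)).trace = k₀ * (if μ = ν then 1 else 0))
    (hz : ∀ x : 𝔤, (M x).trace = z * δ x) (ξ : VecField N) (X : Fin dg → Poly N) :
    ∑ β, ∑ α, B (glMat ϱ dM ξ α β) (gaugeMat J M dV X β α) =
      (k₀ * z) • B (divergence ξ) (gaugeTrace J δ X) := by
  unfold glMat gaugeMat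
  rw [polyMat_trace_mul]
  have h : ∀ (k : Fin N × Fin N) a, ((ϱ (glUnit k.2 k.1) ⊗ₖ (1 : Matrix (Fin dM) (Fin dM) ℂ)) *
      ((1 : Matrix (Fin dV) (Fin dV) ℂ) ⊗ₖ M (J a))).trace =
      if k.2 = k.1 then k₀ * z * δ (J a) else 0 := by
    intro k a
    rw [← Matrix.mul_kronecker_mul, Matrix.trace_kronecker, mul_one, one_mul, hk₀, hz]
    split_ifs <;> ring
  simp only [h, Fintype.sum_prod_type, ite_smul, zero_smul]
  rw [divergence, gaugeTrace, map_sum B, LinearMap.sum_apply, Finset.smul_sum]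
  refine Finset.sum_congr rfl fun μ _ => ?_
  rw [Finset.sum_eq_single μ]
  · rw [map_sum, Finset.smul_sum]
    refine Finset.sum_congr rfl fun a _ => ?_
    rw [if_pos rfl, map_smul, smul_smul]
  · intro ν _ hν; simp [hν]
  · simp

theorem baseMat_trace_mul
    (hk₀ : ∀ μ ν, (ϱ (glUnit μ ν)).trace = k₀ * (if μ = ν then 1 else 0))
    (hk : ∀ μ ν σ τ, (ϱ (glUnit μ ν) * ϱ (glUnit σ τ)).trace =
      k₁ * ((if μ = τ then 1 else 0) * (if σ = ν then 1 else 0)) +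
        k₂ * ((if μ = ν then 1 else 0) * (if σ = τ then 1 else 0)))
    (hz : ∀ x : 𝔤, (M x).trace = z * δ x)
    (hyw : ∀ x x' : 𝔤, (M x * M x').trace = y * κ x x' + u * (δ x * δ x'))
    (ξ η : VecField N) (X Y : Fin dg → Poly N) :
    ∑ β, ∑ α, B (baseMat ϱ J M ξ X α β) (baseMat ϱ J M η Y β α) =
      (dM * k₁) • ∑ μ, ∑ ν, B (MvPolynomial.pderiv ν (ξ μ)) (MvPolynomial.pderiv μ (η ν)) +
      (dM * k₂) • B (divergence ξ) (divergence η) +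
      (k₀ * z) • (B (divergence ξ) (gaugeTrace J δ Y) + B (gaugeTrace J δ X) (divergence η)) +
      ((dV * y) • ∑ a, ∑ b, κ (J a) (J b) • B (X a) (Y b) +
      (dV * u) • B (gaugeTrace J δ X) (gaugeTrace J δ Y)) := by
  have hflip : ∑ β, ∑ α, B (gaugeMat J M dV X α β) (glMat ϱ dM η β α) =
      (k₀ * z) • B (gaugeTrace J δ X) (divergence η) := by
    rw [Finset.sum_comm]
    exact glMat_gaugeMat_trace_mul J B.flip hk₀ hz η X
  simp only [baseMat, Matrix.add_apply, map_add, LinearMap.add_apply, Finset.sum_add_distrib]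
  rw [glMat_trace_mul B hk, gaugeMat_trace_mul J B hyw, glMat_gaugeMat_trace_mul J B hk₀ hz, hflip,
    smul_add]
  abel

variable (p : ℕ)

/-- The matrices of the action on `p`-jets. -/
def jetBaseMat (ϱ : Matrix (Fin N) (Fin N) ℂ →ₗ⁅ℂ⁆ Matrix (Fin dV) (Fin dV) ℂ)
    (M : 𝔤 →ₗ⁅ℂ⁆ Matrix (Fin dM) (Fin dM) ℂ) (ξ : VecField N) (X : Fin dg → Poly N) :
    Matrix (JetIdx N p dV dM) (JetIdx N p dV dM) (Poly N) :=
  jetMat p ξ (baseMat ϱ J M ξ X)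

theorem jetBaseMat_bracket (ξ η : VecField N) (X Y : Fin dg → Poly N) :
    jetBaseMat J p ϱ M (vecBracket ξ η) (gaugeBracket J X Y + alongVec ξ Y - alongVec η X) =
      alongMat ξ (jetBaseMat J p ϱ M η Y) - alongMat η (jetBaseMat J p ϱ M ξ X) +
        (jetBaseMat J p ϱ M ξ X * jetBaseMat J p ϱ M η Y -
          jetBaseMat J p ϱ M η Y * jetBaseMat J p ϱ M ξ X) := by
  unfold jetBaseMat
  rw [baseMat_bracket, jetMat_commutator]

theorem jetBaseMat_trace (hk₀ : ∀ μ ν, (ϱ (glUnit μ ν)).trace = k₀ * (if μ = ν then 1 else 0))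
    (hz : ∀ x : 𝔤, (M x).trace = z * δ x) (ξ : VecField N) (X : Fin dg → Poly N) :
    (jetBaseMat J p ϱ M ξ X).trace =
      (dM * ((N + p).choose p * k₀ + (N + p).choose (N + 1) * dV) : ℂ) • divergence ξ +
      (z * (N + p).choose p * dV : ℂ) • gaugeTrace J δ X := by
  rw [jetBaseMat, jetMat_trace, baseMat_trace J hk₀ hz, smul_add, smul_smul, smul_smul,
    Fintype.card_prod, Fintype.card_fin, Fintype.card_fin, add_right_comm, ← add_smul]
  push_cast
  congr 2 <;> ring

/-- The bilinear map B will be `pairInt`. The five coefficients are, up to sign and the summand 1,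
the charges c₁, c₂, c₇, c₅ and c₈. -/
theorem jetBaseMat_trace_mul
    (hk₀ : ∀ μ ν, (ϱ (glUnit μ ν)).trace = k₀ * (if μ = ν then 1 else 0))
    (hk : ∀ μ ν σ τ, (ϱ (glUnit μ ν) * ϱ (glUnit σ τ)).trace =
      k₁ * ((if μ = τ then 1 else 0) * (if σ = ν then 1 else 0)) +
        k₂ * ((if μ = ν then 1 else 0) * (if σ = τ then 1 else 0)))
    (hz : ∀ x : 𝔤, (M x).trace = z * δ x)
    (hyw : ∀ x x' : 𝔤, (M x * M x').trace = y * κ x x' + u * (δ x * δ x'))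
    (ξ η : VecField N) (X Y : Fin dg → Poly N) :
    ∑ i, ∑ k, B (jetBaseMat J p ϱ M ξ X k i) (jetBaseMat J p ϱ M η Y i k) =
      (dM * ((N + p).choose p * k₁ + (N + p + 1).choose (N + 2) * dV) : ℂ) •
        ∑ μ, ∑ ν, B (MvPolynomial.pderiv ν (ξ μ)) (MvPolynomial.pderiv μ (η ν)) +
      (dM * ((N + p).choose p * k₂ + (N + p).choose (N + 2) * dV
        + 2 * (N + p).choose (N + 1) * k₀) : ℂ) • B (divergence ξ) (divergence η) +
      (z * ((N + p).choose p * k₀ + (N + p).choose (N + 1) * dV) : ℂ) •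
        (B (divergence ξ) (gaugeTrace J δ Y) + B (gaugeTrace J δ X) (divergence η)) +
      (y * (N + p).choose p * dV : ℂ) • ∑ a, ∑ b, κ (J a) (J b) • B (X a) (Y b) +
      (u * (N + p).choose p * dV : ℂ) • B (gaugeTrace J δ X) (gaugeTrace J δ Y) := by
  unfold jetBaseMat
  rw [jetMat_trace_mul p B, baseMat_trace_mul J B hk₀ hk hz hyw, baseMat_trace J hk₀ hz,
    baseMat_trace J hk₀ hz, Fintype.card_prod, Fintype.card_fin, Fintype.card_fin]
  simp only [map_add, map_smul, LinearMap.add_apply, LinearMap.smul_apply]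
  generalize ∑ μ, ∑ ν, B (MvPolynomial.pderiv ν (ξ μ)) (MvPolynomial.pderiv μ (η ν)) = G
  generalize ∑ a, ∑ b, κ (J a) (J b) • B (X a) (Y b) = K
  generalize B (divergence ξ) (divergence η) = DD
  generalize B (divergence ξ) (gaugeTrace J δ Y) = DX
  generalize B (gaugeTrace J δ X) (divergence η) = XD
  generalize B (gaugeTrace J δ X) (gaugeTrace J δ Y) = XX
  push_cast
  module

end BaseTraces

/-! ## Comparison with the explicit matrices -/

section Explicit

variable {N p dV dM dg : ℕ} (ϱ : Matrix (Fin N) (Fin N) ℂ →ₗ⁅ℂ⁆ Matrix (Fin dV) (Fin dV) ℂ)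
  {𝔤 : Type*} [LieRing 𝔤] [LieAlgebra ℂ 𝔤] (J : Module.Basis (Fin dg) ℂ 𝔤)
  (M : 𝔤 →ₗ⁅ℂ⁆ Matrix (Fin dM) (Fin dM) ℂ)

theorem multiDeriv_smul (m : Fin N → ℕ) (c : ℂ) (P : Poly N) :
    multiDeriv m (c • P) = c • multiDeriv m P := by
  simp only [← multiDerivLin_apply, map_smul]

theorem jetMat_glMat (ξ : VecField N) (m n : MultiIdx N p) (β α : VIdx dV dM) :
    jetMat p ξ (glMat ϱ dM ξ) (β, n) (α, m) =
      if m.len ≤ n.len then jetT ϱ ξ m.exps n.exps β α else 0 := by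
  split_ifs with h
  · unfold jetMat jetT
    congr 1
    · simp only [glMat, polyMat, multiDeriv_sum, multiDeriv_smul, Fintype.sum_prod_type,
        Finset.mul_sum, Matrix.kroneckerMap_apply, Matrix.one_apply, multiDeriv_succ',
        MvPolynomial.C_mul', smul_smul]
    · unfold jetShift
      by_cases e : β = α
      · rw [if_pos e]
        refine Finset.sum_congr rfl fun μ _ => ?_
        unfold jetShiftTerm
        -- For |m| ≤ |n| the exclusion m - e_μ ≠ n in `jetT` holds automatically, by comparing
        -- lengths.
        have hiff : (∑ ν, m.exps ν ≤ ∑ ν, n.exps ν ∧ 1 ≤ m.exps μ) ↔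
            (1 ≤ m.exps μ ∧ m.exps - Pi.single μ 1 ≠ n.exps) := by
          constructor
          · rintro ⟨_, h2⟩
            refine ⟨h2, fun h3 => ?_⟩
            have h4 := sum_add_single (m.exps - Pi.single μ 1) μ
            rw [tsub_add_cancel_of_le (single_le_iff.mpr h2), h3] at h4
            have : ∑ ν, m.exps ν ≤ ∑ ν, n.exps ν := h
            omega
          · rintro ⟨h2, _⟩
            exact ⟨h, h2⟩
        simp only [hiff, if_pos e, mul_one]
      · rw [if_neg e]
        symm
        refine Finset.sum_eq_zero fun μ _ => ?_
        simp [e]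
  · exact jetMat_of_len_lt p ξ _ (not_le.mp h)

theorem jetMat_gaugeMat (X : Fin dg → Poly N) (m n : MultiIdx N p) (β α : VIdx dV dM) :
    jetMat p 0 (gaugeMat J M dV X) (β, n) (α, m) =
      if m.len ≤ n.len then jetJ J M X m.exps n.exps β α else 0 := by
  have h0 : jetShift (0 : VecField N) n.exps m.exps = 0 := by
    refine Finset.sum_eq_zero fun μ _ => ?_
    simp [jetShiftTerm, multiDeriv_apply_zero]
  split_ifs with h
  · unfold jetMat jetJ
    rw [h0, ite_self, add_zero]
    simp only [gaugeMat, polyMat, multiDeriv_sum, multiDeriv_smul,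
        Finset.mul_sum, Matrix.kroneckerMap_apply, Matrix.one_apply,
        MvPolynomial.C_mul', smul_smul]
  · exact jetMat_of_len_lt p 0 _ (not_le.mp h)

theorem jetBaseMat_zero_right (ξ : VecField N) :
    jetBaseMat J p ϱ M ξ 0 = jetMat p ξ (glMat ϱ dM ξ) := by
  have : gaugeMat J M dV (0 : Fin dg → Poly N) = 0 := by
    refine Matrix.ext fun β α => ?_
    simp [gaugeMat, polyMat]
  rw [jetBaseMat, baseMat, this, add_zero]

theorem jetBaseMat_zero_left (X : Fin dg → Poly N) :
    jetBaseMat J p ϱ M 0 X = jetMat p 0 (gaugeMat J M dV X) := by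
  have : glMat ϱ dM (0 : VecField N) = 0 := by
    refine Matrix.ext fun β α => ?_
    simp [glMat, polyMat]
  rw [jetBaseMat, baseMat, this, zero_add]

theorem jetBaseMat_add (ξ η : VecField N) (X Y : Fin dg → Poly N) :
    jetBaseMat J p ϱ M (ξ + η) (X + Y) = jetBaseMat J p ϱ M ξ X + jetBaseMat J p ϱ M η Y := by
  refine Matrix.ext fun i j => ?_
  simp only [jetBaseMat, jetMat, baseMat, glMat, gaugeMat, polyMat, Matrix.add_apply, Pi.add_apply,
    map_add, smul_add, Finset.sum_add_distrib, multiDeriv_add, mul_add, jetShift, jetShiftTerm]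
  split_ifs <;> simp [Finset.sum_add_distrib, ite_add_zero] <;> ring

theorem jetBaseMat_smul (c : ℂ) (ξ : VecField N) (X : Fin dg → Poly N) :
    jetBaseMat J p ϱ M (c • ξ) (c • X) = c • jetBaseMat J p ϱ M ξ X := by
  refine Matrix.ext fun i j => ?_
  have hs : jetShift (c • ξ) i.2.exps j.2.exps = c • jetShift ξ i.2.exps j.2.exps := by
    unfold jetShift jetShiftTerm
    rw [Finset.smul_sum]
    refine Finset.sum_congr rfl fun μ _ => ?_
    rw [smul_ite, smul_zero, Pi.smul_apply, multiDeriv_smul, mul_smul_comm]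
  have hb : baseMat ϱ J M (c • ξ) (c • X) = c • baseMat ϱ J M ξ X := by
    refine Matrix.ext fun β α => ?_
    simp only [baseMat, glMat, gaugeMat, polyMat, Matrix.add_apply, Matrix.smul_apply,
      Pi.smul_apply, Derivation.map_smul, smul_add, Finset.smul_sum, smul_smul, mul_comm]
  simp only [jetBaseMat, jetMat, hb, hs, Matrix.smul_apply, multiDeriv_smul, smul_add, smul_ite,
    smul_zero, mul_smul_comm]

end Explicit

end JetFock

end

noncomputable section

namespace JetFock

/-! ## The commutators of the generators with values in local functionals -/

section Realization

variable {N : ℕ} {ι : Type} [DecidableEq ι] {s : Parity} {F : Type*} [AddCommGroup F] [Module ℂ F]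
  (R : ModeRep N ι s F)

/-- The operator of a differential polynomial. -/
def ModeRep.diffInt : DiffPoly N →ₗ[ℂ] Module.End ℂ F where
  toFun P := circInt (R.diffQ P : RField F)
  map_add' P Q := by rw [map_add, Submodule.coe_add, map_add]
  map_smul' c P := by rw [R.diffQ_smul, Submodule.coe_smul, map_smul]; rfl

theorem ModeRep.diffInt_apply (P : DiffPoly N) : R.diffInt P = circInt (R.diffQ P : RField F) := rfl

theorem ModeRep.diffInt_totalDeriv (P : DiffPoly N) : R.diffInt (totalDeriv N P) = 0 := by
  rw [R.diffInt_apply, ← R.qder_diffQ, R.coe_qder, circInt_tder]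

/-- The operator of a local functional. -/
def ModeRep.obsInt : Obs N →ₗ[ℂ] Module.End ℂ F :=
  Submodule.liftQ _ R.diffInt (by
    rintro _ ⟨P, rfl⟩
    exact R.diffInt_totalDeriv P)

theorem ModeRep.obsInt_functional (P : DiffPoly N) : R.obsInt (functional P) = R.diffInt P := rfl

/-- The differential polynomial `(d f(q(t))/dt) g(q(t))`. -/
def pairing (f g : Poly N) : DiffPoly N :=
  ∑ ρ, velocity ρ * atTraj (MvPolynomial.pderiv ρ f * g)

/-- The operator `∫ dt (d f(q(t))/dt) g(q(t))`. -/
def ModeRep.pairInt : Poly N →ₗ[ℂ] Poly N →ₗ[ℂ] Module.End ℂ F :=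
  LinearMap.mk₂ ℂ (fun f g => circInt ((R.qder (R.trajQ f) * R.trajQ g : R.QF) : RField F))
    (fun f f' g => by rw [map_add, map_add, add_mul, Submodule.coe_add, map_add])
    (fun c f g => by rw [map_smul, map_smul, smul_mul_assoc, Submodule.coe_smul, map_smul])
    (fun f g g' => by rw [map_add, mul_add, Submodule.coe_add, map_add])
    (fun c f g => by rw [map_smul, mul_smul_comm, Submodule.coe_smul, map_smul])

theorem ModeRep.pairInt_apply (f g : Poly N) : R.pairInt f g =
    circInt ((R.qder (R.trajQ f) * R.trajQ g : R.QF) : RField F) := rfl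

/-- Integration by parts on the circle, possible because functions of q commute. -/
theorem ModeRep.pairInt_antisymm (f g : Poly N) : R.pairInt f g = -R.pairInt g f := by
  rw [eq_neg_iff_add_eq_zero, R.pairInt_apply, R.pairInt_apply, ← map_add, ← Submodule.coe_add,
    mul_comm (R.qder (R.trajQ g)), ← R.qder_mul, R.coe_qder, circInt_tder]

theorem ModeRep.diffInt_pairing (f g : Poly N) : R.diffInt (pairing f g) = R.pairInt f g := by
  rw [R.diffInt_apply, R.pairInt_apply, ← R.diffQ_atTraj, ← R.diffQ_atTraj, R.qder_diffQ,
    ← map_mul, totalDeriv_atTraj, pairing, Finset.sum_mul]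
  simp only [map_mul, mul_assoc]

theorem ModeRep.vecF_add (ξ η : VecField N) : R.vecF (ξ + η) = R.vecF ξ + R.vecF η := by
  simp only [ModeRep.vecF, Pi.add_apply, map_add, Submodule.coe_add, Finset.sum_add_distrib]

theorem ModeRep.vecF_smul (c : ℂ) (ξ : VecField N) : R.vecF (c • ξ) = c • R.vecF ξ := by
  simp only [ModeRep.vecF, Pi.smul_apply, map_smul, Submodule.coe_smul, Finset.smul_sum]

theorem ModeRep.diffInt_commute (P Q : DiffPoly N) :
    R.diffInt P * R.diffInt Q = R.diffInt Q * R.diffInt P := by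
  rw [R.diffInt_apply, R.diffInt_apply, circInt_apply, circInt_apply, smul_mul_smul_comm,
    smul_mul_smul_comm]
  congr 1
  exact R.QF_commute (R.diffQ P) (R.diffQ Q) 0 0

theorem ModeRep.circInt_expQ_mul (r : ℤ) (A : R.QF) :
    circInt ((R.expQ r * A : R.QF) : RField F) = (2 * (Real.pi : ℂ)) • (A : RField F) (-r) := by
  rw [R.expQ_mul, circInt_apply, shift_apply, zero_sub]

theorem ModeRep.diffInt_single_mul (r : ℤ) (c : ℂ) (P : Poly N) :
    R.diffInt (MvPolynomial.C (AddMonoidAlgebra.single r c) * atTraj P) =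
      (c * (2 * (Real.pi : ℂ))) • (R.trajQ P : RField F) (-r) := by
  rw [R.diffInt_apply, map_mul, R.diffQ_C, R.trigQ_single, R.diffQ_atTraj, smul_mul_assoc,
    Submodule.coe_smul, map_smul, R.circInt_expQ_mul, smul_smul]

theorem ModeRep.diffInt_single (r : ℤ) (c : ℂ) :
    R.diffInt (MvPolynomial.C (AddMonoidAlgebra.single r c)) =
      (c * (2 * (Real.pi : ℂ))) • (if r = 0 then 1 else 0 : Module.End ℂ F) := by
  have h := R.diffInt_single_mul r c 1
  rw [map_one, mul_one] at h
  rw [h, map_one, R.coe_one, fone_apply]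
  simp only [neg_eq_zero]

variable [Fintype ι]

theorem ModeRep.bilF_add (A B : Matrix ι ι (Poly N)) : R.bilF (A + B) = R.bilF A + R.bilF B := by
  simp only [ModeRep.bilF, ModeRep.trajPhi, Matrix.add_apply, map_add, Submodule.coe_add,
    LinearMap.add_apply, Finset.sum_add_distrib, smul_add]

theorem ModeRep.bilF_smul (c : ℂ) (A : Matrix ι ι (Poly N)) : R.bilF (c • A) = c • R.bilF A := by
  simp only [ModeRep.bilF, ModeRep.trajPhi, Matrix.smul_apply, map_smul, Submodule.coe_smul,
    LinearMap.smul_apply, ← Finset.smul_sum, smul_comm c]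

/-- The operator by which a first order matrix differential operator `ξ^μ ∂_μ + A` acts. -/
def ModeRep.firstOrderInt (ξ : VecField N) (A : Matrix ι ι (Poly N)) : Module.End ℂ F :=
  circInt (R.vecF ξ + R.bilF A)

/-- First order operators are quantized up to the two Schwinger terms, from re-bracketing p and π
respectively; they become the charges once A and B are jet matrices. -/
theorem ModeRep.commutator_firstOrderInt (ξ η : VecField N) (A B : Matrix ι ι (Poly N)) :
    R.firstOrderInt ξ A * R.firstOrderInt η B - R.firstOrderInt η B * R.firstOrderInt ξ A =
      R.firstOrderInt (vecBracket ξ η) (alongMat ξ B - alongMat η A + (A * B - B * A)) -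
        (Complex.I * (1 / (2 * (Real.pi : ℂ)))) •
          (∑ μ, ∑ ν, R.pairInt (MvPolynomial.pderiv ν (ξ μ)) (MvPolynomial.pderiv μ (η ν)) +
            s.sgn • ∑ i, ∑ k, R.pairInt (A k i) (B i k)) := by
  -- After integration the roles can be exchanged, reducing this cross term to the anomaly-free
  -- action of η on the bilinear.
  have hflip : circInt (tad (circInt (R.bilF A)) 1 (R.vecF η)) = -circInt (R.bilF (alongMat η A)) := by
    rw [← ad_vec_bil, ← commutator_circInt, ← commutator_circInt]
    abel
  have e1 : circInt ((∑ μ, ∑ ν, R.qder (R.trajQ (MvPolynomial.pderiv μ (ξ ν))) *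
      R.trajQ (MvPolynomial.pderiv ν (η μ)) : R.QF) : RField F) =
      ∑ μ, ∑ ν, R.pairInt (MvPolynomial.pderiv ν (ξ μ)) (MvPolynomial.pderiv μ (η ν)) := by
    rw [Finset.sum_comm]
    simp only [coe_sum_QF, map_sum, R.pairInt_apply]
  have e2 : circInt ((∑ i, ∑ k, R.qder (R.trajQ (A k i)) * R.trajQ (B i k) : R.QF) : RField F) =
      ∑ i, ∑ k, R.pairInt (A k i) (B i k) := by
    simp only [coe_sum_QF, map_sum, R.pairInt_apply]
  have h : R.firstOrderInt ξ A * R.firstOrderInt η B - R.firstOrderInt η B * R.firstOrderInt ξ A =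
      circInt (tad (circInt (R.vecF ξ)) 1 (R.vecF η)) +
      circInt (tad (circInt (R.vecF ξ)) 1 (R.bilF B)) +
      circInt (tad (circInt (R.bilF A)) 1 (R.vecF η)) +
      circInt (tad (circInt (R.bilF A)) 1 (R.bilF B)) := by
    unfold ModeRep.firstOrderInt
    simp only [← commutator_circInt, map_add, add_mul, mul_add]
    abel
  rw [h, hflip, ad_vec_vec, ad_vec_bil, ad_bil_bil, map_sub, map_sub, map_smul, map_smul, e1, e2,
    ModeRep.firstOrderInt]
  simp only [R.bilF_add, R.bilF_sub, map_add, map_sub]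
  module

theorem ModeRep.commutator_firstOrderInt_diffInt (ξ : VecField N) (A : Matrix ι ι (Poly N))
    (P : DiffPoly N) :
    R.firstOrderInt ξ A * R.diffInt P - R.diffInt P * R.firstOrderInt ξ A =
      R.diffInt (variation (trajVariation ξ 0) P) := by
  refine commutator_diffQ (fun μ => ?_) P
  rw [ModeRep.firstOrderInt, map_add, tad_add_left, R.ad_bil_fq, add_zero, ad_vec_fq_diffQ]
  simp [trajVariation]

/-- The integral of a field against trigonometric polynomials. -/
def smearLin (A : RField F) : Trig →ₗ[ℂ] Module.End ℂ F :=
  Finsupp.linearCombination ℂ (fun n => modeInt n A) ∘ₗ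
    (AddMonoidAlgebra.coeffLinearEquiv ℂ).toLinearMap

theorem smearLin_single (A : RField F) (r : ℤ) (c : ℂ) :
    smearLin A (AddMonoidAlgebra.single r c) = c • modeInt r A :=
  Finsupp.linearCombination_single ℂ c r

theorem smear_eq (A : RField F) (f : Trig) : smear f (A : OpField F) = smearLin A f := by
  change _ = f.coeff.sum fun n c => c • modeInt n A
  rw [smear, Finset.smul_sum, Finsupp.sum]
  refine Finset.sum_congr rfl fun n _ => ?_
  rw [modeInt_apply, smul_comm]

theorem smear_one (A : RField F) : smear 1 (A : OpField F) = circInt A := by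
  rw [smear_eq, AddMonoidAlgebra.one_def, smearLin_single, one_smul, modeInt_apply, neg_zero,
    circInt_apply]

/-- The reparametrization current with a constant term. -/
def ModeRep.repF (lam w c : ℂ) : RField F := R.repTrajF + R.repMatF lam w + c • fone

theorem ModeRep.modeInt_repF (lam w c : ℂ) (r : ℤ) :
    modeInt r (R.repF lam w c) = R.repGen lam w r + (c * (2 * (Real.pi : ℂ))) •
      (if r = 0 then 1 else 0 : Module.End ℂ F) := by
  rw [ModeRep.repF, map_add, map_smul, ModeRep.repGen, modeInt_apply r fone, fone_apply, smul_smul]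
  simp only [neg_eq_zero]

theorem trigDeriv_single (r : ℤ) (c : ℂ) : trigDeriv (AddMonoidAlgebra.single r c) =
    AddMonoidAlgebra.single r (-Complex.I * (r : ℂ) * c) := trigDerivLin_single r c

/-- By linearity f is an exponential exp(-irt). Then f'' and f' carry -r² and -ir, which match the
quadratic polynomials of `ad_rep_vec` and `ad_rep_bil`; the constant c drops out. -/
theorem ModeRep.commutator_smear_firstOrderInt (lam w c : ℂ) (f : Trig) (ξ : VecField N)
    (A : Matrix ι ι (Poly N)) :
    smearLin (R.repF lam w c) f * R.firstOrderInt ξ A -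
      R.firstOrderInt ξ A * smearLin (R.repF lam w c) f =
      (1 / (4 * (Real.pi : ℂ) * Complex.I)) • (R.diffInt
          (MvPolynomial.C (trigDeriv (trigDeriv f) - Complex.I • trigDeriv f) *
            atTraj (divergence ξ)) +
        s.sgn • R.diffInt (MvPolynomial.C ((2 * lam - 1) • trigDeriv (trigDeriv f) -
          (Complex.I * (2 * w - 1)) • trigDeriv f) * atTraj A.trace)) := by
  induction f using AddMonoidAlgebra.induction_linear with
  | zero => simp
  | add f g hf hg =>
    rw [map_add, add_mul, mul_add, add_sub_add_comm, hf, hg, ← smul_add, map_add, map_add]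
    congr 1
    rw [add_add_add_comm, ← smul_add, ← map_add, ← map_add, ← add_mul, ← add_mul, ← map_add,
      ← map_add, smul_add, smul_add, smul_add, add_sub_add_comm, add_sub_add_comm]
  | single r a =>
    have hcomm : smearLin (R.repF lam w c) (AddMonoidAlgebra.single r a) * R.firstOrderInt ξ A -
        R.firstOrderInt ξ A * smearLin (R.repF lam w c) (AddMonoidAlgebra.single r a) =
        a • circInt (tad (R.repGen lam w r) 1 (R.vecF ξ + R.bilF A)) := by
      rw [smearLin_single, R.modeInt_repF, ← commutator_circInt, ModeRep.firstOrderInt]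
      simp only [smul_add, add_mul, mul_add, smul_mul_assoc, mul_smul_comm, smul_sub]
      split_ifs <;> simp
    rw [hcomm, map_add, map_add, ad_rep_vec, ad_rep_bil]
    simp only [trigDeriv_single, AddMonoidAlgebra.smul_single, smul_eq_mul,
      ← AddMonoidAlgebra.single_sub, R.diffInt_single_mul, smul_add, smul_smul]
    have hpi : (Real.pi : ℂ) ≠ 0 := by simp [Real.pi_ne_zero]
    congr 2
    · field_simp
      ring_nf
    · field_simp
      ring_nf

theorem ModeRep.commutator_smear_diffInt (lam w c : ℂ) (f : Trig) (P : DiffPoly N) :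
    smearLin (R.repF lam w c) f * R.diffInt P - R.diffInt P * smearLin (R.repF lam w c) f =
      R.diffInt (variation (trajVariation 0 f) P) := by
  have hx : ∀ μ, tad (smearLin (R.repF lam w c) f) 1 (R.fq μ) =
      R.diffQ (trajVariation 0 f μ) := by
    intro μ
    induction f using AddMonoidAlgebra.induction_linear with
    | zero => simp [trajVariation, ← adLin_apply]
    | add f g hf hg =>
      rw [map_add, tad_add_left, hf, hg, ← Submodule.coe_add, ← map_add]
      congr 2
      simp [trajVariation, add_mul]
      ring
    | single r a =>
      have h1 : tad (if r = 0 then 1 else 0 : Module.End ℂ F) 1 (R.fq μ) = 0 := by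
        split_ifs <;> ext n <;> simp [tad_apply]
      rw [smearLin_single, R.modeInt_repF, tad_smul_left, tad_add_left, tad_smul_left, h1,
        smul_zero, add_zero, ad_rep_fq_diffQ, ← Submodule.coe_smul, ← R.diffQ_smul]
      congr 2
      have : AddMonoidAlgebra.single r a = a • (AddMonoidAlgebra.single r 1 : Trig) := by
        rw [AddMonoidAlgebra.smul_single, smul_eq_mul, mul_one]
      rw [this]
      simp [trajVariation, MvPolynomial.C_mul', smul_neg]
  exact commutator_diffQ hx P

/-- The cocycle allows only multiples of r³ - r. The matter term has the linear excess λ - λ² - w +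
w² per pair. Since [f, g] contributes 2ir times the zero mode of L, shifting L by c, that is its
integral by 2πc, absorbs the excess; this determines c. -/
theorem ModeRep.commutator_smear_smear (lam w : ℂ) (f g : Trig) {c c₄ : ℂ}
    (hc : c = s.sgn * Fintype.card ι *
      ((lam - lam ^ 2 - w + w ^ 2) / (4 * (Real.pi : ℂ) * Complex.I)))
    (hc₄ : c₄ = 2 * N + s.sgn * 2 * (1 - 6 * lam + 6 * lam ^ 2) * Fintype.card ι) :
    smearLin (R.repF lam w c) f * smearLin (R.repF lam w c) g -
      smearLin (R.repF lam w c) g * smearLin (R.repF lam w c) f =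
      smearLin (R.repF lam w c) (circleBracket f g) +
      (c₄ / (24 * (Real.pi : ℂ) * Complex.I)) • R.diffInt
        (MvPolynomial.C (trigDeriv (trigDeriv f) * trigDeriv g - trigDeriv f * g)) := by
  induction f using AddMonoidAlgebra.induction_linear with
  | zero => simp [circleBracket]
  | add f f' hf hf' =>
    have e : circleBracket (f + f') g = circleBracket f g + circleBracket f' g := by
      simp only [circleBracket, map_add]; ring
    have e' : trigDeriv (trigDeriv (f + f')) * trigDeriv g - trigDeriv (f + f') * g =
        (trigDeriv (trigDeriv f) * trigDeriv g - trigDeriv f * g) +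
        (trigDeriv (trigDeriv f') * trigDeriv g - trigDeriv f' * g) := by
      simp only [map_add]; ring
    rw [e, e', map_add, map_add, map_add, map_add, add_mul, mul_add, add_sub_add_comm, hf, hf',
      smul_add]
    abel
  | single r a =>
    induction g using AddMonoidAlgebra.induction_linear with
    | zero => simp [circleBracket]
    | add g g' hg hg' =>
      have e : ∀ f, circleBracket f (g + g') = circleBracket f g + circleBracket f g' := by
        intro f
        simp only [circleBracket, map_add]; ring
      have e' : ∀ f, trigDeriv (trigDeriv f) * trigDeriv (g + g') - trigDeriv f * (g + g') =
          (trigDeriv (trigDeriv f) * trigDeriv g - trigDeriv f * g) +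
          (trigDeriv (trigDeriv f) * trigDeriv g' - trigDeriv f * g') := by
        intro f
        simp only [map_add]; ring
      rw [e, e', map_add, map_add, map_add, map_add, add_mul, mul_add, add_sub_add_comm, hg, hg',
        smul_add]
      abel
    | single q b =>
      have hcomm : smearLin (R.repF lam w c) (AddMonoidAlgebra.single r a) *
          smearLin (R.repF lam w c) (AddMonoidAlgebra.single q b) -
          smearLin (R.repF lam w c) (AddMonoidAlgebra.single q b) *
          smearLin (R.repF lam w c) (AddMonoidAlgebra.single r a) =
          (a * b) • modeInt q (tad (R.repGen lam w r) 1 (R.repTrajF + R.repMatF lam w)) := by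
        rw [smearLin_single, smearLin_single, R.modeInt_repF, R.modeInt_repF,
          ← commutator_modeInt, ← ModeRep.repGen]
        simp only [smul_add, add_mul, mul_add, smul_mul_assoc, mul_smul_comm, smul_sub, smul_smul]
        have h1 : ∀ (n : ℤ) (x : Module.End ℂ F),
            (if n = 0 then 1 else 0 : Module.End ℂ F) * x =
              x * (if n = 0 then 1 else 0 : Module.End ℂ F) := by
          intro n x; split_ifs <;> simp
        rw [h1 r (R.repGen lam w q), h1 r (if q = 0 then 1 else 0), h1 q (R.repGen lam w r)]
        module
      have hbr : circleBracket (AddMonoidAlgebra.single r a) (AddMonoidAlgebra.single q b) =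
          AddMonoidAlgebra.single (r + q) (Complex.I * (r - q) * (a * b)) := by
        rw [circleBracket, trigDeriv_single, trigDeriv_single,
          AddMonoidAlgebra.single_mul_single, AddMonoidAlgebra.single_mul_single, add_comm q r,
          ← AddMonoidAlgebra.single_sub]
        congr 1
        ring
      have hcc : trigDeriv (trigDeriv (AddMonoidAlgebra.single r a)) *
          trigDeriv (AddMonoidAlgebra.single q b) -
          trigDeriv (AddMonoidAlgebra.single r a) * AddMonoidAlgebra.single q b =
          AddMonoidAlgebra.single (r + q) (Complex.I * (r ^ 2 * q + r) * (a * b)) := by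
        rw [trigDeriv_single, trigDeriv_single, trigDeriv_single,
          AddMonoidAlgebra.single_mul_single, AddMonoidAlgebra.single_mul_single,
          ← AddMonoidAlgebra.single_sub]
        congr 1
        ring_nf
        simp only [Complex.I_pow_three]
        ring
      rw [hcomm, hbr, hcc, smearLin_single, R.modeInt_repF, R.diffInt_single, ad_rep_repGen,
        fone_apply]
      have hpi : (Real.pi : ℂ) ≠ 0 := by simp [Real.pi_ne_zero]
      -- Both the constant c and the cocycle are seen only by the zero mode, so the numerical
      -- identity is needed only for q = -r.
      by_cases hrq : r + q = 0
      · obtain rfl : q = -r := by omega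
        simp only [hrq, if_true]
        subst hc hc₄
        push_cast
        match_scalars
        · ring
        · field_simp
          ring
      · simp only [hrq, if_false]
        match_scalars
        ring

end Realization

end JetFock

end

noncomputable section

namespace JetFock

/-! ## The extensions as pairings -/

section Cocycles

variable {N dg : ℕ} {𝔤 : Type*} [LieRing 𝔤] [LieAlgebra ℂ 𝔤] (J : Module.Basis (Fin dg) ℂ 𝔤)

/-- The local functional `∫ dt (d f(q(t))/dt) g(q(t))`, as a bilinear map. -/
def obsPairing : Poly N →ₗ[ℂ] Poly N →ₗ[ℂ] DiffPoly N :=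
  LinearMap.mk₂ ℂ pairing
    (fun f f' g => by simp only [pairing, map_add, add_mul, mul_add, Finset.sum_add_distrib])
    (fun c f g => by
      simp only [pairing, Derivation.map_smul, smul_mul_assoc, map_smul, mul_smul_comm,
        Finset.smul_sum])
    (fun f g g' => by simp only [pairing, map_add, mul_add, Finset.sum_add_distrib])
    (fun c f g => by simp only [pairing, map_smul, mul_smul_comm, Finset.smul_sum])

theorem obsPairing_apply (f g : Poly N) : obsPairing f g = pairing f g := rfl

/-- Rewritten with `pairing` so that it can be compared with the trace formula for jet matrices; the
next lemmas do the same for the extensions that involve the gauge currents. -/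
theorem cocycleDiff_eq (c : Charges) (ξ η : VecField N) :
    cocycleDiff c ξ η = (1 / (2 * (Real.pi : ℂ) * Complex.I)) • functional
      (c.c₁ • (∑ μ, ∑ ν, pairing (MvPolynomial.pderiv ν (ξ μ)) (MvPolynomial.pderiv μ (η ν))) +
        c.c₂ • pairing (divergence ξ) (divergence η)) := by
  unfold cocycleDiff
  congr 2
  have h1 : ∑ μ, ∑ ν, pairing (MvPolynomial.pderiv ν (ξ μ)) (MvPolynomial.pderiv μ (η ν)) =
      ∑ ρ, velocity ρ * atTraj (∑ μ, ∑ ν, MvPolynomial.pderiv ρ (MvPolynomial.pderiv ν (ξ μ)) *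
        MvPolynomial.pderiv μ (η ν)) := by
    simp only [pairing, map_sum, Finset.mul_sum]
    rw [Finset.sum_congr rfl fun μ _ => Finset.sum_comm, Finset.sum_comm]
  have h2 : pairing (divergence ξ) (divergence η) =
      ∑ ρ, velocity ρ * atTraj (∑ μ, ∑ ν, MvPolynomial.pderiv ρ (MvPolynomial.pderiv μ (ξ μ)) *
        MvPolynomial.pderiv ν (η ν)) := by
    unfold pairing divergence
    refine Finset.sum_congr rfl fun ρ _ => ?_
    rw [map_sum, Finset.sum_mul_sum]
  rw [h1, h2, Finset.smul_sum, Finset.smul_sum, ← Finset.sum_add_distrib]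
  refine Finset.sum_congr rfl fun ρ _ => ?_
  rw [map_add, MvPolynomial.C_mul', MvPolynomial.C_mul', map_smul, map_smul, mul_add,
    mul_smul_comm, mul_smul_comm]

theorem cocycleGauge_eq (κ : LinearMap.BilinForm ℂ 𝔤) (δ : Module.Dual ℂ 𝔤) (c : Charges)
    (X Y : Fin dg → Poly N) :
    cocycleGauge J κ δ c X Y = (-(1 / (2 * (Real.pi : ℂ) * Complex.I))) • functional
      (c.c₅ • (∑ a, ∑ b, κ (J a) (J b) • pairing (X a) (Y b)) +
        c.c₈ • pairing (gaugeTrace J δ X) (gaugeTrace J δ Y)) := by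
  unfold cocycleGauge
  congr 2
  have h : pairing (gaugeTrace J δ X) (gaugeTrace J δ Y) =
      ∑ a, ∑ b, (δ (J a) * δ (J b)) • pairing (X a) (Y b) := by
    simp only [← obsPairing_apply, gaugeTrace]
    rw [map_sum obsPairing, LinearMap.sum_apply]
    refine Finset.sum_congr rfl fun a _ => ?_
    rw [map_sum]
    refine Finset.sum_congr rfl fun b _ => ?_
    rw [map_smul, map_smul, LinearMap.smul_apply, smul_smul, mul_comm]
  rw [h, Finset.smul_sum, Finset.smul_sum, ← Finset.sum_add_distrib]
  refine Finset.sum_congr rfl fun a _ => ?_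
  rw [Finset.smul_sum, Finset.smul_sum, ← Finset.sum_add_distrib]
  refine Finset.sum_congr rfl fun b _ => ?_
  rw [← Finset.smul_sum, smul_smul, smul_smul, ← add_smul, mul_assoc]
  rfl

theorem cocycleDiffGauge_eq (δ : Module.Dual ℂ 𝔤) (c : Charges) (ξ : VecField N)
    (X : Fin dg → Poly N) :
    cocycleDiffGauge J δ c ξ X = (-(c.c₇ / (2 * (Real.pi : ℂ) * Complex.I))) • functional
      (pairing (divergence ξ) (gaugeTrace J δ X)) := by
  have h : pairing (divergence ξ) (gaugeTrace J δ X) = ∑ a, ∑ ρ, δ (J a) •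
      (velocity ρ * atTraj (X a * MvPolynomial.pderiv ρ (divergence ξ))) := by
    rw [← obsPairing_apply, gaugeTrace, map_sum]
    refine Finset.sum_congr rfl fun a _ => ?_
    rw [← Finset.smul_sum, map_smul, obsPairing_apply, pairing]
    refine congrArg (fun P => δ (J a) • P) (Finset.sum_congr rfl fun ρ _ => ?_)
    rw [mul_comm (X a)]
  rw [h, cocycleDiffGauge]

theorem cocycleRepGauge_eq (δ : Module.Dual ℂ 𝔤) (c : Charges) (f : Trig)
    (X : Fin dg → Poly N) :
    cocycleRepGauge J δ c f X = (1 / (4 * (Real.pi : ℂ) * Complex.I)) • functional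
      (MvPolynomial.C (c.c₆ • trigDeriv (trigDeriv f) - (Complex.I * c.a₆) • trigDeriv f) *
        atTraj (gaugeTrace J δ X)) := by
  unfold cocycleRepGauge
  congr 2
  simp only [gaugeTrace, map_sum, map_smul, Finset.mul_sum, mul_smul_comm]

theorem trajVariation_add (ξ : VecField N) (f : Trig) :
    trajVariation ξ f = trajVariation ξ 0 + trajVariation 0 f := by
  funext μ
  simp [trajVariation, sub_eq_add_neg]

theorem variation_add (Q Q' : Fin N → DiffPoly N) (P : DiffPoly N) :
    variation (Q + Q') P = variation Q P + variation Q' P := by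
  have h : variation (Q + Q') = variation Q + variation Q' := by
    apply MvPolynomial.derivation_ext
    rintro ⟨μ, k⟩
    have hk : ∀ (k : ℕ) (A B : DiffPoly N),
        (totalDeriv N)^[k] (A + B) = (totalDeriv N)^[k] A + (totalDeriv N)^[k] B := by
      intro k
      induction k with
      | zero => intro A B; rfl
      | succ k ih => intro A B; rw [Function.iterate_succ_apply, map_add, ih]; rfl
    rw [Derivation.add_apply, variation, variation, variation, MvPolynomial.mkDerivation_X,
      MvPolynomial.mkDerivation_X, MvPolynomial.mkDerivation_X, Pi.add_apply, hk]
  rw [h, Derivation.add_apply]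

theorem functional_surjective : Function.Surjective (functional : DiffPoly N →ₗ[ℂ] Obs N) :=
  Submodule.mkQ_surjective _

theorem variationObs_functional (Q : Fin N → DiffPoly N) (P : DiffPoly N) :
    variationObs Q (functional P) = functional (variation Q P) := rfl

end Cocycles

/-! ## The realization -/

section DGRORealization

variable {N p dV dM dg : ℕ} {s : Parity} {F : Type*} [AddCommGroup F] [Module ℂ F]
  (R : ModeRep N (JetIdx N p dV dM) s F)
  (ϱ : Matrix (Fin N) (Fin N) ℂ →ₗ⁅ℂ⁆ Matrix (Fin dV) (Fin dV) ℂ)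
  {𝔤 : Type*} [LieRing 𝔤] [LieAlgebra ℂ 𝔤] (J : Module.Basis (Fin dg) ℂ 𝔤)
  (M : 𝔤 →ₗ⁅ℂ⁆ Matrix (Fin dM) (Fin dM) ℂ)

/-- The operator `ℒ_ξ + 𝒥_X`. -/
def ModeRep.geomInt (ξ : VecField N) (X : Fin dg → Poly N) : Module.End ℂ F :=
  R.firstOrderInt ξ (jetBaseMat J p ϱ M ξ X)

/-- The linear map from `DGRO(N, 𝔤)` to operators. -/
def ModeRep.realization (lam w c : ℂ) : DGRO N dg →ₗ[ℂ] Module.End ℂ F where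
  toFun x := R.geomInt ϱ J M x.1 x.2.2.1 + smearLin (R.repF lam w c) x.2.1 + R.obsInt x.2.2.2
  map_add' x y := by
    simp only [ModeRep.geomInt, ModeRep.firstOrderInt, Prod.fst_add, Prod.snd_add, map_add,
      R.vecF_add, jetBaseMat_add, R.bilF_add]
    abel
  map_smul' a x := by
    simp only [ModeRep.geomInt, ModeRep.firstOrderInt, Prod.smul_fst, Prod.smul_snd, map_smul,
      R.vecF_smul, jetBaseMat_smul, R.bilF_smul, ← smul_add, RingHom.id_apply]

theorem ModeRep.realization_apply (lam w c : ℂ) (ξ : VecField N) (f : Trig) (X : Fin dg → Poly N)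
    (a : Obs N) : R.realization ϱ J M lam w c (ξ, f, X, a) =
      R.geomInt ϱ J M ξ X + smearLin (R.repF lam w c) f + R.obsInt a := rfl

theorem ModeRep.commutator_geomInt_obsInt (ξ : VecField N) (X : Fin dg → Poly N) (a : Obs N) :
    R.geomInt ϱ J M ξ X * R.obsInt a - R.obsInt a * R.geomInt ϱ J M ξ X =
      R.obsInt (variationObs (trajVariation ξ 0) a) := by
  obtain ⟨P, rfl⟩ := functional_surjective a
  exact R.commutator_firstOrderInt_diffInt ξ _ P

theorem ModeRep.commutator_smear_obsInt (lam w c : ℂ) (f : Trig) (a : Obs N) :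
    smearLin (R.repF lam w c) f * R.obsInt a - R.obsInt a * smearLin (R.repF lam w c) f =
      R.obsInt (variationObs (trajVariation 0 f) a) := by
  obtain ⟨P, rfl⟩ := functional_surjective a
  exact R.commutator_smear_diffInt lam w c f P

theorem ModeRep.obsInt_commute (a b : Obs N) : R.obsInt a * R.obsInt b = R.obsInt b * R.obsInt a := by
  obtain ⟨P, rfl⟩ := functional_surjective a
  obtain ⟨Q, rfl⟩ := functional_surjective b
  exact R.diffInt_commute P Q

theorem ModeRep.obsInt_variationObs_add (ξ : VecField N) (f : Trig) (a : Obs N) :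
    R.obsInt (variationObs (trajVariation ξ f) a) =
      R.obsInt (variationObs (trajVariation ξ 0) a) +
        R.obsInt (variationObs (trajVariation 0 f) a) := by
  obtain ⟨P, rfl⟩ := functional_surjective a
  rw [trajVariation_add, variationObs_functional, variationObs_functional,
    variationObs_functional, variation_add, map_add, map_add]

variable {ϱ M} {k₀ k₁ k₂ y z u : ℂ} {κ : LinearMap.BilinForm ℂ 𝔤} {δ : Module.Dual ℂ 𝔤}

/-- The classical part is `jetBaseMat_bracket`. The remaining six pairings are treated as
independent symbols after antisymmetry has removed the pairing of the divergence of η with the trace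
of X, and the charges are read off as their coefficients. -/
theorem ModeRep.commutator_geomInt (lam w : ℂ)
    (hk₀ : ∀ μ ν, (ϱ (glUnit μ ν)).trace = k₀ * (if μ = ν then 1 else 0))
    (hk : ∀ μ ν σ τ, (ϱ (glUnit μ ν) * ϱ (glUnit σ τ)).trace =
      k₁ * ((if μ = τ then 1 else 0) * (if σ = ν then 1 else 0)) +
        k₂ * ((if μ = ν then 1 else 0) * (if σ = τ then 1 else 0)))
    (hz : ∀ x : 𝔤, (M x).trace = z * δ x)
    (hyw : ∀ x x' : 𝔤, (M x * M x').trace = y * κ x x' + u * (δ x * δ x'))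
    (ξ η : VecField N) (X Y : Fin dg → Poly N) :
    R.geomInt ϱ J M ξ X * R.geomInt ϱ J M η Y - R.geomInt ϱ J M η Y * R.geomInt ϱ J M ξ X =
      R.geomInt ϱ J M (vecBracket ξ η) (gaugeBracket J X Y + alongVec ξ Y - alongVec η X) +
        R.obsInt (cocycleDiff (fockCharges N p dV dM s lam w k₀ k₁ k₂ y z u) ξ η +
          cocycleGauge J κ δ (fockCharges N p dV dM s lam w k₀ k₁ k₂ y z u) X Y +
          (cocycleDiffGauge J δ (fockCharges N p dV dM s lam w k₀ k₁ k₂ y z u) ξ Y -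
            cocycleDiffGauge J δ (fockCharges N p dV dM s lam w k₀ k₁ k₂ y z u) η X)) := by
  rw [ModeRep.geomInt, ModeRep.geomInt, R.commutator_firstOrderInt, ModeRep.geomInt,
    jetBaseMat_bracket, jetBaseMat_trace_mul J R.pairInt p hk₀ hk hz hyw, cocycleDiff_eq,
    cocycleGauge_eq, cocycleDiffGauge_eq, cocycleDiffGauge_eq]
  simp only [map_add, map_sub, map_smul, map_sum, R.obsInt_functional, R.diffInt_pairing,
    R.pairInt_antisymm (divergence η) (gaugeTrace J δ X)]
  generalize ∑ μ, ∑ ν, R.pairInt (MvPolynomial.pderiv ν (ξ μ)) (MvPolynomial.pderiv μ (η ν)) = G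
  generalize ∑ a, ∑ b, κ (J a) (J b) • R.pairInt (X a) (Y b) = K
  generalize R.pairInt (divergence ξ) (divergence η) = DD
  generalize R.pairInt (divergence ξ) (gaugeTrace J δ Y) = DX
  generalize R.pairInt (gaugeTrace J δ X) (divergence η) = XD
  generalize R.pairInt (gaugeTrace J δ X) (gaugeTrace J δ Y) = XX
  rw [sub_eq_add_neg]
  congr 1
  simp only [fockCharges]
  have hpi : (Real.pi : ℂ) ≠ 0 := by simp [Real.pi_ne_zero]
  -- 1/i = -i converts the normalization of the cocycles into the factor of the Schwinger term.
  have hI : ∀ t : ℂ, t / (2 * (Real.pi : ℂ) * Complex.I) =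
      -(t * (Complex.I * (1 / (2 * (Real.pi : ℂ))))) := by
    intro t
    field_simp
    simp
  simp only [hI]
  module

theorem ModeRep.commutator_smear_geomInt (lam w c : ℂ)
    (hk₀ : ∀ μ ν, (ϱ (glUnit μ ν)).trace = k₀ * (if μ = ν then 1 else 0))
    (hz : ∀ x : 𝔤, (M x).trace = z * δ x)
    (f : Trig) (ξ : VecField N) (X : Fin dg → Poly N) :
    smearLin (R.repF lam w c) f * R.geomInt ϱ J M ξ X -
      R.geomInt ϱ J M ξ X * smearLin (R.repF lam w c) f =
      R.obsInt (cocycleRepDiff (fockCharges N p dV dM s lam w k₀ k₁ k₂ y z u) f ξ +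
        cocycleRepGauge J δ (fockCharges N p dV dM s lam w k₀ k₁ k₂ y z u) f X) := by
  have hs : ∀ (a : ℂ) (g : Trig),
      (MvPolynomial.C (a • g) : DiffPoly N) = a • MvPolynomial.C g := fun a g =>
    (MvPolynomial.smul_monomial a).symm
  have hC : ∀ (a b : ℂ) (g h : Trig) (P : DiffPoly N),
      MvPolynomial.C (a • g - b • h) * P =
        a • (MvPolynomial.C g * P) - b • (MvPolynomial.C h * P) := by
    intro a b g h P
    rw [map_sub, sub_mul, hs, hs, smul_mul_assoc,
      smul_mul_assoc]
  have hC1 : ∀ (b : ℂ) (g h : Trig) (P : DiffPoly N),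
      MvPolynomial.C (g - b • h) * P =
        MvPolynomial.C g * P - b • (MvPolynomial.C h * P) := by
    intro b g h P
    rw [map_sub, sub_mul, hs, smul_mul_assoc]
  rw [ModeRep.geomInt, R.commutator_smear_firstOrderInt, jetBaseMat_trace J p hk₀ hz,
    cocycleRepGauge_eq, cocycleRepDiff]
  simp only [hC, hC1]
  simp only [map_add, map_sub, map_smul, mul_add, mul_smul_comm, R.obsInt_functional,
    fockCharges]
  generalize R.diffInt (MvPolynomial.C (trigDeriv (trigDeriv f)) * atTraj (divergence ξ)) = A₁
  generalize R.diffInt (MvPolynomial.C (trigDeriv f) * atTraj (divergence ξ)) = A₂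
  generalize R.diffInt (MvPolynomial.C (trigDeriv (trigDeriv f)) * atTraj (gaugeTrace J δ X)) = A₃
  generalize R.diffInt (MvPolynomial.C (trigDeriv f) * atTraj (gaugeTrace J δ X)) = A₄
  generalize 1 / (4 * (Real.pi : ℂ) * Complex.I) = t
  module

end DGRORealization

end JetFock

end

noncomputable section

namespace JetFock

/-! ## The brackets -/

section Brackets

theorem commutator_of_three {A : Type*} [Ring A] {T T' L L' O O' TT LT LT' LL TO T'O LO L'O : A}
    (h₁ : T * T' - T' * T = TT) (h₂ : L * T' - T' * L = LT) (h₃ : L' * T - T * L' = LT')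
    (h₄ : L * L' - L' * L = LL) (h₅ : T * O' - O' * T = TO) (h₆ : T' * O - O * T' = T'O)
    (h₇ : L * O' - O' * L = LO) (h₈ : L' * O - O * L' = L'O) (h₉ : O * O' = O' * O) :
    (T + L + O) * (T' + L' + O') - (T' + L' + O') * (T + L + O) =
      TT + LT - LT' + LL + TO + LO - T'O - L'O := by
  subst h₁ h₂ h₃ h₄ h₅ h₆ h₇ h₈
  simp only [add_mul, mul_add, h₉]
  abel

variable {N p dV dM dg : ℕ} {s : Parity} {F : Type*} [AddCommGroup F] [Module ℂ F]
  (R : ModeRep N (JetIdx N p dV dM) s F)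
  {ϱ : Matrix (Fin N) (Fin N) ℂ →ₗ⁅ℂ⁆ Matrix (Fin dV) (Fin dV) ℂ}
  {𝔤 : Type*} [LieRing 𝔤] [LieAlgebra ℂ 𝔤] (J : Module.Basis (Fin dg) ℂ 𝔤)
  {M : 𝔤 →ₗ⁅ℂ⁆ Matrix (Fin dM) (Fin dM) ℂ}
  {k₀ k₁ k₂ y z u : ℂ} {κ : LinearMap.BilinForm ℂ 𝔤} {δ : Module.Dual ℂ 𝔤}

theorem JetIdx.card : (Fintype.card (JetIdx N p dV dM) : ℂ) =
    ((N + p).choose p : ℂ) * ((dV : ℂ) * dM) := by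
  rw [Fintype.card_prod, Fintype.card_prod, Fintype.card_fin, Fintype.card_fin, MultiIdx.card]
  push_cast
  ring

/-- The normalization constant of `L(t)`. -/
def repConst (N p dV dM : ℕ) (s : Parity) (lam w : ℂ) : ℂ :=
  s.sgn * ((N + p).choose p : ℂ) * ((dV : ℂ) * dM) *
      ((lam - lam ^ 2 - w + w ^ 2) / (4 * (Real.pi : ℂ) * Complex.I))

theorem ModeRep.geomInt_zero (ϱ : Matrix (Fin N) (Fin N) ℂ →ₗ⁅ℂ⁆ Matrix (Fin dV) (Fin dV) ℂ)
    (M : 𝔤 →ₗ⁅ℂ⁆ Matrix (Fin dM) (Fin dM) ℂ) : R.geomInt ϱ J M 0 0 = 0 := by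
  have h := R.realization_apply ϱ J M 0 0 0 0 0 0 0
  rw [map_zero, map_zero, add_zero, add_zero] at h
  exact h.symm.trans (map_zero _)

theorem ModeRep.commutator_smear (lam w : ℂ) (f g : Trig) :
    smearLin (R.repF lam w (repConst N p dV dM s lam w)) f *
        smearLin (R.repF lam w (repConst N p dV dM s lam w)) g -
      smearLin (R.repF lam w (repConst N p dV dM s lam w)) g *
        smearLin (R.repF lam w (repConst N p dV dM s lam w)) f =
      smearLin (R.repF lam w (repConst N p dV dM s lam w)) (circleBracket f g) +
        R.obsInt (cocycleRep (fockCharges N p dV dM s lam w k₀ k₁ k₂ y z u) f g) := by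
  rw [cocycleRep, map_smul, R.obsInt_functional]
  refine R.commutator_smear_smear lam w f g ?_ ?_
  · rw [JetIdx.card, repConst]
    ring
  · rw [JetIdx.card]
    simp only [fockCharges]
    ring

theorem ModeRep.realization_bracket (lam w : ℂ)
    (hk₀ : ∀ μ ν, (ϱ (glUnit μ ν)).trace = k₀ * (if μ = ν then 1 else 0))
    (hk : ∀ μ ν σ τ, (ϱ (glUnit μ ν) * ϱ (glUnit σ τ)).trace =
      k₁ * ((if μ = τ then 1 else 0) * (if σ = ν then 1 else 0)) +
        k₂ * ((if μ = ν then 1 else 0) * (if σ = τ then 1 else 0)))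
    (hz : ∀ x : 𝔤, (M x).trace = z * δ x)
    (hyw : ∀ x x' : 𝔤, (M x * M x').trace = y * κ x x' + u * (δ x * δ x'))
    (a b : DGRO N dg) :
    R.realization ϱ J M lam w (repConst N p dV dM s lam w)
        (dgroBracket J κ δ (fockCharges N p dV dM s lam w k₀ k₁ k₂ y z u) a b) =
      R.realization ϱ J M lam w (repConst N p dV dM s lam w) a *
          R.realization ϱ J M lam w (repConst N p dV dM s lam w) b -
        R.realization ϱ J M lam w (repConst N p dV dM s lam w) b *
          R.realization ϱ J M lam w (repConst N p dV dM s lam w) a := by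
  obtain ⟨ξ, f, X, a⟩ := a
  obtain ⟨η, g, Y, b⟩ := b
  rw [dgroBracket, R.realization_apply, R.realization_apply, R.realization_apply]
  rw [commutator_of_three (R.commutator_geomInt J lam w hk₀ hk hz hyw ξ η X Y)
    (R.commutator_smear_geomInt (k₁ := k₁) (k₂ := k₂) (y := y) (u := u) J lam w _ hk₀ hz f η Y)
    (R.commutator_smear_geomInt (k₁ := k₁) (k₂ := k₂) (y := y) (u := u) J lam w _ hk₀ hz g ξ X)
    (R.commutator_smear (k₀ := k₀) (k₁ := k₁) (k₂ := k₂) (y := y) (z := z) (u := u) lam w f g)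
    (R.commutator_geomInt_obsInt ϱ J M ξ X b)
    (R.commutator_geomInt_obsInt ϱ J M η Y a)
    (R.commutator_smear_obsInt lam w _ f b) (R.commutator_smear_obsInt lam w _ g a)
    (R.obsInt_commute a b)]
  simp only [map_add, map_sub, R.obsInt_variationObs_add ξ f b, R.obsInt_variationObs_add η g a]
  abel

end Brackets

end JetFock

end

noncomputable section

namespace JetFock

/-! ## Comparison with the explicit operators -/

section Comparison

variable {N : ℕ} {ι : Type} [DecidableEq ι] {s : Parity} {F : Type*} [AddCommGroup F] [Module ℂ F]

section AnyIndex

variable (R : ModeRep N ι s F)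

theorem ModeRep.polyField_eq_trajQ (P : Poly N) :
    polyField (fun μ => (R.fq μ : OpField F)) P = (R.trajQ P : RField F) := by
  rw [polyField_fq, R.diffQ_atTraj]

theorem ModeRep.mulField_trajPhi (P : Poly N) (A : ι) :
    mulField (polyField (fun μ => (R.fq μ : OpField F)) P) (R.fphi A) = R.trajPhi P A := by
  rw [R.polyField_eq_trajQ, (R.QF_fphi _ A).mulField_eq]
  rfl

theorem coe_tder_iterate (k : ℕ) (A : RField F) :
    ((tder^[k] A : RField F) : OpField F) = timeDeriv^[k] (A : OpField F) := by
  induction k with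
  | zero => rfl
  | succ k ih => rw [Function.iterate_succ_apply', Function.iterate_succ_apply', coe_tder, ih]

/-- The field `d^k q^μ / dt^k`. -/
def ModeRep.jetQ (v : Fin N × ℕ) : R.QF := R.qder^[v.2] (R.coordQ v.1)

theorem ModeRep.coe_jetQ (v : Fin N × ℕ) :
    ((R.jetQ v : RField F) : OpField F) = timeDeriv^[v.2] (R.fq v.1 : OpField F) := by
  rw [ModeRep.jetQ, coe_qder_iterate, coe_tder_iterate]
  rfl

theorem ModeRep.circInt_trigQ_mul (f : Trig) (A : R.QF) :
    circInt ((R.trigQ f * A : R.QF) : RField F) = smearLin (A : RField F) f := by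
  induction f using AddMonoidAlgebra.induction_linear with
  | zero => rw [map_zero, map_zero, zero_mul]; exact map_zero _
  | add f g hf hg => rw [map_add, map_add, add_mul, Submodule.coe_add, map_add, hf, hg]
  | single r c =>
    rw [R.trigQ_single, smul_mul_assoc, Submodule.coe_smul, map_smul, smearLin_single]
    rw [R.circInt_expQ_mul, modeInt_apply]

theorem ModeRep.sum_smear_monoField (P : DiffPoly N) :
    ∑ m ∈ P.support, smear (P.coeff m)
      (monoField (fun v : Fin N × ℕ => timeDeriv^[v.2] (R.fq v.1 : OpField F)) m) =
      R.diffInt P := by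
  rw [R.diffInt_apply]
  have h : R.diffQ P = ∑ m ∈ P.support,
      R.trigQ (P.coeff m) * m.prod fun v k => R.jetQ v ^ k := by
    conv_lhs => rw [MvPolynomial.as_sum P]
    rw [map_sum]
    refine Finset.sum_congr rfl fun m _ => ?_
    rw [MvPolynomial.monomial_eq, map_mul, R.diffQ_C, Finsupp.prod, map_prod, Finsupp.prod]
    refine congrArg _ (Finset.prod_congr rfl fun v _ => ?_)
    rw [map_pow, R.diffQ_X]
    rfl
  rw [h, AddSubmonoidClass.coe_finsetSum, map_sum]
  refine Finset.sum_congr rfl fun m _ => ?_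
  rw [R.circInt_trigQ_mul, ← smear_eq, ← monoField_eq]
  simp only [R.coe_jetQ]

theorem ModeRep.opLocallyFinite_wordField {σ : Type*} (Q : σ → R.QF) (a : σ) (l : List σ) (k : ℤ) :
    OpLocallyFinite (mulTerm ((Q a : RField F) : OpField F)
      (wordField (fun b => ((Q b : RField F) : OpField F)) l) k) := by
  rw [wordField_eq]
  exact (R.QF_commute _ _).opLocallyFinite k

theorem ModeRep.opLocallyFinite_jet (v : Fin N × ℕ) (l : List (Fin N × ℕ)) (k : ℤ) :
    OpLocallyFinite (mulTerm (timeDeriv^[v.2] (R.fq v.1 : OpField F))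
      (wordField (fun v : Fin N × ℕ => timeDeriv^[v.2] (R.fq v.1 : OpField F)) l) k) := by
  have h := R.opLocallyFinite_wordField R.jetQ v l k
  simpa only [R.coe_jetQ] using h

theorem ModeRep.opLocallyFinite_trajPhi (P : Poly N) (A : ι) (k : ℤ) :
    OpLocallyFinite (mulTerm (polyField (fun μ => (R.fq μ : OpField F)) P) (R.fphi A) k) := by
  rw [R.polyField_eq_trajQ]
  exact (R.QF_fphi _ A).opLocallyFinite k

theorem ModeRep.opLocallyFinite_fp_traj (μ : Fin N) (P : Poly N) (k : ℤ) :
    OpLocallyFinite (normalTerm 1 (R.fp μ : OpField F)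
      (polyField (fun μ => (R.fq μ : OpField F)) P) k) := by
  rw [R.polyField_eq_trajQ]
  exact opLocallyFinite_normalTerm _ _ _ k

theorem ModeRep.opLocallyFinite_fpi_trajPhi (P : Poly N) (A B : ι) (k : ℤ) :
    OpLocallyFinite (normalTerm s.sgn (R.fpi A : OpField F)
      (mulField (polyField (fun μ => (R.fq μ : OpField F)) P) (R.fphi B)) k) := by
  rw [R.mulField_trajPhi]
  exact opLocallyFinite_normalTerm _ _ _ k

variable [Fintype ι]

theorem ModeRep.smear_rep (lam w c : ℂ) (f : Trig) :
    smear f (fun k => -∑ μ, normalOrdered 1 (R.fp μ) (timeDeriv (R.fq μ)) k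
      + s.sgn • ∑ A : ι, (-normalOrdered s.sgn (R.fpi A) (timeDeriv (R.fphi A)) k
          + lam • timeDeriv (normalOrdered s.sgn (R.fpi A) (R.fphi A)) k
          + (Complex.I * w) • normalOrdered s.sgn (R.fpi A) (R.fphi A) k)
      + c • oneField k) = smearLin (R.repF lam w c) f := by
  rw [← smear_eq]
  congr 1
  funext k
  rw [ModeRep.repF, RField.add_apply, RField.add_apply, ModeRep.repTrajF, RField.neg_apply,
    RField.sum_apply, ModeRep.repMatF, RField.smul_apply, RField.sum_apply]
  rfl

end AnyIndex

section JetIndex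

variable {p dV dM : ℕ} (R : ModeRep N (JetIdx N p dV dM) s F)

/-- The restriction |m| ≤ |n| in the definition costs nothing, because jet matrices vanish on the
other pairs. -/
theorem ModeRep.bilF_apply {A : Matrix (JetIdx N p dV dM) (JetIdx N p dV dM) (Poly N)}
    {B : (Fin N → ℕ) → (Fin N → ℕ) → Matrix (VIdx dV dM) (VIdx dV dM) (Poly N)}
    (h : ∀ (m n : MultiIdx N p) (β α : VIdx dV dM),
      A (β, n) (α, m) = if m.len ≤ n.len then B m.exps n.exps β α else 0) (k : ℤ) :
    -s.sgn • ∑ m : MultiIdx N p, ∑ n : MultiIdx N p, (if m.len ≤ n.len then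
      ∑ β, ∑ α, normalOrdered s.sgn (R.fpi (β, n))
        (mulField (polyField (fun μ => (R.fq μ : OpField F)) (B m.exps n.exps β α))
          (R.fphi (α, m))) k else 0) = R.bilF A k := by
  have h₀ : ∀ i j, nop s.sgn (R.fpi i) (R.trajPhi 0 j) = 0 := by
    intro i j
    have : R.trajPhi 0 j = 0 := by
      rw [ModeRep.trajPhi, map_zero]
      exact congrArg (fun T : RField F →ₗ[ℂ] RField F => T (R.fphi j)) (map_zero (nop 1))
    rw [this, map_zero]
  rw [ModeRep.bilF, RField.smul_apply, RField.sum_apply]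
  congr 1
  have h₁ : ∀ (m n : MultiIdx N p), (if m.len ≤ n.len then
      ∑ β, ∑ α, normalOrdered s.sgn (R.fpi (β, n))
        (mulField (polyField (fun μ => (R.fq μ : OpField F)) (B m.exps n.exps β α))
          (R.fphi (α, m))) k else 0) =
      ∑ β, ∑ α, nop s.sgn (R.fpi (β, n)) (R.trajPhi (A (β, n) (α, m)) (α, m)) k := by
    intro m n
    split_ifs with hmn
    · refine Finset.sum_congr rfl fun β _ => Finset.sum_congr rfl fun α _ => ?_
      rw [h, if_pos hmn, R.mulField_trajPhi]
      rfl
    · symm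
      refine Finset.sum_eq_zero fun β _ => Finset.sum_eq_zero fun α _ => ?_
      rw [h, if_neg hmn, h₀]
      rfl
  simp only [h₁, RField.sum_apply, Fintype.sum_prod_type (α₁ := VIdx dV dM)]
  rw [Finset.sum_comm]
  rw [Finset.sum_comm (s := (Finset.univ : Finset (VIdx dV dM)))]
  refine Finset.sum_congr rfl fun n _ => ?_
  rw [Finset.sum_comm]
  refine Finset.sum_congr rfl fun β _ => ?_
  rw [Finset.sum_comm]

theorem ModeRep.smear_bil {A : Matrix (JetIdx N p dV dM) (JetIdx N p dV dM) (Poly N)}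
    {B : (Fin N → ℕ) → (Fin N → ℕ) → Matrix (VIdx dV dM) (VIdx dV dM) (Poly N)}
    (h : ∀ (m n : MultiIdx N p) (β α : VIdx dV dM),
      A (β, n) (α, m) = if m.len ≤ n.len then B m.exps n.exps β α else 0) :
    smear 1 (fun k => -s.sgn • ∑ m : MultiIdx N p, ∑ n : MultiIdx N p, if m.len ≤ n.len then
      ∑ β, ∑ α, normalOrdered s.sgn (R.fpi (β, n))
        (mulField (polyField (fun μ => (R.fq μ : OpField F)) (B m.exps n.exps β α))
          (R.fphi (α, m))) k else 0) = R.firstOrderInt 0 A := by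
  have hv : R.vecF 0 = 0 := by simpa using R.vecF_smul 0 0
  rw [ModeRep.firstOrderInt, hv, zero_add, ← smear_one]
  exact congrArg _ (funext fun k => R.bilF_apply h k)

theorem ModeRep.smear_vec_bil {A : Matrix (JetIdx N p dV dM) (JetIdx N p dV dM) (Poly N)}
    {B : (Fin N → ℕ) → (Fin N → ℕ) → Matrix (VIdx dV dM) (VIdx dV dM) (Poly N)}
    (h : ∀ (m n : MultiIdx N p) (β α : VIdx dV dM),
      A (β, n) (α, m) = if m.len ≤ n.len then B m.exps n.exps β α else 0) (ξ : VecField N) :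
    smear 1 (fun k => ∑ μ, normalOrdered 1 (R.fp μ)
        (polyField (fun μ => (R.fq μ : OpField F)) (ξ μ)) k
      + (fun k => -s.sgn • ∑ m : MultiIdx N p, ∑ n : MultiIdx N p, if m.len ≤ n.len then
          ∑ β, ∑ α, normalOrdered s.sgn (R.fpi (β, n))
            (mulField (polyField (fun μ => (R.fq μ : OpField F)) (B m.exps n.exps β α))
              (R.fphi (α, m))) k else 0) k) = R.firstOrderInt ξ A := by
  rw [ModeRep.firstOrderInt, ← smear_one]
  refine congrArg _ (funext fun k => ?_)
  rw [RField.add_apply, ← R.bilF_apply h, ModeRep.vecF, RField.sum_apply]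
  congr 1
  refine Finset.sum_congr rfl fun μ _ => ?_
  rw [R.polyField_eq_trajQ]
  rfl

end JetIndex

end Comparison

/-! ## The Fock space as a representation of the modes -/

section FockRep

variable {N : ℕ} {ι : Type} [DecidableEq ι] {s : Parity}

theorem heisMode_mul (x y : Mode N ι) : heisMode s x * heisMode s y =
    exchangeSign s x y • (heisMode s y * heisMode s x) +
      algebraMap ℂ (Heis N ι s) (modeBracket s x y) := by
  have h := RingQuot.mkAlgHom_rel ℂ (HeisRel.exchange (s := s) x y)
  simpa [heisMode] using h

theorem modeOp_mul (x y : Mode N ι) : modeOp s x * modeOp s y =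
    exchangeSign s x y • (modeOp s y * modeOp s x) +
      modeBracket s x y • (1 : Module.End ℂ (Fock N ι s)) := by
  unfold modeOp
  rw [← map_mul, heisMode_mul, map_add, map_smul, map_mul, AlgHom.commutes,
    Algebra.algebraMap_eq_smul_one]

/-- The vacuum. -/
def vacuum (N : ℕ) (ι : Type) [DecidableEq ι] (s : Parity) : Fock N ι s :=
  Submodule.Quotient.mk 1

theorem modeOp_vacuum {x : Mode N ι} (hx : x.annihilates) : modeOp s x (vacuum N ι s) = 0 := by
  have : modeOp s x (vacuum N ι s) =
      (Submodule.Quotient.mk (heisMode s x * 1) : Fock N ι s) := rfl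
  rw [this, Submodule.Quotient.mk_eq_zero, mul_one]
  exact Submodule.subset_span ⟨x, hx, rfl⟩

/-- Every vector is the image of the vacuum under a noncommutative polynomial in the modes, so
induction on that polynomial applies; the property is carried for all vectors at once to handle
products. -/
theorem fock_induction (p : Fock N ι s → Prop) (h₀ : p (vacuum N ι s))
    (hadd : ∀ u v, p u → p v → p (u + v)) (hsmul : ∀ (c : ℂ) v, p v → p (c • v))
    (hop : ∀ x v, p v → p (modeOp s x v)) (v : Fock N ι s) : p v := by
  have key : ∀ (a : FreeAlgebra ℂ (Mode N ι)) (v : Fock N ι s), p v →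
      p (RingQuot.mkAlgHom ℂ (HeisRel N ι s) a • v) := by
    intro a
    induction a using FreeAlgebra.induction with
    | grade0 c => intro v hv; rw [AlgHom.commutes, algebraMap_smul]; exact hsmul c v hv
    | grade1 x => intro v hv; exact hop x v hv
    | mul a b ha hb => intro v hv; rw [map_mul, mul_smul]; exact ha _ (hb v hv)
    | add a b ha hb => intro v hv; rw [map_add, add_smul]; exact hadd _ _ (ha v hv) (hb v hv)
  obtain ⟨b, rfl⟩ := Submodule.Quotient.mk_surjective _ v
  obtain ⟨a, rfl⟩ := RingQuot.mkAlgHom_surjective ℂ (HeisRel N ι s) b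
  have e : RingQuot.mkAlgHom ℂ (HeisRel N ι s) a • vacuum N ι s =
      Submodule.Quotient.mk (RingQuot.mkAlgHom ℂ (HeisRel N ι s) a) := by
    rw [vacuum, ← Submodule.Quotient.mk_smul, smul_eq_mul, mul_one]
  rw [← e]
  exact key a _ h₀

/-- The representation of the modes on the Fock space. -/
def fockRep (N : ℕ) (ι : Type) [DecidableEq ι] (s : Parity) : ModeRep N ι s (Fock N ι s) :=
  ModeRep.ofCyclic (modeOp s) modeOp_mul (vacuum N ι s) (fun _ hx => modeOp_vacuum hx)
    fock_induction

end FockRep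

end JetFock

end

/-- The operators `ℒ_ξ`, `L_f`, `𝒥_X` realize `DGRO(N, 𝔤)` on the Fock space of trajectories in the
space of `p`-jets. -/
theorem theorem3 (N p dV dM dg : ℕ) (s : JetFock.Parity) (lam w : ℂ)
    (ϱ : Matrix (Fin N) (Fin N) ℂ →ₗ⁅ℂ⁆ Matrix (Fin dV) (Fin dV) ℂ) (k₀ k₁ k₂ : ℂ)
    (hk₀ : ∀ μ ν, (ϱ (JetFock.glUnit μ ν)).trace = k₀ * (if μ = ν then 1 else 0))
    (hk : ∀ μ ν σ τ, (ϱ (JetFock.glUnit μ ν) * ϱ (JetFock.glUnit σ τ)).trace =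
      k₁ * ((if μ = τ then 1 else 0) * (if σ = ν then 1 else 0)) +
        k₂ * ((if μ = ν then 1 else 0) * (if σ = τ then 1 else 0)))
    {𝔤 : Type*} [LieRing 𝔤] [LieAlgebra ℂ 𝔤] (J : Module.Basis (Fin dg) ℂ 𝔤)
    (κ : LinearMap.BilinForm ℂ 𝔤) (hκ_symm : κ.IsSymm)
    (hκ_inv : ∀ x y z : 𝔤, κ ⁅x, y⁆ z = κ x ⁅y, z⁆)
    (δ : Module.Dual ℂ 𝔤) (hδ : ∀ x y : 𝔤, δ ⁅x, y⁆ = 0)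
    (M : 𝔤 →ₗ⁅ℂ⁆ Matrix (Fin dM) (Fin dM) ℂ) (y_M z_M w_M : ℂ)
    (hz : ∀ x : 𝔤, (M x).trace = z_M * δ x)
    (hyw : ∀ x y : 𝔤, (M x * M y).trace = y_M * κ x y + w_M * (δ x * δ y)) :
    JetFock.SumsLocallyFinite N p dV dM s ∧
    ∃ ρ : JetFock.DGRO N dg →ₗ[ℂ] Module.End ℂ (JetFock.JetFockSpace N p dV dM s),
      (∀ ξ : JetFock.VecField N, ρ (ξ, 0, 0, 0) = JetFock.diffOp N p dV dM s ϱ ξ) ∧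
      (∀ f : JetFock.Trig, ρ (0, f, 0, 0) = JetFock.repOp N p dV dM s lam w f) ∧
      (∀ X : Fin dg → JetFock.Poly N, ρ (0, 0, X, 0) = JetFock.gaugeOp N p dV dM s J M X) ∧
      (∀ P : JetFock.DiffPoly N, ρ (0, 0, 0, JetFock.functional P) =
        JetFock.obsOp N p dV dM s P) ∧
      ∀ x y : JetFock.DGRO N dg,
        ρ (JetFock.dgroBracket J κ δ
            (JetFock.fockCharges N p dV dM s lam w k₀ k₁ k₂ y_M z_M w_M) x y) =
          ρ x * ρ y - ρ y * ρ x := by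

  classical
  -- From here only unfolding remains: the explicit operators are the values of `R.realization` on
  -- the four summands, and local finiteness is that of products of restricted fields.
  let R := JetFock.fockRep N (JetFock.JetIdx N p dV dM) s
  refine ⟨⟨R.opLocallyFinite_jet, fun μ l k => R.opLocallyFinite_wordField R.coordQ μ l k,
    R.opLocallyFinite_trajPhi, R.opLocallyFinite_fp_traj,
    fun μ k => JetFock.opLocallyFinite_normalTerm 1 (R.fp μ) (JetFock.tder (R.fq μ)) k,
    fun P A B k => R.opLocallyFinite_fpi_trajPhi P A B k,
    fun A k => JetFock.opLocallyFinite_normalTerm s.sgn (R.fpi A) (JetFock.tder (R.fphi A)) k,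
    fun A k => JetFock.opLocallyFinite_normalTerm s.sgn (R.fpi A) (R.fphi A) k⟩,
    R.realization ϱ J M lam w (JetFock.repConst N p dV dM s lam w), fun ξ => ?_, fun f => ?_,
    fun X => ?_, fun P => ?_, R.realization_bracket J lam w hk₀ hk hz hyw⟩
  · rw [R.realization_apply, map_zero, map_zero, add_zero, add_zero, JetFock.ModeRep.geomInt,
      JetFock.jetBaseMat_zero_right]
    exact (R.smear_vec_bil (fun m n β α => JetFock.jetMat_glMat ϱ ξ m n β α) ξ).symm
  · rw [R.realization_apply, map_zero, add_zero, R.geomInt_zero J ϱ M, zero_add]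
    exact (R.smear_rep lam w _ f).symm
  · rw [R.realization_apply, map_zero, map_zero, add_zero, add_zero, JetFock.ModeRep.geomInt,
      JetFock.jetBaseMat_zero_left]
    exact (R.smear_bil (fun m n β α => JetFock.jetMat_gaugeMat J M X m n β α)).symm
  · rw [R.realization_apply, R.geomInt_zero J ϱ M, map_zero, zero_add, zero_add, R.obsInt_functional]
    exact (R.sum_smear_monoField P).symm
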